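/- Let $k$ be a finite field and let $\mathcal A$ be an essentially small hereditary abelian $k$-category (i.e. $\operatorname{Ext}^n_{\mathcal A}(X,Y)=0$ for all $n\ge 2$) all of whose $\operatorname{Hom}$ and $\operatorname{Ext}$ spaces are finite-dimensional over $k$. Let $\mathcal C=\mathcal C_{\mathbb Z/2}(\mathcal A)$ be the abelian category of $\mathbb Z/2$-graded complexes $M^0\rightleftarrows M^1$ (with $d^1d^0=0=d^0d^1$) over $\mathcal A$. For $X\in\mathcal A$ let $K_X$ (resp. $K_X^*$) be the complex with $X$ in both degrees and $d^0=1,\ d^1=0$ (resp. $d^0=0,\ d^1=1$), and let $C_X$ (resp. $C_X^*$) be the complex with $X$ in degree $1$ (resp. $0$) and $0$ in the other degree. Let $\mathcal H(\mathcal C)$ be the $\mathbb Q$-vector space with basis the isomorphism classes $[M]$ of objects of $\mathcal C$, with the product $$[L]\diamond[M]=\sum_{[X]}\frac{|\operatorname{Ext}^1_{\mathcal C}(L,M)_X|}{|\operatorname{Hom}_{\mathcal C}(L,M)|}\,[X],$$ where $\operatorname{Ext}^1_{\mathcal C}(L,M)_X\subseteq\operatorname{Ext}^1_{\mathcal C}(L,M)$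 is the set of classes of extensions $0\to M\to X'\to L\to0$ with $X'\cong X$. Then all groups $\operatorname{Hom}_{\mathcal C}(L,M)$ and $\operatorname{Ext}^1_{\mathcal C}(L,M)$ are finite, the sum is finite and independent of the choice of representatives, and $\mathcal H(\mathcal C)$ is an associative $\mathbb Q$-algebra with unit $[0]$. Let $I_{\mathbb Z/2}$ be the two-sided ideal of $\mathcal H(\mathcal C)$ generated by all $[L]-[K\oplus M]$ such that there is a short exact sequence $0\to K\to L\to M\to 0$ in $\mathcal C$ with $K$ acyclic, and let $S_{\mathbb Z/2}\subseteq\mathcal H(\mathcal C)/I_{\mathbb Z/2}$ be the set of all $q[K]$ with $q\in\mathbb Q^\times$ and $K$ acyclic. Then $S_{\mathbb Z/2}$ contains $1$, is closed under multiplication, right Ore and right reversible, so that the right Ore localization $$\mathcal{MH}_{\mathbb Z/2}(\mathcal A)=(\mathcal H(\mathcal C)/I_{\mathbb Z/2})[S_{\mathbb Z/2}^{-1}],$$ the modified Ringel–Hall algebra of $\mathcal A$, exists. For $X\in\mathcal A$ let $\widehat X$ be its class in the Grothendieck group $K_0(\mathcal A)$, and put $\langle X,Y\rangle=|\operatorname{Hom}_{\mathcal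 A}(X,Y)|/|\operatorname{Ext}^1_{\mathcal A}(X,Y)|$. For $\alpha\in K_0(\mathcal A)$ write $\alpha=\widehat X-\widehat Y$ with $X,Y\in\mathcal A$ and set $$K_\alpha=\frac{\langle Y,Y\rangle}{\langle X,Y\rangle}\,[K_X]\diamond[K_Y]^{-1},\qquad K_\alpha^*=\frac{\langle Y,Y\rangle}{\langle X,Y\rangle}\,[K_X^*]\diamond[K_Y^*]^{-1}$$ in $\mathcal{MH}_{\mathbb Z/2}(\mathcal A)$. Then $K_\alpha$ and $K_\alpha^*$ do not depend on the choice of $X$ and $Y$, and the elements $$[C_A\oplus C_B^*]\diamond K_\alpha\diamond K_\beta^*,\qquad [A],[B]\in\operatorname{Iso}(\mathcal A),\ \alpha,\beta\in K_0(\mathcal A),$$ indexed by the quadruples $([A],[B],\alpha,\beta)$, form a $\mathbb Q$-basis of $\mathcal{MH}_{\mathbb Z/2}(\mathcal A)$. -/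

import Mathlib

open CategoryTheory CategoryTheory.Limits CategoryTheory.Abelian

open scoped ZeroObject

-- `Ext` groups of an abelian category exist in a large enough universe; this is the standard choice.
attribute [local instance] CategoryTheory.HasExt.standard

namespace ModifiedHall

universe v u w

noncomputable section

/-! ### Isomorphism classes, the Grothendieck group, hereditary categories -/

section Categories

/-- The isomorphism classes of objects of a category. -/
def IsoClass (C : Type u) [Category.{v} C] : Type u := Quotient (isIsomorphicSetoid C)

/-- The isomorphism class of an object. -/
def IsoClass.mk {C : Type u} [Category.{v} C] (X : C) : IsoClass C :=
  Quotient.mk (isIsomorphicSetoid C) X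

/-- An object representing an isomorphism class. -/
def IsoClass.rep {C : Type u} [Category.{v} C] (x : IsoClass C) : C := Quotient.out x

variable (C : Type u) [Category.{v} C] [Abelian C]

/-- `C` is hereditary: `Ext^n(X, Y) = 0` for all objects `X`, `Y` and all `n ≥ 2`. -/
def IsHereditary : Prop := ∀ (X Y : C) (n : ℕ), 2 ≤ n → Subsingleton (Ext X Y n)

/-- The relations `X₂ - (X₁ + X₃)` for all short exact sequences `0 → X₁ → X₂ → X₃ → 0`. -/
def K0.relations : AddSubgroup (FreeAbelianGroup C) :=
  AddSubgroup.closure {z | ∃ S : ShortComplex C, S.ShortExact ∧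
    z = FreeAbelianGroup.of S.X₂ - (FreeAbelianGroup.of S.X₁ + FreeAbelianGroup.of S.X₃)}

/-- The Grothendieck group of an abelian category. -/
def K0 : Type u := FreeAbelianGroup C ⧸ K0.relations C

instance : AddCommGroup (K0 C) :=
  inferInstanceAs (AddCommGroup (FreeAbelianGroup C ⧸ K0.relations C))

variable {C}

/-- The class of an object in the Grothendieck group. -/
def K0.of (X : C) : K0 C := QuotientAddGroup.mk' (K0.relations C) (FreeAbelianGroup.of X)

lemma K0.of_biprod (X Y : C) : K0.of (X ⊞ Y) = K0.of X + K0.of Y := by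
  have h := (ShortComplex.Splitting.ofHasBinaryBiproduct X Y).shortExact
  have h' : FreeAbelianGroup.of (X ⊞ Y) - (FreeAbelianGroup.of X + FreeAbelianGroup.of Y) ∈
      K0.relations C := AddSubgroup.subset_closure ⟨_, h, rfl⟩
  have h2 := (QuotientAddGroup.eq_zero_iff _).2 h'
  exact sub_eq_zero.1 h2

lemma K0.exists_eq_sub (α : K0 C) : ∃ p : C × C, α = K0.of p.1 - K0.of p.2 := by
  obtain ⟨z, rfl⟩ := QuotientAddGroup.mk'_surjective (K0.relations C) α
  induction z using FreeAbelianGroup.induction_on with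
  | zero => exact ⟨(0, 0), by rw [sub_self]; rfl⟩
  | of X => exact ⟨(X ⊞ X, X), by rw [K0.of_biprod, add_sub_cancel_right]; rfl⟩
  | neg X _ => exact ⟨(X, X ⊞ X), by rw [K0.of_biprod, map_neg]; simp; rfl⟩
  | add x y hx hy =>
    obtain ⟨⟨a, b⟩, h⟩ := hx
    obtain ⟨⟨c, d⟩, h'⟩ := hy
    refine ⟨(a ⊞ c, b ⊞ d), ?_⟩
    rw [map_add, h, h']
    simp only [K0.of_biprod]
    abel

/-- The multiplicative Euler form `⟨X, Y⟩ = |Hom(X, Y)| / |Ext^1(X, Y)|` of a hereditary category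
with finite `Hom` and `Ext^1`, on objects. -/
def eulerForm (X Y : C) : ℚ := (Nat.card (X ⟶ Y) : ℚ) / (Nat.card (Ext X Y 1) : ℚ)

end Categories

/-! ### The Ringel-Hall algebra of an abelian category -/

section Hall

variable {C : Type u} [Category.{v} C] [Abelian C]

/-- The subset `Ext^1(L, M)_X` of `Ext^1(L, M)` of the classes of the extensions
`0 → M → X' → L → 0` with `X'` isomorphic to `X` (equivalently, with `X' = X`). -/
def extWithMiddle (L M X : C) : Set (Ext L M 1) :=
  {ξ | ∃ (f : M ⟶ X) (g : X ⟶ L) (zero : f ≫ g = 0) (hS : (ShortComplex.mk f g zero).ShortExact),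
    hS.extClass = ξ}

/-- The structure constant `|Ext^1(L, M)_X| / |Hom(L, M)|`. -/
def hallNumber (L M X : C) : ℚ := (Nat.card (extWithMiddle L M X) : ℚ) / (Nat.card (L ⟶ M) : ℚ)

variable (C) in
/-- The rational vector space with basis the isomorphism classes of objects. -/
abbrev HallSpace : Type u := IsoClass C →₀ ℚ

/-- The Hall product of two isomorphism classes,
`[L] ⋄ [M] = ∑_{[X]} |Ext^1(L, M)_X| / |Hom(L, M)| [X]`. -/
def hallBasisMul (a b : IsoClass C) : HallSpace C :=
  ∑ᶠ x : IsoClass C, Finsupp.single x (hallNumber a.rep b.rep x.rep)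

variable (C) in
/-- The Hall product, as a bilinear map. -/
def hallMul : HallSpace C →ₗ[ℚ] HallSpace C →ₗ[ℚ] HallSpace C :=
  Finsupp.linearCombination ℚ fun a => Finsupp.linearCombination ℚ fun b => hallBasisMul a b

/-- The basis vector of an object in the Hall space. -/
def HallSpace.cls (X : C) : HallSpace C := Finsupp.single (IsoClass.mk X) 1

variable (C) in
/-- The Hall product is well defined, associative and unital: all `Hom` and `Ext^1` groups are
finite, the product has the structure constants `hallNumber` (so that the sum defining it is finite
and does not depend on the choice of representatives), it is associative, and the class of the
zero object is a unit. -/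
structure IsHallAlgebra : Prop where
  finite_hom : ∀ L M : C, Finite (L ⟶ M)
  finite_ext : ∀ L M : C, Finite (Ext L M 1)
  mul_apply : ∀ L M X : C,
    hallMul C (HallSpace.cls L) (HallSpace.cls M) (IsoClass.mk X) = hallNumber L M X
  mul_assoc : ∀ x y z : HallSpace C, hallMul C (hallMul C x y) z = hallMul C x (hallMul C y z)
  one_mul : ∀ x : HallSpace C, hallMul C (HallSpace.cls 0) x = x
  mul_one : ∀ x : HallSpace C, hallMul C x (HallSpace.cls 0) = x

/-- The Ringel-Hall algebra of `C`: the vector space `HallSpace C` with the Hall product. -/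
def HallAlgebra (_h : IsHallAlgebra C) : Type u := HallSpace C

namespace HallAlgebra

variable (h : IsHallAlgebra C)

instance : AddCommGroup (HallAlgebra h) := inferInstanceAs (AddCommGroup (HallSpace C))

instance : Module ℚ (HallAlgebra h) := inferInstanceAs (Module ℚ (HallSpace C))

instance : Ring (HallAlgebra h) :=
  { (inferInstance : AddCommGroup (HallAlgebra h)) with
    mul := fun x y => hallMul C x y
    one := HallSpace.cls (0 : C)
    mul_assoc := h.mul_assoc
    one_mul := h.one_mul
    mul_one := h.mul_one
    zero_mul := fun x => LinearMap.map_zero₂ (hallMul C) x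
    mul_zero := fun x => map_zero (hallMul C x)
    left_distrib := fun x y z => map_add (hallMul C x) y z
    right_distrib := fun x y z => LinearMap.map_add₂ (hallMul C) x y z }

instance : Algebra ℚ (HallAlgebra h) :=
  Algebra.ofModule (fun r x y => LinearMap.map_smul₂ (hallMul C) r x y)
    (fun r x y => map_smul (hallMul C x) r y)

/-- The class `[X]` of an object in the Hall algebra. -/
def cls (X : C) : HallAlgebra h := HallSpace.cls X

end HallAlgebra

end Hall

/-! ### Right Ore localization -/

section Ore

variable {R : Type u} [Ring R]

/-- `S` is a multiplicatively closed, right Ore, right reversible subset of the ring `R`. -/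
structure IsRightDenominatorSet (S : Set R) : Prop where
  one_mem : 1 ∈ S
  mul_mem : ∀ s t, s ∈ S → t ∈ S → s * t ∈ S
  ore : ∀ a s, s ∈ S → ∃ a₁ s₁, s₁ ∈ S ∧ s * a₁ = a * s₁
  reversible : ∀ a s, s ∈ S → s * a = 0 → ∃ t ∈ S, a * t = 0

variable {S : Set R} (hS : IsRightDenominatorSet S)

/-- `S` as a submonoid of `R`. -/
def IsRightDenominatorSet.submonoid : Submonoid R where
  carrier := S
  one_mem' := hS.one_mem
  mul_mem' := fun {s t} hs ht => hS.mul_mem s t hs ht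

/-- A right Ore set of `R` is a left Ore set of the opposite ring. -/
instance IsRightDenominatorSet.oreSet : OreLocalization.OreSet hS.submonoid.op :=
  Classical.choice <| OreLocalization.nonempty_oreSet_iff.2 <| by
    refine ⟨fun r₁ r₂ s hrs => ?_, fun r s => ?_⟩
    · obtain ⟨t, ht, hat⟩ := hS.reversible (r₁.unop - r₂.unop) s.1.unop s.2 (by
        rw [mul_sub, sub_eq_zero]
        exact congrArg MulOpposite.unop hrs)
      refine ⟨⟨MulOpposite.op t, ht⟩, MulOpposite.unop_injective ?_⟩
      rw [sub_mul, sub_eq_zero] at hat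
      exact hat
    · obtain ⟨a, t, ht, hat⟩ := hS.ore r.unop s.1.unop s.2
      exact ⟨MulOpposite.op a, ⟨MulOpposite.op t, ht⟩, MulOpposite.unop_injective hat.symm⟩

/-- The right Ore localization `R S⁻¹`, as the opposite of the left Ore localization of the
opposite ring. -/
def RightLocalization : Type u := (OreLocalization hS.submonoid.op Rᵐᵒᵖ)ᵐᵒᵖ

namespace RightLocalization

instance : Ring (RightLocalization hS) :=
  inferInstanceAs (Ring (OreLocalization hS.submonoid.op Rᵐᵒᵖ)ᵐᵒᵖ)

instance {k : Type w} [CommSemiring k] [Algebra k R] : Algebra k (RightLocalization hS) :=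
  inferInstanceAs (Algebra k (OreLocalization hS.submonoid.op Rᵐᵒᵖ)ᵐᵒᵖ)

/-- The right fraction `a s⁻¹`. -/
def frac (a s : R) (hs : s ∈ S) : RightLocalization hS :=
  MulOpposite.op (OreLocalization.oreDiv (MulOpposite.op a)
    (⟨MulOpposite.op s, hs⟩ : hS.submonoid.op))

/-- The canonical map `R → R S⁻¹`. -/
def ofRing (a : R) : RightLocalization hS := frac hS a 1 hS.one_mem

end RightLocalization

end Ore

/-! ### `ℤ/2`-graded complexes -/

section Complexes

variable (A : Type u) [Category.{v} A] [Abelian A]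

/-- The category of `ℤ/2`-graded complexes `M⁰ ⇄ M¹`. -/
abbrev Z2Complex : Type (max u v) := HomologicalComplex A (ComplexShape.up (ZMod 2))

variable {A}

lemma rel_zero_one : (ComplexShape.up (ZMod 2)).Rel 0 1 := by decide

lemma rel_one_zero : (ComplexShape.up (ZMod 2)).Rel 1 0 := by decide

/-- `C_X`: the object `X` in degree `1`. -/
def stalk (X : A) : Z2Complex A := (HomologicalComplex.single A (ComplexShape.up (ZMod 2)) 1).obj X

/-- `C_X^*`: the object `X` in degree `0`. -/
def stalkStar (X : A) : Z2Complex A :=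
  (HomologicalComplex.single A (ComplexShape.up (ZMod 2)) 0).obj X

/-- `K_X`: the complex with `X` in both degrees, `d⁰ = 1` and `d¹ = 0`. -/
def cone (X : A) : Z2Complex A := HomologicalComplex.double (𝟙 X) rel_zero_one

/-- `K_X^*`: the complex with `X` in both degrees, `d⁰ = 0` and `d¹ = 1`. -/
def coneStar (X : A) : Z2Complex A := HomologicalComplex.double (𝟙 X) rel_one_zero

lemma acyclic_double_id (X : A) {i j : ZMod 2} (hij : (ComplexShape.up (ZMod 2)).Rel i j) :
    (HomologicalComplex.double (𝟙 X) hij).Acyclic := by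
  have hne : i ≠ j := by revert i j; decide
  have hji : (ComplexShape.up (ZMod 2)).Rel j i := by revert i j; decide
  have hk : ∀ k, k = i ∨ k = j := by revert i j; decide
  have hiso : IsIso ((HomologicalComplex.double (𝟙 X) hij).d i j) := by
    rw [HomologicalComplex.double_d (𝟙 X) hij hne]
    infer_instance
  intro k
  rcases hk k with rfl | rfl
  · rw [HomologicalComplex.exactAt_iff' _ j k j
      ((ComplexShape.up (ZMod 2)).prev_eq' hji) ((ComplexShape.up (ZMod 2)).next_eq' hij)]
    refine (ShortComplex.exact_iff_mono _ ?_).2 ?_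
    · exact HomologicalComplex.double_d_eq_zero₀ (𝟙 X) hij _ _ hne.symm
    · exact inferInstanceAs (Mono ((HomologicalComplex.double (𝟙 X) hij).d k j))
  · rw [HomologicalComplex.exactAt_iff' _ i k i
      ((ComplexShape.up (ZMod 2)).prev_eq' hij) ((ComplexShape.up (ZMod 2)).next_eq' hji)]
    refine (ShortComplex.exact_iff_epi _ ?_).2 ?_
    · exact HomologicalComplex.double_d_eq_zero₀ (𝟙 X) hij _ _ hne.symm
    · exact inferInstanceAs (Epi ((HomologicalComplex.double (𝟙 X) hij).d i k))

lemma acyclic_cone (X : A) : (cone X).Acyclic := acyclic_double_id X rel_zero_one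

lemma acyclic_coneStar (X : A) : (coneStar X).Acyclic := acyclic_double_id X rel_one_zero

end Complexes

/-! ### The modified Ringel-Hall algebra -/

section Modified

variable {A : Type u} [Category.{v} A] [Abelian A] (h : IsHallAlgebra (Z2Complex A))

/-- The two-sided ideal `I` of the Hall algebra of `ℤ/2`-graded complexes generated by the
differences `[L] - [K ⊕ M]` for all short exact sequences `0 → K → L → M → 0` with `K` acyclic. -/
def acyclicIdeal : TwoSidedIdeal (HallAlgebra h) :=
  TwoSidedIdeal.span {x | ∃ T : ShortComplex (Z2Complex A), T.ShortExact ∧ T.X₁.Acyclic ∧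
    x = HallAlgebra.cls h T.X₂ - HallAlgebra.cls h (T.X₁ ⊞ T.X₃)}

/-- The quotient of the Hall algebra of `ℤ/2`-graded complexes by the ideal `I`. -/
abbrev QuotientHallAlgebra : Type (max u v) := (acyclicIdeal h).ringCon.Quotient

/-- The class `[M]` of a complex in the quotient algebra. -/
def quotientCls (M : Z2Complex A) : QuotientHallAlgebra h :=
  (acyclicIdeal h).ringCon.mk' (HallAlgebra.cls h M)

/-- The set of all `q[K]` with `q` a nonzero rational number and `K` acyclic. -/
def acyclicClasses : Set (QuotientHallAlgebra h) :=
  {x | ∃ (q : ℚ) (K : Z2Complex A), q ≠ 0 ∧ K.Acyclic ∧ x = q • quotientCls h K}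

variable {h} in
lemma quotientCls_mem {K : Z2Complex A} (hK : K.Acyclic) : quotientCls h K ∈ acyclicClasses h :=
  ⟨1, K, one_ne_zero, hK, (one_smul ℚ (quotientCls h K)).symm⟩

variable {h} (hS : IsRightDenominatorSet (acyclicClasses h))

/-- The modified Ringel-Hall algebra: the right Ore localization of the quotient algebra at the
classes of the acyclic complexes. -/
abbrev ModifiedHallAlgebra : Type (max u v) := RightLocalization hS

/-- The class `[M]` of a complex in the modified Ringel-Hall algebra. -/
def mhCls (M : Z2Complex A) : ModifiedHallAlgebra hS :=
  RightLocalization.ofRing hS (quotientCls h M)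

/-- The element `⟨α, Y⟩⁻¹ [K_X] ⋄ [K_Y]⁻¹` with `α = X - Y` in the Grothendieck group, where
`⟨α, Y⟩ = ⟨X, Y⟩ / ⟨Y, Y⟩` since the Euler form is bilinear on the Grothendieck group. -/
def torusFrac (X Y : A) : ModifiedHallAlgebra hS :=
  (eulerForm X Y / eulerForm Y Y)⁻¹ •
    RightLocalization.frac hS (quotientCls h (cone X)) (quotientCls h (cone Y))
      (quotientCls_mem (acyclic_cone Y))

/-- The element `⟨α, Y⟩⁻¹ [K_X^*] ⋄ [K_Y^*]⁻¹` with `α = X - Y` in the Grothendieck group. -/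
def torusFracStar (X Y : A) : ModifiedHallAlgebra hS :=
  (eulerForm X Y / eulerForm Y Y)⁻¹ •
    RightLocalization.frac hS (quotientCls h (coneStar X)) (quotientCls h (coneStar Y))
      (quotientCls_mem (acyclic_coneStar Y))

/-- `K_α` for `α` in the Grothendieck group, through a choice of `X`, `Y` with `α = X - Y`. -/
def torusElt (α : K0 A) : ModifiedHallAlgebra hS :=
  torusFrac hS (K0.exists_eq_sub α).choose.1 (K0.exists_eq_sub α).choose.2

/-- `K_α^*` for `α` in the Grothendieck group, through a choice of `X`, `Y` with `α = X - Y`. -/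
def torusEltStar (α : K0 A) : ModifiedHallAlgebra hS :=
  torusFracStar hS (K0.exists_eq_sub α).choose.1 (K0.exists_eq_sub α).choose.2

end Modified

end

end ModifiedHall

/-! A single linear invariant controls everything. The index of a complex `M` consists of the
isomorphism classes of its two homology objects and the classes in `K₀` of its boundaries in degrees
`1` and `0`. Sending `[M]` to the basis vector of its index maps the Hall space to the free vector
space on quadruples. After localization this map becomes a bijection (`locMap_bijective`) that takes
each monomial to a nonzero multiple of the vector of its quadruple (`exists_locMap_monomial`).

Heredity enters in two ways. Every morphism `d : M → N` factors as a monomorphism into an extension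
`E` of `N` by `ker d` followed by `E → N` (`exists_mono_lift`). Hence every complex is joined, by
surjections whose kernels are cones, to the sum of its homology stalks (`exists_roof`,
`rel_stalk_homology`), and every acyclic complex is resolved by cones. Moreover cones are adjoint on
both sides to evaluations, so they have no `Ext²` in either variable. The resolution extends this to
all acyclic `K`, and the Euler form of `K` with any complex then depends only on indices
(`eulerForm_acyclic_right`, `eulerForm_acyclic_left`).

Consequently the elements of zero index form a two-sided ideal containing `acyclicIdeal`, and the
invariant descends to the quotient (`barMap`). There, multiplication by an acyclic class acts as an
invertible weighted translation. Conversely, complexes of equal index become equal in the quotient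
after adding an acyclic summand (`exists_stable_eq`), so an element of zero index is killed by a
denominator (`exists_mul_eq_zero`). The Ore conditions and the injectivity of `locMap` both follow
from this.

The Hall algebra itself rests on Riedtmann's formula, on counting flags for associativity, and on
embedding complexes into sums of cones for finiteness. -/

namespace ModifiedHall

universe v u w v' u'

set_option linter.unusedSectionVars false

/-! ### Effaceability of Ext classes. -/

section Effaceability

variable {C : Type u} [Category.{v} C] [Abelian C]

open HomologicalComplex DerivedCategory

/-- A quasi-isomorphism from a complex concentrated in degrees `≤ i` onto a complex concentrated in
degree `i` admits a section after composition with an epimorphism. -/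
lemma exists_single_comp_eq_map {X : C} {i : ℤ} {K : CochainComplex C ℤ} [K.IsStrictlyLE i]
    (π : K ⟶ (single C (ComplexShape.up ℤ) i).obj X) [hq : QuasiIso π] :
    ∃ (P : C) (p : P ⟶ X) (s : (single C (ComplexShape.up ℤ) i).obj P ⟶ K),
      Epi p ∧ s ≫ π = (single C (ComplexShape.up ℤ) i).map p := by
  -- In the top degree `i` everything is a cycle, so `K.X i` maps onto `H^i(K) ≅ X`; this is the
  -- required epimorphism.
  let e := K.iCyclesIso i (i + 1) (by simp)
    ((K.isZero_of_isStrictlyLE i (i + 1) (by simp)).eq_of_tgt _ _)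
  let α := e.inv ≫ K.homologyπ i ≫ homologyMap π i ≫ (singleObjHomologySelfIso _ _ _).hom
  have hα : π.f i = α ≫ (singleObjXSelf (ComplexShape.up ℤ) i X).inv := by
    rw [← cancel_epi e.hom]
    dsimp [α, e]
    rw [Category.assoc, Category.assoc, Category.assoc, Iso.hom_inv_id_assoc,
      homologyπ_naturality_assoc, homologyπ_singleObjHomologySelfIso_hom_assoc,
      ← singleObjCyclesSelfIso_inv_iCycles, Iso.hom_inv_id_assoc]
    exact (cyclesMap_i π i).symm
  let s : (single C (ComplexShape.up ℤ) i).obj (K.X i) ⟶ K := mkHomFromSingle (𝟙 _) (by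
      rintro _ rfl
      apply (K.isZero_of_isStrictlyLE i (i + 1) (by simp)).eq_of_tgt)
  refine ⟨K.X i, α, s, ?_, ?_⟩
  · dsimp only [α]
    infer_instance
  · apply HomologicalComplex.from_single_hom_ext
    rw [comp_f, hα]
    dsimp [s]
    rw [mkHomFromSingle_f, Category.comp_id, single_map_f_self]

/-- A morphism in the derived category from an object in degree `i` to a complex concentrated in
degrees `< i` is killed by an epimorphism onto that object. -/
lemma exists_epi_singleFunctor_comp_eq_zero [HasDerivedCategory.{w} C] {X : C}
    {L : CochainComplex C ℤ} {i : ℤ}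
    (φ : Q.obj ((CochainComplex.singleFunctor C i).obj X) ⟶ Q.obj L)
    (n : ℤ) (hn : n < i) [L.IsStrictlyLE n] :
    ∃ (P : C) (p : P ⟶ X), Epi p ∧ Q.map ((CochainComplex.singleFunctor C i).map p) ≫ φ = 0 := by
  obtain ⟨K, _, π, h, g, rfl⟩ := right_fac_of_isStrictlyLE φ i
  have hq := h
  rw [isIso_Q_map_iff_quasiIso] at hq
  obtain ⟨P, p, s, hp, h₁⟩ : ∃ (P : C) (p : P ⟶ X)
      (s : (CochainComplex.singleFunctor C i).obj P ⟶ K),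
      Epi p ∧ s ≫ π = (CochainComplex.singleFunctor C i).map p :=
    exists_single_comp_eq_map (hq := hq) π
  have h₂ : s ≫ g = 0 := by
    apply HomologicalComplex.from_single_hom_ext
    apply (L.isZero_of_isStrictlyLE n i hn).eq_of_tgt
  refine ⟨P, p, hp, ?_⟩
  rw [← h₁, Q.map_comp, Category.assoc, IsIso.hom_inv_id_assoc, ← Q.map_comp, h₂, Q.map_zero]

/-- A class in `Ext^(n+1)` is killed by an epimorphism. -/
lemma exists_epi_comp_eq_zero [HasExt.{w} C] {X Y : C} {n : ℕ} (e : Ext.{w} X Y (n + 1)) :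
    ∃ (P : C) (p : P ⟶ X), Epi p ∧ (Ext.mk₀ p).comp e (zero_add _) = 0 := by
  let := HasDerivedCategory.standard C
  obtain ⟨P, p, hp, h⟩ := exists_epi_singleFunctor_comp_eq_zero (X := X)
    (L := (CochainComplex.singleFunctor C (-(n + 1))).obj Y) (i := 0)
    (e.hom ≫ ((singleFunctors C).shiftIso (n + 1) (-(n + 1)) 0 (by lia)).hom.app _)
      (-(n + 1)) (by lia)
  refine ⟨P, p, hp, Ext.homEquiv.injective ?_⟩
  change Ext.hom _ = Ext.hom _
  simp only [← cancel_mono (((singleFunctors C).shiftIso (n + 1) (-(n + 1)) 0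
    (by lia)).hom.app _), Ext.zero_hom, Limits.zero_comp]
  rw [Ext.comp_hom, Ext.mk₀_hom, ShiftedHom.mk₀_comp]
  rw [Category.assoc]
  exact h

end Effaceability

/-! ### Extensions and their Ext classes. -/

section Basic

variable {C : Type u} [Category.{v} C] [Abelian C]

lemma kernel_shortExact {X Y : C} (p : X ⟶ Y) [Epi p] :
    (ShortComplex.mk (kernel.ι p) p (kernel.condition p)).ShortExact where
  exact := ShortComplex.exact_of_f_is_kernel _ (kernelIsKernel p)

lemma cokernel_shortExact {X Y : C} (i : X ⟶ Y) [Mono i] :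
    (ShortComplex.mk i (cokernel.π i) (cokernel.condition i)).ShortExact where
  exact := ShortComplex.exact_of_g_is_cokernel _ (cokernelIsCokernel i)

lemma image_shortExact {X Y : C} (f : X ⟶ Y) :
    (ShortComplex.mk (kernel.ι f) (Limits.factorThruImage f) (by
      rw [← cancel_mono (Limits.image.ι f)]; simp)).ShortExact where
  exact := by
    refine ShortComplex.exact_of_f_is_kernel _ (KernelFork.IsLimit.ofι' _ _ fun k hk => ?_)
    have hk' : k ≫ f = 0 := by rw [← Limits.image.fac f, ← Category.assoc, hk, zero_comp]
    exact ⟨kernel.lift f k hk', kernel.lift_ι _ _ _⟩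

/-- The pullback of a short exact sequence. -/
lemma pullback_shortExact {S : ShortComplex C} (hS : S.ShortExact) {M : C} (f : M ⟶ S.X₃) :
    (ShortComplex.mk (pullback.lift S.f 0 (by simp) : S.X₁ ⟶ pullback S.g f)
      (pullback.snd S.g f) (pullback.lift_snd _ _ _)).ShortExact := by
  have := hS.mono_f
  have := hS.epi_g
  have hm : Mono (pullback.lift S.f 0 (by simp) : S.X₁ ⟶ pullback S.g f) :=
    mono_of_mono_fac (pullback.lift_fst S.f 0 (by simp))
  refine ShortComplex.ShortExact.mk' ?_ hm (inferInstanceAs (Epi (pullback.snd S.g f)))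
  refine ShortComplex.exact_of_f_is_kernel _ (KernelFork.IsLimit.ofι' _ _ fun k hk => ?_)
  have hk' : (k ≫ pullback.fst S.g f) ≫ S.g = 0 := by
    rw [Category.assoc, pullback.condition, reassoc_of% hk, zero_comp]
  refine ⟨hS.exact.lift _ hk', pullback.hom_ext ?_ ?_⟩
  · rw [Category.assoc]
    erw [pullback.lift_fst]
    exact hS.exact.lift_f _ _
  · rw [Category.assoc]
    erw [pullback.lift_snd]
    rw [comp_zero]
    exact hk.symm

/-- The pushout of a short exact sequence. -/
lemma pushout_shortExact {S : ShortComplex C} (hS : S.ShortExact) {M : C} (f : S.X₁ ⟶ M) :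
    (ShortComplex.mk (pushout.inr S.f f)
      (pushout.desc S.g 0 (by simp) : pushout S.f f ⟶ S.X₃) (pushout.inr_desc _ _ _)).ShortExact := by
  have := hS.mono_f
  have := hS.epi_g
  have hm : Epi (pushout.desc S.g 0 (by simp) : pushout S.f f ⟶ S.X₃) :=
    epi_of_epi_fac (pushout.inl_desc S.g 0 (by simp))
  refine ShortComplex.ShortExact.mk' ?_ (inferInstanceAs (Mono (pushout.inr S.f f))) hm
  refine ShortComplex.exact_of_g_is_cokernel _ (CokernelCofork.IsColimit.ofπ' _ _ fun k hk => ?_)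
  have hk' : S.f ≫ (pushout.inl S.f f ≫ k) = 0 := by
    rw [← Category.assoc, pushout.condition, Category.assoc, hk, comp_zero]
  refine ⟨hS.exact.desc _ hk', pushout.hom_ext ?_ ?_⟩
  · erw [pushout.inl_desc_assoc]
    exact hS.exact.g_desc _ _
  · erw [pushout.inr_desc_assoc]
    rw [zero_comp]
    exact hk.symm

variable [HasExt.{w} C]

/-- Every class in `Ext^(n+1)` is the product of a class in `Ext^1` and a class in `Ext^n`. -/
lemma exists_extClass_comp {X Y : C} {n m : ℕ} (e : Ext.{w} X Y m) (hm : 1 + n = m) :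
    ∃ (S : ShortComplex C) (hS : S.ShortExact) (h : S.X₃ = X) (x : Ext.{w} S.X₁ Y n),
      e = (h ▸ hS.extClass).comp x hm := by
  obtain rfl : n + 1 = m := by omega
  -- Once `p` kills `e`, the long exact sequence of `ker p → P → X` exhibits `e` as a connecting
  -- image.
  obtain ⟨P, p, hp, h⟩ := exists_epi_comp_eq_zero e
  obtain ⟨x, hx⟩ := Ext.contravariant_sequence_exact₃ (kernel_shortExact p) Y e h hm
  exact ⟨_, kernel_shortExact p, rfl, x, hx.symm⟩

/-- Every class in `Ext^1` is the class of an extension. -/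
lemma exists_shortExact_of_ext {L M : C} (ξ : Ext.{w} L M 1) :
    ∃ (X : C) (f : M ⟶ X) (g : X ⟶ L) (zero : f ≫ g = 0)
      (hS : (ShortComplex.mk f g zero).ShortExact), hS.extClass = ξ := by
  obtain ⟨S, hS, rfl, x, hx⟩ := exists_extClass_comp (n := 0) ξ rfl
  obtain ⟨a, rfl⟩ := Ext.addEquiv₀.symm.surjective x
  refine ⟨_, _, _, _, pushout_shortExact hS a, ?_⟩
  have := ShortComplex.ShortExact.extClass_naturality hS (pushout_shortExact hS a)
    { τ₁ := a
      τ₂ := pushout.inl _ _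
      τ₃ := 𝟙 _
      comm₁₂ := pushout.condition.symm
      comm₂₃ := (pushout.inl_desc _ _ _).trans (Category.comp_id _).symm }
  rw [Ext.mk₀_id_comp] at this
  rw [← this, hx]
  rfl

/-- A morphism to the quotient lifts if it pulls back the class to zero. -/
lemma exists_lift_of_extClass {S : ShortComplex C} (hS : S.ShortExact) {X : C} (t : X ⟶ S.X₃)
    (h : (Ext.mk₀.{w} t).comp hS.extClass (zero_add 1) = 0) : ∃ s : X ⟶ S.X₂, s ≫ S.g = t := by
  obtain ⟨y, hy⟩ := Ext.covariant_sequence_exact₃ X hS (Ext.mk₀.{w} t) rfl h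
  obtain ⟨s, rfl⟩ := Ext.addEquiv₀.symm.surjective y
  exact ⟨s, (Ext.mk₀_bijective _ _).1 ((Ext.mk₀_comp_mk₀ s S.g).symm.trans hy)⟩

/-- A morphism from the subobject extends if it pushes out the class to zero. -/
lemma exists_desc_of_extClass {S : ShortComplex C} (hS : S.ShortExact) {Y : C} (t : S.X₁ ⟶ Y)
    (h : hS.extClass.comp (Ext.mk₀.{w} t) (add_zero 1) = 0) : ∃ s : S.X₂ ⟶ Y, S.f ≫ s = t := by
  obtain ⟨y, hy⟩ := Ext.contravariant_sequence_exact₁ hS Y (Ext.mk₀.{w} t) rfl h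
  obtain ⟨s, rfl⟩ := Ext.addEquiv₀.symm.surjective y
  exact ⟨s, (Ext.mk₀_bijective _ _).1 ((Ext.mk₀_comp_mk₀ S.f s).symm.trans hy)⟩

/-- A pair of morphisms between the ends of two short exact sequences which is compatible with
their classes extends to a morphism. -/
lemma exists_hom_of_extClass {S S' : ShortComplex C} (hS : S.ShortExact) (hS' : S'.ShortExact)
    (f₁ : S.X₁ ⟶ S'.X₁) (f₃ : S.X₃ ⟶ S'.X₃)
    (h : hS.extClass.comp (Ext.mk₀.{w} f₁) (add_zero 1) =
      (Ext.mk₀ f₃).comp hS'.extClass (zero_add 1)) :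
    ∃ φ : S ⟶ S', φ.τ₁ = f₁ ∧ φ.τ₃ = f₃ := by
  have := hS.epi_g
  -- By `h`, the obstruction to extending `f₁ ≫ S'.f` over `S.X₂` is a multiple of the class of `S'`
  -- pushed along `S'.f`, hence zero. The square over `f₃` then commutes up to a map `k` on `S.X₃`.
  obtain ⟨m, hm⟩ := exists_desc_of_extClass hS (f₁ ≫ S'.f) (by
    rw [← Ext.mk₀_comp_mk₀, ← Ext.comp_assoc _ _ _ (add_zero 1) (add_zero 0) (by omega), h,
      Ext.comp_assoc _ _ _ (zero_add 1) (add_zero 1) (by omega), hS'.extClass_comp,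
      Ext.comp_zero])
  have hz : S.f ≫ (m ≫ S'.g - S.g ≫ f₃) = 0 := by
    rw [Preadditive.comp_sub, ← Category.assoc, hm]
    simp
  let k := hS.exact.desc _ hz
  have hk : S.g ≫ k = m ≫ S'.g - S.g ≫ f₃ := hS.exact.g_desc _ hz
  let ψ : S ⟶ S' :=
    { τ₁ := f₁
      τ₂ := m
      τ₃ := f₃ + k
      comm₁₂ := hm.symm
      comm₂₃ := by rw [Preadditive.comp_add, hk]; abel }
  have hψ := ShortComplex.ShortExact.extClass_naturality hS hS' ψ
  -- Comparing naturality for `f₃ + k` with `h` shows that `k` pulls the class of `S'` back to zero,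
  -- so `k` lifts to `S'.X₂` and the lift corrects `m`.
  have hk0 : (Ext.mk₀.{w} k).comp hS'.extClass (zero_add 1) = 0 := by
    have h2 : (Ext.mk₀.{w} f₃).comp hS'.extClass (zero_add 1) =
        (Ext.mk₀ (f₃ + k)).comp hS'.extClass (zero_add 1) := h.symm.trans hψ
    rw [Ext.mk₀_add, Ext.add_comp] at h2
    exact left_eq_add.1 h2
  obtain ⟨t, ht⟩ := exists_lift_of_extClass hS' k hk0
  refine ⟨{ τ₁ := f₁
            τ₂ := m - S.g ≫ t
            τ₃ := f₃
            comm₁₂ := ?_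
            comm₂₃ := ?_ }, rfl, rfl⟩
  · rw [Preadditive.comp_sub, ← hm, S.zero_assoc, zero_comp, sub_zero]
  · rw [Preadditive.sub_comp, Category.assoc, ht, hk]; abel

/-- Two extensions with the same class have isomorphic middle terms. -/
lemma exists_iso_of_extClass_eq {L M X X' : C} {f : M ⟶ X} {g : X ⟶ L} {zero : f ≫ g = 0}
    (hS : (ShortComplex.mk f g zero).ShortExact) {f' : M ⟶ X'} {g' : X' ⟶ L} {zero' : f' ≫ g' = 0}
    (hS' : (ShortComplex.mk f' g' zero').ShortExact)
    (h : (hS.extClass : Ext.{w} L M 1) = hS'.extClass) :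
    ∃ e : X ≅ X', f ≫ e.hom = f' ∧ e.hom ≫ g' = g := by
  obtain ⟨φ, h₁, h₃⟩ := exists_hom_of_extClass hS hS' (𝟙 _) (𝟙 _) (by
    rw [Ext.comp_mk₀_id, Ext.mk₀_id_comp, h])
  have : IsIso φ.τ₁ := by rw [h₁]; exact inferInstanceAs (IsIso (𝟙 M))
  have : IsIso φ.τ₃ := by rw [h₃]; exact inferInstanceAs (IsIso (𝟙 L))
  have : IsIso φ.τ₂ := ShortComplex.isIso₂_of_shortExact_of_isIso₁₃ φ hS hS'
  refine ⟨asIso φ.τ₂, ?_, ?_⟩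
  · have := φ.comm₁₂
    rw [h₁] at this
    simpa using this.symm
  · have := φ.comm₂₃
    rw [h₃] at this
    simpa using this

/-- The class of a short exact sequence vanishes iff the projection has a section. -/
lemma extClass_eq_zero_of_section {S : ShortComplex C} (hS : S.ShortExact) (s : S.X₃ ⟶ S.X₂)
    (hs : s ≫ S.g = 𝟙 _) : (hS.extClass : Ext.{w} _ _ 1) = 0 := by
  rw [← Ext.mk₀_id_comp hS.extClass, ← hs, ← Ext.mk₀_comp_mk₀,
    Ext.comp_assoc _ _ _ (zero_add 0) (zero_add 1) (by omega), hS.comp_extClass, Ext.comp_zero]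

/-- A class in `Ext^2` is killed by a monomorphism. -/
lemma exists_mono_comp_eq_zero {X Y : C} (e : Ext.{w} X Y 2) :
    ∃ (Z : C) (i : Y ⟶ Z), Mono i ∧ e.comp (Ext.mk₀ i) (add_zero 2) = 0 := by
  obtain ⟨S, hS, rfl, x, hx⟩ := exists_extClass_comp (n := 1) e rfl
  obtain ⟨Z, f, g, zero, hT, rfl⟩ := exists_shortExact_of_ext x
  refine ⟨Z, f, hT.mono_f, ?_⟩
  rw [hx, Ext.comp_assoc _ _ _ _ (add_zero 1) (by omega)]
  erw [hT.extClass_comp]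
  rw [Ext.comp_zero]

end Basic

noncomputable section

/-! ### Ext along exact adjoint functors. -/

section Adjunction

variable {C : Type u} [Category.{v} C] [Abelian C] {D : Type u'} [Category.{v'} D] [Abelian D]
  {F : D ⥤ C} {G : C ⥤ D} [F.Additive] [PreservesFiniteLimits F] [PreservesFiniteColimits F]
  [G.Additive] [PreservesFiniteLimits G] [PreservesFiniteColimits G] (adj : F ⊣ G)

/-- The map `Ext^1(F X, Y) → Ext^1(X, G Y)` for exact adjoint functors `F ⊣ G`. -/
def adjExt (X : D) (Y : C) : Ext (F.obj X) Y 1 →+ Ext X (G.obj Y) 1 :=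
  ((Ext.mk₀ (adj.unit.app X)).precomp _ (zero_add 1)).comp (G.mapExtAddHom _ _ 1)

lemma adjExt_apply {X : D} {Y : C} (ξ : Ext (F.obj X) Y 1) :
    adjExt adj X Y ξ = (Ext.mk₀ (adj.unit.app X)).comp (ξ.mapExactFunctor G) (zero_add 1) := rfl

/-- If the adjoint class vanishes, the unit lifts to `G E`, and the transpose of the lift splits the
extension. -/
lemma adjExt_injective (X : D) (Y : C) : Function.Injective (adjExt adj X Y) := by
  rw [injective_iff_map_eq_zero]
  intro ξ hξ
  obtain ⟨E, f, g, zero, hS, rfl⟩ := exists_shortExact_of_ext ξ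
  rw [adjExt_apply, Ext.mapExactFunctor_extClass] at hξ
  obtain ⟨t, ht⟩ : ∃ t : X ⟶ G.obj E, t ≫ G.map g = adj.unit.app X :=
    exists_lift_of_extClass (hS.map_of_exact G) (adj.unit.app X) hξ
  have hs : (adj.homEquiv _ _).symm t ≫ g = 𝟙 _ := by
    rw [← Adjunction.homEquiv_naturality_right_symm, ht]
    simp
  exact extClass_eq_zero_of_section hS _ hs

/-- A preimage is the image of the extension under `F`, pushed out along the counit; a triangle
identity recovers the original class. -/
lemma adjExt_surjective (X : D) (Y : C) : Function.Surjective (adjExt adj X Y) := by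
  intro ζ
  obtain ⟨E, f, g, zero, hT, rfl⟩ := exists_shortExact_of_ext ζ
  let θ : Ext (F.obj X) (F.obj (G.obj Y)) 1 := (hT.map_of_exact F).extClass
  refine ⟨θ.comp (Ext.mk₀ (adj.counit.app Y)) (add_zero 1), ?_⟩
  have h := ShortComplex.ShortExact.extClass_naturality hT ((hT.map_of_exact F).map_of_exact G)
    { τ₁ := adj.unit.app _
      τ₂ := adj.unit.app _
      τ₃ := adj.unit.app _
      comm₁₂ := (adj.unit.naturality _).symm
      comm₂₃ := (adj.unit.naturality _).symm }
  have h' : hT.extClass.comp (Ext.mk₀ (adj.unit.app (G.obj Y))) (add_zero 1) =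
      (Ext.mk₀ (adj.unit.app X)).comp (θ.mapExactFunctor G) (zero_add 1) := by
    refine h.trans ?_
    congr 1
    exact (Ext.mapExactFunctor_extClass G (hT.map_of_exact F)).symm
  rw [adjExt_apply, Ext.mapExactFunctor_comp,
    Ext.mapExactFunctor_mk₀, ← Ext.comp_assoc _ _ _ (zero_add 1) (add_zero 1) (by omega), ← h']
  rw [Ext.comp_assoc _ _ _ (add_zero 1) (add_zero 0) (by omega), Ext.mk₀_comp_mk₀]
  erw [adj.right_triangle_components]
  rw [Ext.comp_mk₀_id]

lemma adjExt_precomp {X X' : D} {Y : C} (x : X' ⟶ X) (ξ : Ext (F.obj X) Y 1) :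
    adjExt adj X' Y ((Ext.mk₀ (F.map x)).comp ξ (zero_add 1)) =
      (Ext.mk₀ x).comp (adjExt adj X Y ξ) (zero_add 1) := by
  rw [adjExt_apply, adjExt_apply, Ext.mapExactFunctor_comp, Ext.mapExactFunctor_mk₀,
    Ext.mk₀_comp_mk₀_assoc, Ext.mk₀_comp_mk₀_assoc]
  congr 2
  exact (adj.unit.naturality x).symm

lemma adjExt_postcomp {X : D} {Y Y' : C} (y : Y ⟶ Y') (ξ : Ext (F.obj X) Y 1) :
    adjExt adj X Y' (ξ.comp (Ext.mk₀ y) (add_zero 1)) =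
      (adjExt adj X Y ξ).comp (Ext.mk₀ (G.map y)) (add_zero 1) := by
  rw [adjExt_apply, adjExt_apply, Ext.mapExactFunctor_comp, Ext.mapExactFunctor_mk₀,
    Ext.comp_assoc _ _ _ (zero_add 1) (add_zero 1) (by omega)]

/-- `Ext^1(F X, Y) ≃ Ext^1(X, G Y)` for exact adjoint functors `F ⊣ G`. -/
def adjExtEquiv (X : D) (Y : C) : Ext (F.obj X) Y 1 ≃+ Ext X (G.obj Y) 1 :=
  AddEquiv.ofBijective _ ⟨adjExt_injective adj X Y, adjExt_surjective adj X Y⟩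

include adj in
lemma eulerForm_adj (X : D) (Y : C) : eulerForm (F.obj X) Y = eulerForm X (G.obj Y) := by
  unfold eulerForm
  rw [Nat.card_congr (adj.homEquiv X Y), Nat.card_congr (adjExtEquiv adj X Y).toEquiv]

-- Only the adjunction in degree one is needed. A monomorphism `Y → Z` kills a given class, which is
-- therefore the connecting image of some `η` in `Ext¹(F X, Z/Y)`. The adjoint of `η` lifts to
-- `Ext¹(X, G Z)` because `Ext²(X, G Y) = 0`; so `η` lifts to `Ext¹(F X, Z)` and its connecting
-- image is zero.
include adj in
lemma subsingleton_ext_two_left (X : D) (h : ∀ Y : C, Subsingleton (Ext X (G.obj Y) 2)) (Y : C) :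
    Subsingleton (Ext (F.obj X) Y 2) := by
  refine subsingleton_of_forall_eq 0 fun ξ => ?_
  obtain ⟨Z, i, hi, h0⟩ := exists_mono_comp_eq_zero ξ
  have hS := cokernel_shortExact i
  obtain ⟨η, rfl⟩ := Ext.covariant_sequence_exact₁ (F.obj X) hS ξ h0 rfl
  obtain ⟨ζ, hζ⟩ := Ext.covariant_sequence_exact₃ X (hS.map_of_exact G) (adjExt adj X _ η) rfl
    ((h Y).elim _ _)
  obtain ⟨ω, rfl⟩ := adjExt_surjective adj X Z ζ
  have : ω.comp (Ext.mk₀ (cokernel.π i)) (add_zero 1) = η := by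
    apply adjExt_injective adj
    rw [adjExt_postcomp]
    exact hζ
  rw [← this, Ext.comp_assoc _ _ _ (add_zero 1) (zero_add 1) (by omega), hS.comp_extClass,
    Ext.comp_zero]

-- Dually, the class is an extension class times a class in `Ext¹(S.X₁, G Y)`. The adjoint of the
-- second factor extends over `F S.X₂`, as `Ext²(F S.X₃, Y) = 0`.
include adj in
lemma subsingleton_ext_two_right (Y : C) (h : ∀ X : D, Subsingleton (Ext (F.obj X) Y 2)) (X : D) :
    Subsingleton (Ext X (G.obj Y) 2) := by
  refine subsingleton_of_forall_eq 0 fun ξ => ?_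
  obtain ⟨S, hS, rfl, η, rfl⟩ := exists_extClass_comp (n := 1) ξ rfl
  obtain ⟨η, rfl⟩ := adjExt_surjective adj _ Y η
  obtain ⟨ζ, hζ⟩ : ∃ ζ : Ext (F.obj S.X₂) Y 1, (Ext.mk₀ (F.map S.f)).comp ζ (zero_add 1) = η :=
    Ext.contravariant_sequence_exact₁ (hS.map_of_exact F) Y η rfl ((h S.X₃).elim _ _)
  have : adjExt adj _ Y η = (Ext.mk₀ S.f).comp (adjExt adj _ Y ζ) (zero_add 1) := by
    rw [← adjExt_precomp]
    rw [hζ]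
  rw [this]
  exact hS.extClass_comp_assoc _

end Adjunction

/-! ### Orders of groups and multiplicativity of the Euler form. -/

section Card

lemma card_ker_mul_card_range {G H : Type*} [AddCommGroup G] [AddCommGroup H] (f : G →+ H) :
    Nat.card f.ker * Nat.card f.range = Nat.card G := by
  rw [← AddSubgroup.index_ker, AddSubgroup.card_mul_index]

/-- The alternating product of the orders in a six-term exact sequence. -/
lemma card_six_term {A₁ A₂ A₃ A₄ A₅ A₆ : Type*} [AddCommGroup A₁] [AddCommGroup A₂]
    [AddCommGroup A₃] [AddCommGroup A₄] [AddCommGroup A₅] [AddCommGroup A₆]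
    (f₁ : A₁ →+ A₂) (f₂ : A₂ →+ A₃) (f₃ : A₃ →+ A₄) (f₄ : A₄ →+ A₅) (f₅ : A₅ →+ A₆)
    (h₁ : Function.Injective f₁) (h₂ : f₁.range = f₂.ker) (h₃ : f₂.range = f₃.ker)
    (h₄ : f₃.range = f₄.ker) (h₅ : f₄.range = f₅.ker) (h₆ : Function.Surjective f₅) :
    Nat.card A₁ * Nat.card A₃ * Nat.card A₅ = Nat.card A₂ * Nat.card A₄ * Nat.card A₆ := by
  have e₁ : Nat.card A₁ = Nat.card f₁.range :=
    Nat.card_congr (AddMonoidHom.ofInjective h₁).toEquiv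
  have e₆ : Nat.card f₅.range = Nat.card A₆ := by
    rw [AddMonoidHom.range_eq_top.2 h₆]
    exact Nat.card_congr AddSubgroup.topEquiv.toEquiv
  rw [← card_ker_mul_card_range f₂, ← card_ker_mul_card_range f₃, ← card_ker_mul_card_range f₄,
    ← card_ker_mul_card_range f₅, e₁, h₂, h₃, h₄, h₅, e₆]
  ring

variable {C : Type u} [Category.{v} C] [Abelian C] [∀ X Y : C, Finite (X ⟶ Y)]
  [∀ X Y : C, Finite (Ext X Y 1)]

lemma card_hom_pos (X Y : C) : (0 : ℚ) < Nat.card (X ⟶ Y) := by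
  exact_mod_cast Nat.card_pos

lemma card_ext_pos (X Y : C) : (0 : ℚ) < Nat.card (Ext X Y 1) := by
  exact_mod_cast Nat.card_pos

lemma eulerForm_pos (X Y : C) : 0 < eulerForm X Y := div_pos (card_hom_pos X Y) (card_ext_pos X Y)

omit [∀ X Y : C, Finite (X ⟶ Y)] [∀ X Y : C, Finite (Ext X Y 1)] in
lemma card_ext_zero (X Y : C) : Nat.card (Ext X Y 0) = Nat.card (X ⟶ Y) :=
  Nat.card_congr Ext.addEquiv₀.toEquiv

/-- The Euler form is multiplicative in the second variable. -/
lemma eulerForm_covariant {S : ShortComplex C} (hS : S.ShortExact) (N : C)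
    (hs : ∀ x : Ext N S.X₃ 1, ∃ y : Ext N S.X₂ 1, y.comp (Ext.mk₀ S.g) (add_zero 1) = x) :
    eulerForm N S.X₂ = eulerForm N S.X₁ * eulerForm N S.X₃ := by
  have := hS.mono_f
  have key := card_six_term ((Ext.mk₀ S.f).postcomp N (add_zero 0))
    ((Ext.mk₀ S.g).postcomp N (add_zero 0)) (hS.extClass.postcomp N (zero_add 1))
    ((Ext.mk₀ S.f).postcomp N (add_zero 1)) ((Ext.mk₀ S.g).postcomp N (add_zero 1))
    (Ext.postcomp_mk₀_injective_of_mono N S.f) ?_ ?_ ?_ ?_ hs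
  · rw [card_ext_zero, card_ext_zero, card_ext_zero] at key
    unfold eulerForm
    have h₁ := (card_ext_pos N S.X₁).ne'
    have h₂ := (card_ext_pos N S.X₂).ne'
    have h₃ := (card_ext_pos N S.X₃).ne'
    field_simp
    exact_mod_cast by linarith
  · ext x
    refine ⟨?_, fun hx => Ext.covariant_sequence_exact₂ N hS x hx⟩
    rintro ⟨y, rfl⟩
    simp [AddMonoidHom.mem_ker]
  · ext x
    refine ⟨?_, fun hx => Ext.covariant_sequence_exact₃ N hS x rfl hx⟩
    rintro ⟨y, rfl⟩
    change (y.comp (Ext.mk₀ S.g) (add_zero 0)).comp hS.extClass (zero_add 1) = 0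
    rw [Ext.comp_assoc _ _ _ _ (zero_add 1) (by omega), hS.comp_extClass, Ext.comp_zero]
  · ext x
    refine ⟨?_, fun hx => Ext.covariant_sequence_exact₁ N hS x hx rfl⟩
    rintro ⟨y, rfl⟩
    change (y.comp hS.extClass (zero_add 1)).comp (Ext.mk₀ S.f) (add_zero 1) = 0
    rw [Ext.comp_assoc _ _ _ _ (add_zero 1) (by omega), hS.extClass_comp, Ext.comp_zero]
  · ext x
    refine ⟨?_, fun hx => Ext.covariant_sequence_exact₂ N hS x hx⟩
    rintro ⟨y, rfl⟩
    simp [AddMonoidHom.mem_ker]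

/-- The Euler form is multiplicative in the first variable. -/
lemma eulerForm_contravariant {S : ShortComplex C} (hS : S.ShortExact) (N : C)
    (hs : ∀ x : Ext S.X₁ N 1, ∃ y : Ext S.X₂ N 1, (Ext.mk₀ S.f).comp y (zero_add 1) = x) :
    eulerForm S.X₂ N = eulerForm S.X₁ N * eulerForm S.X₃ N := by
  have := hS.epi_g
  have key := card_six_term ((Ext.mk₀ S.g).precomp N (zero_add 0))
    ((Ext.mk₀ S.f).precomp N (zero_add 0)) (hS.extClass.precomp N (add_zero 1))
    ((Ext.mk₀ S.g).precomp N (zero_add 1)) ((Ext.mk₀ S.f).precomp N (zero_add 1))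
    (Ext.precomp_mk₀_injective_of_epi N S.g) ?_ ?_ ?_ ?_ hs
  · rw [card_ext_zero, card_ext_zero, card_ext_zero] at key
    unfold eulerForm
    have h₁ := (card_ext_pos S.X₁ N).ne'
    have h₂ := (card_ext_pos S.X₂ N).ne'
    have h₃ := (card_ext_pos S.X₃ N).ne'
    field_simp
    exact_mod_cast by linarith
  · ext x
    refine ⟨?_, fun hx => Ext.contravariant_sequence_exact₂ hS N x hx⟩
    rintro ⟨y, rfl⟩
    simp [AddMonoidHom.mem_ker]
  · ext x
    refine ⟨?_, fun hx => Ext.contravariant_sequence_exact₁ hS N x rfl hx⟩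
    rintro ⟨y, rfl⟩
    change hS.extClass.comp ((Ext.mk₀ S.f).comp y (zero_add 0)) (add_zero 1) = 0
    rw [← Ext.comp_assoc _ _ _ (add_zero 1) (zero_add 0) (by omega), hS.extClass_comp,
      Ext.zero_comp]
  · ext x
    refine ⟨?_, fun hx => Ext.contravariant_sequence_exact₃ hS N x hx rfl⟩
    rintro ⟨y, rfl⟩
    change (Ext.mk₀ S.g).comp (hS.extClass.comp y (add_zero 1)) (zero_add 1) = 0
    rw [← Ext.comp_assoc _ _ _ (zero_add 1) (add_zero 1) (by omega), hS.comp_extClass,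
      Ext.zero_comp]
  · ext x
    refine ⟨?_, fun hx => Ext.contravariant_sequence_exact₂ hS N x hx⟩
    rintro ⟨y, rfl⟩
    simp [AddMonoidHom.mem_ker]

-- Supplies the surjectivity that cuts the long exact sequence down to six terms in
-- `eulerForm_covariant`.
omit [∀ X Y : C, Finite (X ⟶ Y)] [∀ X Y : C, Finite (Ext X Y 1)] in
lemma exists_ext_covariant {S : ShortComplex C} (hS : S.ShortExact) (N : C)
    (h : Subsingleton (Ext N S.X₁ 2)) (x : Ext N S.X₃ 1) :
    ∃ y : Ext N S.X₂ 1, y.comp (Ext.mk₀ S.g) (add_zero 1) = x :=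
  Ext.covariant_sequence_exact₃ N hS x rfl (h.elim _ _)

omit [∀ X Y : C, Finite (X ⟶ Y)] [∀ X Y : C, Finite (Ext X Y 1)] in
lemma exists_ext_contravariant {S : ShortComplex C} (hS : S.ShortExact) (N : C)
    (h : Subsingleton (Ext S.X₃ N 2)) (x : Ext S.X₁ N 1) :
    ∃ y : Ext S.X₂ N 1, (Ext.mk₀ S.f).comp y (zero_add 1) = x :=
  Ext.contravariant_sequence_exact₁ hS N x rfl (h.elim _ _)

end Card

/-! ### Riedtmann's formula and the Hall product. -/

section HallAlgebra

variable {C : Type u} [Category.{v} C] [Abelian C]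

lemma IsoClass.mk_eq_iff {X Y : C} : IsoClass.mk X = IsoClass.mk Y ↔ Nonempty (X ≅ Y) :=
  Quotient.eq (r := isIsomorphicSetoid C)

lemma IsoClass.mk_rep (x : IsoClass C) : IsoClass.mk x.rep = x := Quotient.out_eq x

lemma IsoClass.ind {p : IsoClass C → Prop} (h : ∀ X, p (IsoClass.mk X)) (x : IsoClass C) : p x :=
  Quotient.ind h x

/-- An isomorphism from the chosen representative of the class of an object. -/
def IsoClass.repIso (X : C) : (IsoClass.mk X).rep ≅ X :=
  (IsoClass.mk_eq_iff.1 (IsoClass.mk_rep (IsoClass.mk X))).some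

/-- The short exact sequences `0 → M → X → L → 0`. -/
def ExtPair (L M X : C) : Type v :=
  {p : (M ⟶ X) × (X ⟶ L) // ∃ zero : p.1 ≫ p.2 = 0, (ShortComplex.mk p.1 p.2 zero).ShortExact}

namespace ExtPair

variable {L M X : C}

abbrev f (p : ExtPair L M X) : M ⟶ X := p.1.1

abbrev g (p : ExtPair L M X) : X ⟶ L := p.1.2

lemma zero (p : ExtPair L M X) : p.f ≫ p.g = 0 := p.2.1

lemma shortExact (p : ExtPair L M X) : (ShortComplex.mk p.f p.g p.zero).ShortExact := p.2.2

instance (p : ExtPair L M X) : Mono p.f := p.shortExact.mono_f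

instance (p : ExtPair L M X) : Epi p.g := p.shortExact.epi_g

lemma ext {p q : ExtPair L M X} (hf : p.f = q.f) (hg : p.g = q.g) : p = q :=
  Subtype.ext (Prod.ext hf hg)

/-- The class of a short exact sequence. -/
def cls (p : ExtPair L M X) : Ext L M 1 := p.shortExact.extClass

/-- Transport of a short exact sequence along isomorphisms. -/
def map {L' M' X' : C} (l : L ≅ L') (m : M ≅ M') (x : X ≅ X') (p : ExtPair L M X) :
    ExtPair L' M' X' :=
  ⟨(m.inv ≫ p.f ≫ x.hom, x.inv ≫ p.g ≫ l.hom), by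
    have h : (m.inv ≫ p.f ≫ x.hom) ≫ x.inv ≫ p.g ≫ l.hom = 0 := by
      simp [reassoc_of% p.zero]
    refine ⟨h, ShortComplex.shortExact_of_iso ?_ p.shortExact⟩
    exact ShortComplex.isoMk m x l (by simp) (by simp)⟩

/-- Isomorphic ends and middle terms have equally many short exact sequences. -/
def mapEquiv {L' M' X' : C} (l : L ≅ L') (m : M ≅ M') (x : X ≅ X') :
    ExtPair L M X ≃ ExtPair L' M' X' where
  toFun := map l m x
  invFun := map l.symm m.symm x.symm
  left_inv p := ext (by simp [map, f]) (by simp [map, g])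
  right_inv p := ext (by simp [map, f]) (by simp [map, g])

lemma cls_mem (p : ExtPair L M X) : p.cls ∈ extWithMiddle L M X :=
  ⟨p.f, p.g, p.zero, p.shortExact, rfl⟩

lemma exists_iso {X' : C} (p : ExtPair L M X) (q : ExtPair L M X') (h : p.cls = q.cls) :
    ∃ e : X ≅ X', p.f ≫ e.hom = q.f ∧ e.hom ≫ q.g = p.g :=
  exists_iso_of_extClass_eq p.shortExact q.shortExact h

lemma cls_eq_of_iso {X' : C} (p : ExtPair L M X) (q : ExtPair L M X') (e : X ≅ X')
    (h₁ : p.f ≫ e.hom = q.f) (h₂ : e.hom ≫ q.g = p.g) : p.cls = q.cls := by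
  have := ShortComplex.ShortExact.extClass_naturality p.shortExact q.shortExact
    { τ₁ := 𝟙 _
      τ₂ := e.hom
      τ₃ := 𝟙 _
      comm₁₂ := by simpa using h₁.symm
      comm₂₃ := by simpa using h₂ }
  rwa [Ext.comp_mk₀_id, Ext.mk₀_id_comp] at this

/-- The automorphism `1 + h` of the middle term of an extension, for `h : L → M`. -/
def shear (p : ExtPair L M X) (h : L ⟶ M) : X ≅ X where
  hom := 𝟙 X + p.g ≫ h ≫ p.f
  inv := 𝟙 X - p.g ≫ h ≫ p.f
  hom_inv_id := by
    simp [Preadditive.comp_sub, Preadditive.add_comp, reassoc_of% p.zero]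
  inv_hom_id := by
    simp [Preadditive.comp_add, Preadditive.sub_comp, reassoc_of% p.zero]

lemma f_shear (p : ExtPair L M X) (h : L ⟶ M) : p.f ≫ (p.shear h).hom = p.f := by
  simp [shear, Preadditive.comp_add, reassoc_of% p.zero]

lemma shear_g (p : ExtPair L M X) (h : L ⟶ M) : (p.shear h).hom ≫ p.g = p.g := by
  simp [shear, Preadditive.add_comp, p.zero]

/-- The difference `e - 1` vanishes on `M` and has image in `M`, so it factors as `X → L → M → X`.
-/
lemma exists_shear (p : ExtPair L M X) (e : X ≅ X) (h₁ : p.f ≫ e.hom = p.f)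
    (h₂ : e.hom ≫ p.g = p.g) : ∃ h, p.shear h = e := by
  have z₁ : p.f ≫ (e.hom - 𝟙 X) = 0 := by
    rw [Preadditive.comp_sub, h₁, Category.comp_id, sub_self]
  obtain ⟨k, hk⟩ : ∃ k : L ⟶ X, p.g ≫ k = e.hom - 𝟙 X :=
    ⟨p.shortExact.exact.desc _ z₁, p.shortExact.exact.g_desc _ z₁⟩
  have z₂ : k ≫ p.g = 0 := by
    rw [← cancel_epi p.g, reassoc_of% hk, Preadditive.sub_comp, h₂]
    simp
  obtain ⟨h, hh⟩ : ∃ h : L ⟶ M, h ≫ p.f = k :=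
    ⟨p.shortExact.exact.lift _ z₂, p.shortExact.exact.lift_f _ z₂⟩
  refine ⟨h, Iso.ext ?_⟩
  simp [shear, hh, hk]

/-- The extensions with a given class form a torsor under the automorphisms of the middle term
modulo the shears. -/
lemma exists_fiber_equiv (p : ExtPair L M X) :
    Nonempty ((L ⟶ M) × {q : ExtPair L M X // q.cls = p.cls} ≃ (X ≅ X)) := by
  choose e he₁ he₂ using fun q : {q : ExtPair L M X // q.cls = p.cls} =>
    exists_iso p q.1 q.2.symm
  refine ⟨Equiv.ofBijective (fun t => p.shear t.1 ≪≫ e t.2) ⟨?_, ?_⟩⟩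
  · rintro ⟨h, q⟩ ⟨h', q'⟩ heq
    have hhom : (p.shear h).hom ≫ (e q).hom = (p.shear h').hom ≫ (e q').hom :=
      congrArg Iso.hom heq
    have hinv : (e q).inv ≫ (p.shear h).inv = (e q').inv ≫ (p.shear h').inv :=
      congrArg Iso.inv heq
    have hqf : q.1.f = q'.1.f := by
      rw [← he₁, ← he₁, ← p.f_shear h, Category.assoc, hhom, ← Category.assoc, p.f_shear,
        p.f_shear]
    have hg : ∀ (h : L ⟶ M) (q : {q : ExtPair L M X // q.cls = p.cls}),
        ((e q).inv ≫ (p.shear h).inv) ≫ p.g = q.1.g := by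
      intro h q
      rw [Category.assoc, Iso.inv_comp_eq, Iso.inv_comp_eq, he₂, p.shear_g]
    have hqg : q.1.g = q'.1.g := by rw [← hg h q, ← hg h' q', hinv]
    obtain rfl : q = q' := Subtype.ext (ext hqf hqg)
    rw [cancel_mono] at hhom
    have hh : p.g ≫ h ≫ p.f = p.g ≫ h' ≫ p.f := by simpa [shear] using hhom
    rw [cancel_epi, cancel_mono] at hh
    rw [hh]
  · intro a
    let q : ExtPair L M X := p.map (Iso.refl _) (Iso.refl _) a
    have hq₁ : p.f ≫ a.hom = q.f := by simp [q, map, f]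
    have hq₂ : a.hom ≫ q.g = p.g := by simp [q, map, g]
    have hq : q.cls = p.cls := (cls_eq_of_iso p q a hq₁ hq₂).symm
    obtain ⟨h, hh⟩ := p.exists_shear (a ≪≫ (e ⟨q, hq⟩).symm) (by
      have := he₁ ⟨q, hq⟩
      rw [Iso.trans_hom, reassoc_of% hq₁, Iso.symm_hom, Iso.comp_inv_eq, this]) (by
      have := he₂ ⟨q, hq⟩
      rw [Iso.trans_hom, Iso.symm_hom, Category.assoc, ← this, Iso.inv_hom_id_assoc, hq₂, this])
    refine ⟨(h, ⟨q, hq⟩), ?_⟩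
    change p.shear h ≪≫ _ = a
    rw [hh]
    ext
    simp

end ExtPair

/-- Riedtmann's formula. -/
lemma card_extWithMiddle_mul (L M X : C) :
    Nat.card (extWithMiddle L M X) * Nat.card (X ≅ X) =
      Nat.card (L ⟶ M) * Nat.card (ExtPair L M X) := by
  let φ : ExtPair L M X → extWithMiddle L M X := fun p => ⟨p.cls, p.cls_mem⟩
  have hfib : ∀ ξ : extWithMiddle L M X, Nonempty ((L ⟶ M) × {q // φ q = ξ} ≃ (X ≅ X)) := by
    rintro ⟨_, f, g, zero, hS, rfl⟩
    let p : ExtPair L M X := ⟨(f, g), zero, hS⟩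
    obtain ⟨e⟩ := p.exists_fiber_equiv
    refine ⟨(Equiv.prodCongrRight fun _ => Equiv.subtypeEquivRight fun q => ?_).trans e⟩
    exact Subtype.ext_iff
  let e₁ : (L ⟶ M) × ExtPair L M X ≃ extWithMiddle L M X × (X ≅ X) :=
    ((Equiv.prodCongrRight fun _ => (Equiv.sigmaFiberEquiv φ).symm).trans
      ((Equiv.prodComm _ _).trans ((Equiv.sigmaProdDistrib _ _).trans
        (Equiv.sigmaCongrRight fun ξ => (Equiv.prodComm _ _).trans (hfib ξ).some)))).trans
      (Equiv.sigmaEquivProd _ _)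
  rw [← Nat.card_prod, ← Nat.card_prod, Nat.card_congr e₁]

variable [∀ X Y : C, Finite (X ⟶ Y)] [∀ X Y : C, Finite (Ext X Y 1)]

instance finite_iso (X Y : C) : Finite (X ≅ Y) :=
  Finite.of_injective (fun e : X ≅ Y => e.hom) fun _ _ h => Iso.ext h

instance (X : C) : Nonempty (X ≅ X) := ⟨Iso.refl X⟩

instance (L M X : C) : Finite (ExtPair L M X) := inferInstanceAs (Finite (Subtype _))

lemma card_iso_pos (X : C) : (0 : ℚ) < Nat.card (X ≅ X) := by exact_mod_cast Nat.card_pos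

lemma hallNumber_eq (L M X : C) :
    hallNumber L M X = (Nat.card (ExtPair L M X) : ℚ) / Nat.card (X ≅ X) := by
  rw [hallNumber, div_eq_div_iff (card_hom_pos L M).ne' (card_iso_pos X).ne']
  exact_mod_cast (card_extWithMiddle_mul L M X).trans (mul_comm _ _)

lemma hallNumber_congr {L L' M M' X X' : C} (l : L ≅ L') (m : M ≅ M') (x : X ≅ X') :
    hallNumber L M X = hallNumber L' M' X' := by
  rw [hallNumber_eq, hallNumber_eq, Nat.card_congr (ExtPair.mapEquiv l m x),
    Nat.card_congr (⟨fun e => x.symm ≪≫ e ≪≫ x, fun e => x ≪≫ e ≪≫ x.symm,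
      fun e => by ext; simp, fun e => by ext; simp⟩ : (X ≅ X) ≃ (X' ≅ X'))]

/-- The middle term of an extension with a given class. -/
def extMiddle {L M : C} (ξ : Ext L M 1) : C := (exists_shortExact_of_ext ξ).choose

lemma exists_extPair {L M : C} (ξ : Ext L M 1) : ∃ p : ExtPair L M (extMiddle ξ), p.cls = ξ := by
  obtain ⟨f, g, zero, hS, h⟩ := (exists_shortExact_of_ext ξ).choose_spec
  exact ⟨⟨(f, g), zero, hS⟩, h⟩

lemma mk_extMiddle {L M X : C} (p : ExtPair L M X) :
    IsoClass.mk (extMiddle p.cls) = IsoClass.mk X := by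
  obtain ⟨q, hq⟩ := exists_extPair p.cls
  obtain ⟨e, -⟩ := q.exists_iso p hq
  exact IsoClass.mk_eq_iff.2 ⟨e⟩

lemma mem_extWithMiddle_iff {L M X : C} (ξ : Ext L M 1) :
    ξ ∈ extWithMiddle L M X ↔ IsoClass.mk (extMiddle ξ) = IsoClass.mk X := by
  constructor
  · rintro ⟨f, g, zero, hS, rfl⟩
    exact mk_extMiddle ⟨(f, g), zero, hS⟩
  · intro h
    obtain ⟨e⟩ := IsoClass.mk_eq_iff.1 h
    obtain ⟨p, hp⟩ := exists_extPair ξ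
    let q := p.map (Iso.refl L) (Iso.refl M) e
    rw [← hp, ExtPair.cls_eq_of_iso p q e (by simp [q, ExtPair.map, ExtPair.f])
      (by simp [q, ExtPair.map, ExtPair.g])]
    exact q.cls_mem

/-- The Hall product as a sum over the extension classes. -/
def hallProd (L M : C) : HallSpace C :=
  (Nat.card (L ⟶ M) : ℚ)⁻¹ • ∑ᶠ ξ : Ext L M 1, HallSpace.cls (extMiddle ξ)

lemma hallProd_apply (L M X : C) : hallProd L M (IsoClass.mk X) = hallNumber L M X := by
  classical
  have := Fintype.ofFinite (Ext L M 1)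
  rw [hallProd, hallNumber, finsum_eq_sum_of_fintype, Finsupp.smul_apply, Finsupp.finsetSum_apply,
    smul_eq_mul, div_eq_inv_mul]
  congr 1
  simp only [HallSpace.cls, Finsupp.single_apply]
  rw [Finset.sum_boole, Nat.card_eq_fintype_card, Fintype.card_of_subtype]
  intro ξ
  simp [mem_extWithMiddle_iff]

/-- The formal sum over all isomorphism classes is finite because its coefficients are those of the
finitely supported `hallProd`. -/
lemma hallBasisMul_eq (a b : IsoClass C) : hallBasisMul a b = hallProd a.rep b.rep := by
  have h : ∀ x : IsoClass C, hallNumber a.rep b.rep x.rep = hallProd a.rep b.rep x := by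
    intro x
    rw [← hallProd_apply, IsoClass.mk_rep]
  unfold hallBasisMul
  simp only [h]
  rw [finsum_eq_sum_of_support_subset (s := (hallProd a.rep b.rep).support)]
  · exact Finsupp.sum_single _
  · intro x hx
    simpa using hx

lemma hallMul_cls (L M : C) :
    hallMul C (HallSpace.cls L) (HallSpace.cls M) = hallProd L M := by
  have : hallMul C (HallSpace.cls L) (HallSpace.cls M) =
      hallBasisMul (IsoClass.mk L) (IsoClass.mk M) := by
    simp [hallMul, HallSpace.cls]
  rw [this, hallBasisMul_eq]
  ext x
  induction x using IsoClass.ind with | _ X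
  rw [hallProd_apply, hallProd_apply]
  exact hallNumber_congr (IsoClass.repIso L) (IsoClass.repIso M) (Iso.refl X)

lemma hallMul_cls_apply (L M X : C) :
    hallMul C (HallSpace.cls L) (HallSpace.cls M) (IsoClass.mk X) = hallNumber L M X := by
  rw [hallMul_cls, hallProd_apply]

/-- Evaluating a linear map on a Hall product. -/
lemma map_hallMul_cls {W : Type*} [AddCommGroup W] [Module ℚ W] (φ : HallSpace C →ₗ[ℚ] W)
    (L M : C) : φ (hallMul C (HallSpace.cls L) (HallSpace.cls M)) =
      (Nat.card (L ⟶ M) : ℚ)⁻¹ • ∑ᶠ ξ : Ext L M 1, φ (HallSpace.cls (extMiddle ξ)) := by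
  rw [hallMul_cls, hallProd, map_smul]
  congr 1
  exact AddMonoidHom.map_finsum φ.toAddMonoidHom (Set.toFinite _)

end HallAlgebra

/-! ### Associativity by counting flags. -/

section Associativity

variable {C : Type u} [Category.{v} C] [Abelian C]

lemma ShortExact.comp_eq_zero_lift {L M X T : C} (p : ExtPair L M X) (x : T ⟶ X)
    (h : x ≫ p.g = 0) : ∃ m : T ⟶ M, m ≫ p.f = x :=
  ⟨p.shortExact.exact.lift x h, p.shortExact.exact.lift_f x h⟩

lemma ShortExact.comp_eq_zero_desc {L M X T : C} (p : ExtPair L M X) (x : X ⟶ T)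
    (h : p.f ≫ x = 0) : ∃ m : L ⟶ T, p.g ≫ m = x :=
  ⟨p.shortExact.exact.desc x h, p.shortExact.exact.g_desc x h⟩

open ShortExact

/-- The compatibility of two filtrations `N ⊆ Y ⊆ Z` and `Z → X → L` of an object `Z` with
subquotients `N`, `M`, `L`. -/
def FlagRel {L M N X Y Z : C} (w : ExtPair L M X × ExtPair X N Z)
    (w' : ExtPair M N Y × ExtPair L Y Z) : Prop :=
  w'.1.f ≫ w'.2.f = w.2.f ∧ w.2.g ≫ w.1.g = w'.2.g ∧ w'.2.f ≫ w.2.g = w'.1.g ≫ w.1.f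

/-- Third isomorphism theorem: `Y = ker (Z → L)` contains `N`, and `Y / N` is the kernel `M` of `X →
L`. -/
lemma exists_flagRel_of_kernel {L M N X Y Z : C} (w : ExtPair L M X × ExtPair X N Z)
    (q : ExtPair L Y Z) (hq : q.g = w.2.g ≫ w.1.g) :
    ∃ p : ExtPair M N Y, FlagRel w (p, q) := by
  obtain ⟨a, ha⟩ := comp_eq_zero_lift q w.2.f (by rw [hq, reassoc_of% w.2.zero, zero_comp])
  obtain ⟨b, hb⟩ := comp_eq_zero_lift w.1 (q.f ≫ w.2.g) (by
    rw [Category.assoc, ← hq, q.zero])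
  have hz : a ≫ b = 0 := by
    rw [← cancel_mono w.1.f, Category.assoc, hb, reassoc_of% ha, w.2.zero, zero_comp]
  have hm : Mono a := mono_of_mono_fac ha
  have he : Epi b := by
    rw [epi_iff_surjective_up_to_refinements]
    intro T m
    obtain ⟨T', π, hπ, z, hz⟩ := surjective_up_to_refinements_of_epi w.2.g (m ≫ w.1.f)
    obtain ⟨y, hy⟩ := comp_eq_zero_lift q z (by
      rw [hq, ← Category.assoc, ← hz, Category.assoc, Category.assoc, w.1.zero, comp_zero,
        comp_zero])
    refine ⟨T', π, hπ, y, ?_⟩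
    rw [← cancel_mono w.1.f, Category.assoc, hz, Category.assoc, hb, reassoc_of% hy]
  refine ⟨⟨(a, b), hz, ShortComplex.ShortExact.mk' ?_ hm he⟩, ha, hq.symm, hb.symm⟩
  refine ShortComplex.exact_of_f_is_kernel _ (KernelFork.IsLimit.ofι' _ _ fun k hk => ?_)
  have hk' : k ≫ b = 0 := hk
  have h : ∃ n, n ≫ w.2.f = k ≫ q.f := comp_eq_zero_lift w.2 (k ≫ q.f) (by
    rw [Category.assoc, ← hb, reassoc_of% hk', zero_comp])
  refine ⟨h.choose, ?_⟩
  change h.choose ≫ a = k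
  rw [← cancel_mono q.f, Category.assoc, ha, h.choose_spec]

lemma exists_flagRel_of_cokernel {L M N X Y Z : C} (w' : ExtPair M N Y × ExtPair L Y Z)
    (q : ExtPair X N Z) (hq : q.f = w'.1.f ≫ w'.2.f) :
    ∃ p : ExtPair L M X, FlagRel (p, q) w' := by
  obtain ⟨g, hg⟩ := comp_eq_zero_desc q w'.2.g (by
    rw [hq, Category.assoc, w'.2.zero, comp_zero])
  obtain ⟨f, hf⟩ := comp_eq_zero_desc w'.1 (w'.2.f ≫ q.g) (by
    rw [← Category.assoc, ← hq, q.zero])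
  have hz : f ≫ g = 0 := by
    rw [← cancel_epi w'.1.g, reassoc_of% hf, hg, w'.2.zero, comp_zero]
  have he : Epi g := epi_of_epi_fac hg
  have hm : Mono f := by
    refine Preadditive.mono_of_cancel_zero _ fun {T} m hm => ?_
    obtain ⟨T', π, hπ, y, hy⟩ := surjective_up_to_refinements_of_epi w'.1.g m
    obtain ⟨n, hn⟩ := comp_eq_zero_lift q (y ≫ w'.2.f) (by
      rw [Category.assoc, ← hf, ← Category.assoc, ← hy, Category.assoc, hm, comp_zero])
    have hn' : n ≫ w'.1.f = y := by
      rw [← cancel_mono w'.2.f, Category.assoc, ← hq, hn]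
    rw [← cancel_epi π, hy, ← hn', Category.assoc, w'.1.zero, comp_zero, comp_zero]
  refine ⟨⟨(f, g), hz, ShortComplex.ShortExact.mk' ?_ hm he⟩, hq.symm, hg, hf.symm⟩
  rw [ShortComplex.exact_iff_exact_up_to_refinements]
  intro T x hx
  obtain ⟨T', π, hπ, z, hz⟩ := surjective_up_to_refinements_of_epi q.g x
  have hx' : x ≫ g = 0 := hx
  obtain ⟨y, hy⟩ := comp_eq_zero_lift w'.2 z (by
    rw [← hg, ← Category.assoc, ← hz, Category.assoc, hx', comp_zero])
  refine ⟨T', π, hπ, y ≫ w'.1.g, ?_⟩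
  change π ≫ x = (y ≫ w'.1.g) ≫ f
  rw [hz, Category.assoc, hf, reassoc_of% hy]

/-- The kernel of the composite epimorphism of a flag. -/
lemma exists_kernel_extPair {L M N X Z : C} (w : ExtPair L M X × ExtPair X N Z) :
    ∃ q : ExtPair L (kernel (w.2.g ≫ w.1.g)) Z, q.g = w.2.g ≫ w.1.g :=
  ⟨⟨(kernel.ι _, w.2.g ≫ w.1.g), kernel.condition _, kernel_shortExact _⟩, rfl⟩

lemma exists_cokernel_extPair {L M N Y Z : C} (w' : ExtPair M N Y × ExtPair L Y Z) :
    ∃ q : ExtPair (cokernel (w'.1.f ≫ w'.2.f)) N Z, q.f = w'.1.f ≫ w'.2.f :=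
  ⟨⟨(w'.1.f ≫ w'.2.f, cokernel.π _), cokernel.condition _, cokernel_shortExact _⟩, rfl⟩

/-- A compatible flag through `Y` amounts to an identification of `Y` with the kernel of `Z → L`,
the remaining maps being forced. Weighting by `1 / |Aut Y|` and summing over `Y` thus gives each
flag mass one. -/
lemma flagRel_left_equiv {L M N X Z : C} (w : ExtPair L M X × ExtPair X N Z) (Y : C) :
    Nonempty ((kernel (w.2.g ≫ w.1.g) ≅ Y) ≃
      {w' : ExtPair M N Y × ExtPair L Y Z // FlagRel w w'}) := by
  obtain ⟨q, hq⟩ := exists_kernel_extPair w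
  let q' : (kernel (w.2.g ≫ w.1.g) ≅ Y) → ExtPair L Y Z := fun e =>
    q.map (Iso.refl L) e (Iso.refl Z)
  have hq' : ∀ e, (q' e).g = w.2.g ≫ w.1.g := by
    intro e
    simp [q', ExtPair.map, ExtPair.g, ← hq]
  have hqf : ∀ e, (q' e).f = e.inv ≫ q.f := by
    intro e
    simp [q', ExtPair.map, ExtPair.f]
  choose p hp using fun e => exists_flagRel_of_kernel w (q' e) (hq' e)
  refine ⟨Equiv.ofBijective (fun e => ⟨(p e, q' e), hp e⟩) ⟨?_, ?_⟩⟩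
  · intro e e' h
    have h' : (q' e).f = (q' e').f := congrArg (fun t => t.1.2.f) h
    rw [hqf, hqf, cancel_mono] at h'
    exact Iso.ext ((Iso.inv_eq_inv e e').1 h')
  · rintro ⟨⟨a, c⟩, hw⟩
    obtain ⟨u, hu⟩ := comp_eq_zero_lift q c.f (by rw [hq, hw.2.1, c.zero])
    obtain ⟨t, ht⟩ := comp_eq_zero_lift c q.f (by
      have h := q.zero
      rw [hq] at h
      exact (congrArg (q.f ≫ ·) hw.2.1.symm).trans h)
    let e : kernel (w.2.g ≫ w.1.g) ≅ Y := ⟨t, u, by rw [← cancel_mono q.f]; simp [hu, ht],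
      by rw [← cancel_mono c.f]; simp [hu, ht]⟩
    have h₁ : q' e = c := ExtPair.ext (by rw [hqf]; exact hu) ((hq' e).trans hw.2.1)
    refine ⟨e, Subtype.ext (Prod.ext (ExtPair.ext ?_ ?_) h₁)⟩
    · have := (hp e).1.trans hw.1.symm
      dsimp only at this
      rw [h₁, cancel_mono] at this
      exact this
    · have := (hp e).2.2
      dsimp only at this
      rw [h₁, hw.2.2, cancel_mono] at this
      exact this.symm

lemma flagRel_right_equiv {L M N Y Z : C} (w' : ExtPair M N Y × ExtPair L Y Z) (X : C) :
    Nonempty ((cokernel (w'.1.f ≫ w'.2.f) ≅ X) ≃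
      {w : ExtPair L M X × ExtPair X N Z // FlagRel w w'}) := by
  obtain ⟨q, hq⟩ := exists_cokernel_extPair w'
  let q' : (cokernel (w'.1.f ≫ w'.2.f) ≅ X) → ExtPair X N Z := fun e =>
    q.map e (Iso.refl N) (Iso.refl Z)
  have hq' : ∀ e, (q' e).f = w'.1.f ≫ w'.2.f := by
    intro e
    simp [q', ExtPair.map, ExtPair.f, ← hq]
  have hqg : ∀ e, (q' e).g = q.g ≫ e.hom := by
    intro e
    simp [q', ExtPair.map, ExtPair.g]
  choose p hp using fun e => exists_flagRel_of_cokernel w' (q' e) (hq' e)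
  refine ⟨Equiv.ofBijective (fun e => ⟨(p e, q' e), hp e⟩) ⟨?_, ?_⟩⟩
  · intro e e' h
    have h' : (q' e).g = (q' e').g := congrArg (fun t => t.1.2.g) h
    rw [hqg, hqg, cancel_epi] at h'
    exact Iso.ext h'
  · rintro ⟨⟨a, c⟩, hw⟩
    obtain ⟨u, hu⟩ := comp_eq_zero_desc q c.g (by rw [hq, hw.1, c.zero])
    obtain ⟨t, ht⟩ := comp_eq_zero_desc c q.g (by
      have h := q.zero
      rw [hq] at h
      exact (congrArg (· ≫ q.g) hw.1.symm).trans h)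
    let e : cokernel (w'.1.f ≫ w'.2.f) ≅ X := ⟨u, t, by rw [← cancel_epi q.g]; simp [reassoc_of% hu, ht],
      by rw [← cancel_epi c.g]; simp [hu, reassoc_of% ht]⟩
    have h₁ : q' e = c := ExtPair.ext ((hq' e).trans hw.1) (by rw [hqg]; exact hu)
    refine ⟨e, Subtype.ext (Prod.ext (ExtPair.ext ?_ ?_) h₁)⟩
    · have := (hp e).2.2
      dsimp only at this
      rw [h₁, hw.2.2, cancel_epi] at this
      exact this.symm
    · have := (hp e).2.1.trans hw.2.1.symm
      dsimp only at this
      rw [h₁, cancel_epi] at this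
      exact this

variable [∀ X Y : C, Finite (X ⟶ Y)] [∀ X Y : C, Finite (Ext X Y 1)]

lemma mem_support_hallProd {L M X : C} (p : ExtPair L M X) :
    IsoClass.mk X ∈ (hallProd L M).support := by
  rw [Finsupp.mem_support_iff, hallProd_apply, hallNumber_eq]
  have : Nonempty (ExtPair L M X) := ⟨p⟩
  have h₁ : (0 : ℚ) < Nat.card (ExtPair L M X) := by exact_mod_cast Nat.card_pos
  exact (div_pos h₁ (card_iso_pos X)).ne'

/-- The mass of the objects isomorphic to a given one. -/
lemma sum_card_iso_div (K : C) (s : Finset (IsoClass C)) (hs : IsoClass.mk K ∈ s) :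
    ∑ y ∈ s, (Nat.card (K ≅ y.rep) : ℚ) / Nat.card (y.rep ≅ y.rep) = 1 := by
  rw [Finset.sum_eq_single_of_mem _ hs]
  · rw [Nat.card_congr (⟨fun e => IsoClass.repIso K ≪≫ e,
      fun e => (IsoClass.repIso K).symm ≪≫ e, fun e => by ext; simp, fun e => by ext; simp⟩ :
      (K ≅ (IsoClass.mk K).rep) ≃ ((IsoClass.mk K).rep ≅ (IsoClass.mk K).rep))]
    exact div_self (card_iso_pos _).ne'
  · intro y _ hy
    have : IsEmpty (K ≅ y.rep) := ⟨fun e => hy (by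
      rw [← IsoClass.mk_rep y]
      exact IsoClass.mk_eq_iff.2 ⟨e.symm⟩)⟩
    simp

lemma sum_card_subtype {α β : Type*} [Finite α] [Finite β] (r : α → β → Prop) :
    ∑ᶠ a, (Nat.card {b // r a b} : ℚ) = ∑ᶠ b, (Nat.card {a // r a b} : ℚ) := by
  classical
  have := Fintype.ofFinite α
  have := Fintype.ofFinite β
  rw [finsum_eq_sum_of_fintype, finsum_eq_sum_of_fintype]
  simp only [Nat.card_eq_fintype_card, Fintype.card_subtype, Finset.card_filter]
  push_cast
  exact Finset.sum_comm

/-- Both iterated Hall products count the flags with given subquotients. -/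
lemma sum_hallNumber_assoc (L M N Z : C) :
    ∑ x ∈ (hallProd L M).support, hallNumber L M x.rep * hallNumber x.rep N Z =
      ∑ y ∈ (hallProd M N).support, hallNumber M N y.rep * hallNumber L y.rep Z := by
  set s := (hallProd L M).support
  set t := (hallProd M N).support
  let W : IsoClass C → Type v := fun x => ExtPair L M x.rep × ExtPair x.rep N Z
  let W' : IsoClass C → Type v := fun y => ExtPair M N y.rep × ExtPair L y.rep Z
  let a : IsoClass C → ℚ := fun x => Nat.card (x.rep ≅ x.rep)
  -- Replacing each flag by its compatible flags of the other kind, of total mass one, turns both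
  -- sides into the same double sum over `FlagRel`.
  have hW : ∀ x, (Nat.card (W x) : ℚ) =
      ∑ y ∈ t, (∑ᶠ w : W x, (Nat.card {w' : W' y // FlagRel w w'} : ℚ)) / a y := by
    intro x
    have h₁ : ∀ w : W x, ∑ y ∈ t, (Nat.card {w' : W' y // FlagRel w w'} : ℚ) / a y = 1 := by
      intro w
      obtain ⟨q, hq⟩ := exists_kernel_extPair w
      obtain ⟨p, -⟩ := exists_flagRel_of_kernel w q hq
      rw [← sum_card_iso_div _ t (mem_support_hallProd p)]
      refine Finset.sum_congr rfl fun y _ => ?_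
      rw [Nat.card_congr (flagRel_left_equiv w y.rep).some]
    have := Fintype.ofFinite (W x)
    simp only [finsum_eq_sum_of_fintype, Finset.sum_div]
    rw [Finset.sum_comm, Finset.sum_congr rfl fun w _ => h₁ w]
    simp
  have hW' : ∀ y, (Nat.card (W' y) : ℚ) =
      ∑ x ∈ s, (∑ᶠ w' : W' y, (Nat.card {w : W x // FlagRel w w'} : ℚ)) / a x := by
    intro y
    have h₁ : ∀ w' : W' y, ∑ x ∈ s, (Nat.card {w : W x // FlagRel w w'} : ℚ) / a x = 1 := by
      intro w'
      obtain ⟨q, hq⟩ := exists_cokernel_extPair w'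
      obtain ⟨p, -⟩ := exists_flagRel_of_cokernel w' q hq
      rw [← sum_card_iso_div _ s (mem_support_hallProd p)]
      refine Finset.sum_congr rfl fun x _ => ?_
      rw [Nat.card_congr (flagRel_right_equiv w' x.rep).some]
    have := Fintype.ofFinite (W' y)
    simp only [finsum_eq_sum_of_fintype, Finset.sum_div]
    rw [Finset.sum_comm, Finset.sum_congr rfl fun w _ => h₁ w]
    simp
  have e₁ : ∀ x, hallNumber L M x.rep * hallNumber x.rep N Z =
      Nat.card (W x) / a x / Nat.card (Z ≅ Z) := by
    intro x
    rw [hallNumber_eq, hallNumber_eq, Nat.card_prod]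
    push_cast
    simp only [a]
    ring
  have e₂ : ∀ y, hallNumber M N y.rep * hallNumber L y.rep Z =
      Nat.card (W' y) / a y / Nat.card (Z ≅ Z) := by
    intro y
    rw [hallNumber_eq, hallNumber_eq, Nat.card_prod]
    push_cast
    simp only [a]
    ring
  rw [Finset.sum_congr rfl fun x _ => e₁ x, Finset.sum_congr rfl fun y _ => e₂ y,
    ← Finset.sum_div, ← Finset.sum_div]
  congr 1
  simp only [hW, hW', Finset.sum_div]
  rw [Finset.sum_comm]
  refine Finset.sum_congr rfl fun y _ => Finset.sum_congr rfl fun x _ => ?_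
  rw [sum_card_subtype, div_right_comm]

lemma HallSpace.cls_rep (x : IsoClass C) : HallSpace.cls x.rep = Finsupp.single x 1 := by
  unfold HallSpace.cls
  rw [IsoClass.mk_rep]

lemma hallMul_eq_sum_left (u : HallSpace C) (v : HallSpace C) :
    hallMul C u v = u.sum fun x c => c • hallMul C (HallSpace.cls x.rep) v := by
  conv_lhs => rw [← Finsupp.sum_single u, Finsupp.sum, map_sum, LinearMap.sum_apply]
  refine Finset.sum_congr rfl fun x _ => ?_
  rw [← Finsupp.smul_single_one, map_smul, LinearMap.smul_apply, ← HallSpace.cls_rep]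

lemma hallMul_eq_sum_right (u : HallSpace C) (v : HallSpace C) :
    hallMul C u v = v.sum fun x c => c • hallMul C u (HallSpace.cls x.rep) := by
  conv_lhs => rw [← Finsupp.sum_single v, Finsupp.sum, map_sum]
  refine Finset.sum_congr rfl fun x _ => ?_
  rw [← Finsupp.smul_single_one, map_smul, ← HallSpace.cls_rep]

lemma hallMul_assoc_cls (L M N : C) :
    hallMul C (hallMul C (HallSpace.cls L) (HallSpace.cls M)) (HallSpace.cls N) =
      hallMul C (HallSpace.cls L) (hallMul C (HallSpace.cls M) (HallSpace.cls N)) := by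
  have hs : ∀ (L M : C) (x : IsoClass C), hallProd L M x = hallNumber L M x.rep := by
    intro L M x
    rw [← hallProd_apply, IsoClass.mk_rep]
  ext z
  induction z using IsoClass.ind with | _ Z
  rw [hallMul_eq_sum_left, hallMul_cls L M, hallMul_eq_sum_right (HallSpace.cls L),
    hallMul_cls M N, Finsupp.sum, Finsupp.sum, Finsupp.finsetSum_apply, Finsupp.finsetSum_apply]
  simp only [Finsupp.smul_apply, hallMul_cls_apply, hs, smul_eq_mul]
  exact sum_hallNumber_assoc L M N Z

lemma hallSpace_induction {p : HallSpace C → Prop} (h₀ : p 0)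
    (hadd : ∀ x y, p x → p y → p (x + y)) (hcls : ∀ (q : ℚ) (X : C), p (q • HallSpace.cls X))
    (x : HallSpace C) : p x := by
  induction x using Finsupp.induction_linear with
  | zero => exact h₀
  | add f g hf hg => exact hadd f g hf hg
  | single a b =>
    have := hcls b a.rep
    rwa [HallSpace.cls_rep, Finsupp.smul_single_one] at this

lemma hallSpace_linearMap_ext {W : Type*} [AddCommGroup W] [Module ℚ W]
    {φ ψ : HallSpace C →ₗ[ℚ] W} (h : ∀ X : C, φ (HallSpace.cls X) = ψ (HallSpace.cls X)) :
    φ = ψ := by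
  refine Finsupp.lhom_ext fun a b => ?_
  rw [← Finsupp.smul_single_one, map_smul, map_smul, ← IsoClass.mk_rep a]
  exact congrArg _ (h _)

lemma subsingleton_ext_of_isZero_left {X Y : C} (h : IsZero X) (n : ℕ) :
    Subsingleton (Ext X Y n) := by
  refine subsingleton_of_forall_eq 0 fun ξ => ?_
  rw [← Ext.mk₀_id_comp ξ, h.eq_of_src (𝟙 X) 0, Ext.mk₀_zero, Ext.zero_comp]

lemma subsingleton_ext_of_isZero_right {X Y : C} (h : IsZero Y) (n : ℕ) :
    Subsingleton (Ext X Y n) := by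
  refine subsingleton_of_forall_eq 0 fun ξ => ?_
  rw [← Ext.comp_mk₀_id ξ, h.eq_of_src (𝟙 Y) 0, Ext.mk₀_zero, Ext.comp_zero]

lemma hallMul_cls_of_subsingleton {L M X : C} (hh : Subsingleton (L ⟶ M))
    (he : Subsingleton (Ext L M 1)) (p : ExtPair L M X) :
    hallMul C (HallSpace.cls L) (HallSpace.cls M) = HallSpace.cls X := by
  have : Unique (Ext L M 1) := ⟨⟨0⟩, fun _ => Subsingleton.elim _ _⟩
  rw [hallMul_cls, hallProd, finsum_unique, Nat.card_unique, Nat.cast_one, inv_one, one_smul,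
    HallSpace.cls, HallSpace.cls, Subsingleton.elim default p.cls, mk_extMiddle]

lemma hallMul_zero_cls (X : C) : hallMul C (HallSpace.cls 0) (HallSpace.cls X) = HallSpace.cls X := by
  refine hallMul_cls_of_subsingleton ⟨fun _ _ => (isZero_zero C).eq_of_src _ _⟩
    (subsingleton_ext_of_isZero_left (isZero_zero C) 1) ⟨(𝟙 X, 0), comp_zero, ?_⟩
  exact ShortComplex.ShortExact.mk' ((ShortComplex.exact_iff_epi _ rfl).2
    (inferInstanceAs (Epi (𝟙 X)))) (inferInstanceAs (Mono (𝟙 X)))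
    (inferInstanceAs (Epi (0 : X ⟶ 0)))

lemma hallMul_cls_zero (X : C) : hallMul C (HallSpace.cls X) (HallSpace.cls 0) = HallSpace.cls X := by
  refine hallMul_cls_of_subsingleton ⟨fun _ _ => (isZero_zero C).eq_of_tgt _ _⟩
    (subsingleton_ext_of_isZero_right (isZero_zero C) 1) ⟨(0, 𝟙 X), zero_comp, ?_⟩
  exact ShortComplex.ShortExact.mk' ((ShortComplex.exact_iff_mono _ rfl).2
    (inferInstanceAs (Mono (𝟙 X)))) (inferInstanceAs (Mono (0 : 0 ⟶ X)))
    (inferInstanceAs (Epi (𝟙 X)))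

variable (C) in
/-- The Hall algebra of an abelian category with finite `Hom` and `Ext^1`. -/
lemma isHallAlgebra : IsHallAlgebra C where
  finite_hom := inferInstance
  finite_ext := inferInstance
  mul_apply := hallMul_cls_apply
  mul_assoc x y z := by
    induction x using hallSpace_induction with
    | h₀ => simp
    | hadd x x' h h' => simp only [map_add, LinearMap.add_apply, h, h']
    | hcls q X =>
    simp only [map_smul, LinearMap.smul_apply]
    congr 1
    induction y using hallSpace_induction with
    | h₀ => simp
    | hadd x x' h h' => simp only [map_add, LinearMap.add_apply, h, h']
    | hcls q Y =>
    simp only [map_smul, LinearMap.smul_apply]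
    congr 1
    induction z using hallSpace_induction with
    | h₀ => simp
    | hadd x x' h h' => simp only [map_add, h, h']
    | hcls q Z =>
    simp only [map_smul]
    rw [hallMul_assoc_cls]
  one_mul x := LinearMap.congr_fun (hallSpace_linearMap_ext (φ := hallMul C (HallSpace.cls 0))
    (ψ := LinearMap.id) hallMul_zero_cls) x
  mul_one x := LinearMap.congr_fun (hallSpace_linearMap_ext
    (φ := (hallMul C).flip (HallSpace.cls 0)) (ψ := LinearMap.id) hallMul_cls_zero) x

end Associativity

/-! ### Cones over objects and their adjunctions. -/

section Cones

variable {A : Type u} [Category.{v} A] [Abelian A]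
  {i j : ZMod 2} (hij : (ComplexShape.up (ZMod 2)).Rel i j)

lemma rel_symm {i j : ZMod 2} (hij : (ComplexShape.up (ZMod 2)).Rel i j) :
    (ComplexShape.up (ZMod 2)).Rel j i := by revert i j; decide

lemma rel_ne {i j : ZMod 2} (hij : (ComplexShape.up (ZMod 2)).Rel i j) : i ≠ j := by
  revert i j; decide

lemma rel_cases {i j : ZMod 2} (hij : (ComplexShape.up (ZMod 2)).Rel i j) (k : ZMod 2) :
    k = i ∨ k = j := by revert i j k; decide

lemma not_rel_self (i : ZMod 2) : ¬ (ComplexShape.up (ZMod 2)).Rel i i := by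
  revert i; decide

include hij in
lemma z2_hom_ext {K L : Z2Complex A} {φ ψ : K ⟶ L} (hi : φ.f i = ψ.f i) (hj : φ.f j = ψ.f j) :
    φ = ψ := by
  ext k
  rcases rel_cases hij k with rfl | rfl
  · exact hi
  · exact hj

/-- Constructor for morphisms of `ℤ/2`-graded complexes. -/
def z2Hom {K L : Z2Complex A} (a : K.X i ⟶ L.X i) (b : K.X j ⟶ L.X j)
    (h₁ : a ≫ L.d i j = K.d i j ≫ b) (h₂ : b ≫ L.d j i = K.d j i ≫ a) : K ⟶ L where
  f k := if h : k = i then (K.XIsoOfEq h).hom ≫ a ≫ (L.XIsoOfEq h).inv else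
    if h' : k = j then (K.XIsoOfEq h').hom ≫ b ≫ (L.XIsoOfEq h').inv else 0
  comm' k l hkl := by
    have hne := rel_ne hij
    rcases rel_cases hij k with rfl | rfl <;> rcases rel_cases hij l with rfl | rfl
    · exact absurd hkl (not_rel_self _)
    · simp [hne.symm, h₁]
    · simp [hne.symm, h₂]
    · exact absurd hkl (not_rel_self _)

@[simp]
lemma z2Hom_f₀ {K L : Z2Complex A} (a : K.X i ⟶ L.X i) (b : K.X j ⟶ L.X j)
    (h₁ : a ≫ L.d i j = K.d i j ≫ b) (h₂ : b ≫ L.d j i = K.d j i ≫ a) :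
    (z2Hom hij a b h₁ h₂).f i = a := by
  simp [z2Hom]

@[simp]
lemma z2Hom_f₁ {K L : Z2Complex A} (a : K.X i ⟶ L.X i) (b : K.X j ⟶ L.X j)
    (h₁ : a ≫ L.d i j = K.d i j ≫ b) (h₂ : b ≫ L.d j i = K.d j i ≫ a) :
    (z2Hom hij a b h₁ h₂).f j = b := by
  simp [z2Hom, (rel_ne hij).symm]

include hij in
lemma z2_mono {K L : Z2Complex A} (φ : K ⟶ L) (hi : Mono (φ.f i)) (hj : Mono (φ.f j)) :
    Mono φ := by
  refine Preadditive.mono_of_cancel_zero _ fun {T} t ht => z2_hom_ext hij ?_ ?_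
  · rw [← cancel_mono (φ.f i), ← HomologicalComplex.comp_f, ht]; simp
  · rw [← cancel_mono (φ.f j), ← HomologicalComplex.comp_f, ht]; simp

include hij in
lemma z2_isIso {K L : Z2Complex A} (φ : K ⟶ L) (hi : IsIso (φ.f i)) (hj : IsIso (φ.f j)) :
    IsIso φ := by
  have : ∀ k, IsIso (φ.f k) := by
    intro k
    rcases rel_cases hij k with rfl | rfl
    · exact hi
    · exact hj
  exact HomologicalComplex.Hom.isIso_of_components φ

/-- The complex with `X` in both degrees and the identity from degree `i` to degree `j`. -/
abbrev dbl (X : A) : Z2Complex A := HomologicalComplex.double (𝟙 X) hij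

/-- The component of `dbl` in degree `i`. -/
def dblIso₀ (X : A) : (dbl hij X).X i ≅ X := HomologicalComplex.doubleXIso₀ (𝟙 X) hij

/-- The component of `dbl` in degree `j`. -/
def dblIso₁ (X : A) : (dbl hij X).X j ≅ X :=
  HomologicalComplex.doubleXIso₁ (𝟙 X) hij (rel_ne hij)

lemma dbl_d (X : A) : (dbl hij X).d i j = (dblIso₀ hij X).hom ≫ (dblIso₁ hij X).inv := by
  rw [HomologicalComplex.double_d (𝟙 X) hij (rel_ne hij), Category.id_comp]
  rfl

lemma dbl_d_symm (X : A) : (dbl hij X).d j i = 0 :=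
  HomologicalComplex.double_d_eq_zero₀ (𝟙 X) hij _ _ (rel_ne hij).symm

/-- The morphism from `dbl` given by a morphism in degree `i`. -/
def fromDbl {X : A} {M : Z2Complex A} (x : X ⟶ M.X i) : dbl hij X ⟶ M :=
  z2Hom hij ((dblIso₀ hij X).hom ≫ x) ((dblIso₁ hij X).hom ≫ x ≫ M.d i j)
    (by simp [dbl_d]) (by simp [dbl_d_symm])

/-- The morphism to `dbl` given by a morphism in degree `j`. -/
def toDbl {X : A} {M : Z2Complex A} (x : M.X j ⟶ X) : M ⟶ dbl hij X :=
  z2Hom hij (M.d i j ≫ x ≫ (dblIso₀ hij X).inv) (x ≫ (dblIso₁ hij X).inv)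
    (by simp [dbl_d]) (by simp [dbl_d_symm])

@[simp]
lemma fromDbl_f₀ {X : A} {M : Z2Complex A} (x : X ⟶ M.X i) :
    (fromDbl hij x).f i = (dblIso₀ hij X).hom ≫ x := by simp [fromDbl]

@[simp]
lemma fromDbl_f₁ {X : A} {M : Z2Complex A} (x : X ⟶ M.X i) :
    (fromDbl hij x).f j = (dblIso₁ hij X).hom ≫ x ≫ M.d i j := by simp [fromDbl]

@[simp]
lemma toDbl_f₀ {X : A} {M : Z2Complex A} (x : M.X j ⟶ X) :
    (toDbl hij x).f i = M.d i j ≫ x ≫ (dblIso₀ hij X).inv := by simp [toDbl]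

@[simp]
lemma toDbl_f₁ {X : A} {M : Z2Complex A} (x : M.X j ⟶ X) :
    (toDbl hij x).f j = x ≫ (dblIso₁ hij X).inv := by simp [toDbl]

lemma from_dbl_ext {X : A} {M : Z2Complex A} {φ ψ : dbl hij X ⟶ M} (h : φ.f i = ψ.f i) :
    φ = ψ := by
  refine z2_hom_ext hij h ?_
  have h₁ := φ.comm i j
  have h₂ := ψ.comm i j
  have : IsIso ((dbl hij X).d i j) := by rw [dbl_d]; infer_instance
  rw [← cancel_epi ((dbl hij X).d i j), ← h₁, ← h₂, h]

lemma to_dbl_ext {X : A} {M : Z2Complex A} {φ ψ : M ⟶ dbl hij X} (h : φ.f j = ψ.f j) :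
    φ = ψ := by
  refine z2_hom_ext hij ?_ h
  have h₁ := φ.comm i j
  have h₂ := ψ.comm i j
  have : IsIso ((dbl hij X).d i j) := by rw [dbl_d]; infer_instance
  rw [← cancel_mono ((dbl hij X).d i j), h₁, h₂, h]

/-- The morphism `dbl X ⟶ dbl Y` induced by a morphism `X ⟶ Y`. -/
def dblMap {X Y : A} (x : X ⟶ Y) : dbl hij X ⟶ dbl hij Y := fromDbl hij (x ≫ (dblIso₀ hij Y).inv)

@[simp]
lemma dblMap_f₀ {X Y : A} (x : X ⟶ Y) :
    (dblMap hij x).f i = (dblIso₀ hij X).hom ≫ x ≫ (dblIso₀ hij Y).inv := by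
  simp [dblMap]

@[simp]
lemma dblMap_f₁ {X Y : A} (x : X ⟶ Y) :
    (dblMap hij x).f j = (dblIso₁ hij X).hom ≫ x ≫ (dblIso₁ hij Y).inv := by
  simp [dblMap, dbl_d]

/-- The functor `X ↦ dbl X`. -/
def dblFunctor : A ⥤ Z2Complex A where
  obj X := dbl hij X
  map x := dblMap hij x
  map_id X := from_dbl_ext hij (by simp)
  map_comp x y := from_dbl_ext hij (by simp)

/-- Morphisms from `dbl X` are morphisms from `X` in degree `i`. -/
def fromDblEquiv (X : A) (M : Z2Complex A) : (dbl hij X ⟶ M) ≃ (X ⟶ M.X i) where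
  toFun φ := (dblIso₀ hij X).inv ≫ φ.f i
  invFun x := fromDbl hij x
  left_inv φ := from_dbl_ext hij (by simp)
  right_inv x := by simp

/-- Morphisms to `dbl X` are morphisms to `X` in degree `j`. -/
def toDblEquiv (M : Z2Complex A) (X : A) : (M.X j ⟶ X) ≃ (M ⟶ dbl hij X) where
  toFun x := toDbl hij x
  invFun φ := φ.f j ≫ (dblIso₁ hij X).hom
  left_inv x := by simp
  right_inv φ := to_dbl_ext hij (by simp)

lemma fromDbl_comp_left {X Y : A} {M : Z2Complex A} (x : X ⟶ Y) (y : Y ⟶ M.X i) :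
    fromDbl hij (x ≫ y) = dblMap hij x ≫ fromDbl hij y :=
  from_dbl_ext hij (by simp)

lemma toDbl_comp_right {X Y : A} {M : Z2Complex A} (x : M.X j ⟶ X) (y : X ⟶ Y) :
    toDbl hij (x ≫ y) = toDbl hij x ≫ dblMap hij y :=
  to_dbl_ext hij (by simp)

/-- `dbl` is left adjoint to the evaluation in degree `i`. -/
def dblAdjEval : dblFunctor hij ⊣ HomologicalComplex.eval A (ComplexShape.up (ZMod 2)) i :=
  Adjunction.mkOfHomEquiv
    { homEquiv := fromDblEquiv hij
      homEquiv_naturality_left_symm := fromDbl_comp_left hij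
      homEquiv_naturality_right := fun {X _ _} x y =>
        (Category.assoc (dblIso₀ hij X).inv (x.f i) (y.f i)).symm }

/-- The evaluation in degree `j` is left adjoint to `dbl`. -/
def evalAdjDbl : HomologicalComplex.eval A (ComplexShape.up (ZMod 2)) j ⊣ dblFunctor hij :=
  Adjunction.mkOfHomEquiv
    { homEquiv := toDblEquiv hij
      homEquiv_naturality_left_symm := fun {_ _ X} x y =>
        Category.assoc (x.f j) (y.f j) (dblIso₁ hij X).hom
      homEquiv_naturality_right := toDbl_comp_right hij }

/-- Exactness is formal: `dblFunctor` is right adjoint to one evaluation and left adjoint to the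
other. -/
instance : PreservesFiniteLimits (dblFunctor (A := A) hij) :=
  have := (evalAdjDbl (A := A) hij).rightAdjoint_preservesLimits
  inferInstance

instance : PreservesFiniteColimits (dblFunctor (A := A) hij) :=
  have := (dblAdjEval (A := A) hij).leftAdjoint_preservesColimits
  inferInstance

lemma dblMap_add {X Y : A} (x y : X ⟶ Y) :
    dblMap hij (x + y) = dblMap hij x + dblMap hij y :=
  from_dbl_ext hij (by simp)

instance : (dblFunctor (A := A) hij).Additive where
  map_add := dblMap_add hij _ _

/-- Every complex embeds in a sum of two cones. -/
def embDbl (M : Z2Complex A) : M ⟶ dbl hij (M.X j) ⊞ dbl (rel_symm hij) (M.X i) :=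
  biprod.lift (toDbl hij (𝟙 _)) (toDbl (rel_symm hij) (𝟙 _))

instance (M : Z2Complex A) : Mono (embDbl hij M) := by
  refine z2_mono hij _ ?_ ?_
  -- In degree `i` the map to the second cone is already an isomorphism, in degree `j` the map to
  -- the first.
  · have h : (embDbl hij M).f i ≫ (biprod.snd : dbl hij (M.X j) ⊞ dbl (rel_symm hij) (M.X i) ⟶ _).f i
        = (dblIso₁ (rel_symm hij) (M.X i)).inv := by
      rw [← HomologicalComplex.comp_f, embDbl, biprod.lift_snd]
      simp
    exact mono_of_mono_fac h
  · have h : (embDbl hij M).f j ≫ (biprod.fst : dbl hij (M.X j) ⊞ dbl (rel_symm hij) (M.X i) ⟶ _).f j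
        = (dblIso₁ hij (M.X j)).inv := by
      rw [← HomologicalComplex.comp_f, embDbl, biprod.lift_fst]
      simp
    exact mono_of_mono_fac h

end Cones

/-! ### Finiteness of Hom and Ext for complexes. -/

section Finiteness

variable {A : Type u} [Category.{v} A] [Abelian A] [∀ X Y : A, Finite (X ⟶ Y)]

instance finite_z2_hom (L M : Z2Complex A) : Finite (L ⟶ M) :=
  Finite.of_injective (fun φ : L ⟶ M => (φ.f 0, φ.f 1)) fun _ _ h =>
    z2_hom_ext rel_zero_one (congrArg Prod.fst h) (congrArg Prod.snd h)

variable [∀ X Y : A, Finite (Ext X Y 1)] {i j : ZMod 2} (hij : (ComplexShape.up (ZMod 2)).Rel i j)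

omit [∀ X Y : A, Finite (X ⟶ Y)] in
lemma finite_ext_dbl (L : Z2Complex A) (X : A) : Finite (Ext L (dbl hij X) 1) :=
  Finite.of_equiv _ (adjExtEquiv (evalAdjDbl hij) L X).toEquiv

/-- `M` embeds in a sum of two cones, whose `Ext¹` is finite by adjunction; the kernel of the
induced map on `Ext¹` is an image of a finite `Hom` group. -/
instance finite_z2_ext (L M : Z2Complex A) : Finite (Ext L M 1) := by
  have := finite_ext_dbl rel_zero_one L (M.X 1)
  have := finite_ext_dbl (rel_symm rel_zero_one) L (M.X 0)
  have hQ : Finite (Ext L (dbl rel_zero_one (M.X 1) ⊞ dbl (rel_symm rel_zero_one) (M.X 0)) 1) :=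
    Finite.of_equiv _ (Ext.addEquivBiprod (X := L)
      (Y₁ := dbl rel_zero_one (M.X 1)) (Y₂ := dbl (rel_symm rel_zero_one) (M.X 0))
      (n := 1)).symm.toEquiv
  have hS := cokernel_shortExact (embDbl rel_zero_one M)
  let φ := (Ext.mk₀ (embDbl rel_zero_one M)).postcomp L (add_zero 1)
  have hker : Finite φ.ker := by
    have hs : ∀ x : φ.ker, ∃ y : L ⟶ cokernel (embDbl rel_zero_one M),
        (Ext.mk₀ y).comp hS.extClass (zero_add 1) = x.1 := by
      intro x
      obtain ⟨y, hy⟩ := Ext.covariant_sequence_exact₁ L hS x.1 x.2 rfl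
      obtain ⟨y, rfl⟩ := (Ext.mk₀_bijective _ _).2 y
      exact ⟨y, hy⟩
    choose y hy using hs
    exact Finite.of_injective y fun a b h => Subtype.ext (by rw [← hy, ← hy, h])
  have hran : Finite φ.range := inferInstanceAs (Finite (Subtype _))
  have hpos : Nat.card (Ext L M 1) ≠ 0 := by
    rw [← card_ker_mul_card_range φ]
    exact mul_ne_zero Nat.card_pos.ne' Nat.card_pos.ne'
  exact Nat.finite_of_card_ne_zero hpos

end Finiteness

/-! ### Dimension shifting. -/

section Vanishing

variable {C : Type u} [Category.{v} C] [Abelian C]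

lemma subsingleton_ext_three_right {Y : C} (h : ∀ N : C, Subsingleton (Ext N Y 2)) (N : C) :
    Subsingleton (Ext N Y 3) := by
  refine subsingleton_of_forall_eq 0 fun ξ => ?_
  obtain ⟨S, hS, rfl, x, rfl⟩ := exists_extClass_comp (n := 2) ξ rfl
  rw [(h S.X₁).elim x 0, Ext.comp_zero]

lemma subsingleton_ext_three_left {X : C} (h : ∀ N : C, Subsingleton (Ext X N 2)) (N : C) :
    Subsingleton (Ext X N 3) := by
  refine subsingleton_of_forall_eq 0 fun ξ => ?_
  obtain ⟨S, hS, rfl, x, rfl⟩ := exists_extClass_comp (n := 2) ξ rfl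
  obtain ⟨S', hS', h', y, rfl⟩ := exists_extClass_comp (n := 1) x rfl
  rw [← Ext.comp_assoc _ _ _ (show 1 + 1 = 2 by omega) (by omega) (by omega),
    (h S'.X₁).elim (Ext.comp _ _ _) 0, Ext.zero_comp]

lemma subsingleton_ext_middle_right {S : ShortComplex C} (hS : S.ShortExact) (N : C) {n : ℕ}
    (h₁ : Subsingleton (Ext N S.X₁ n)) (h₃ : Subsingleton (Ext N S.X₃ n)) :
    Subsingleton (Ext N S.X₂ n) := by
  refine subsingleton_of_forall_eq 0 fun ξ => ?_
  obtain ⟨x, rfl⟩ := Ext.covariant_sequence_exact₂ N hS ξ (h₃.elim _ _)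
  rw [h₁.elim x 0, Ext.zero_comp]

lemma subsingleton_ext_middle_left {S : ShortComplex C} (hS : S.ShortExact) (N : C) {n : ℕ}
    (h₁ : Subsingleton (Ext S.X₁ N n)) (h₃ : Subsingleton (Ext S.X₃ N n)) :
    Subsingleton (Ext S.X₂ N n) := by
  refine subsingleton_of_forall_eq 0 fun ξ => ?_
  obtain ⟨x, rfl⟩ := Ext.contravariant_sequence_exact₂ hS N ξ (h₁.elim _ _)
  rw [h₃.elim x 0, Ext.comp_zero]

end Vanishing

/-! ### Acyclic complexes and homology isomorphisms. -/

section Acyclic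

variable {A : Type u} [Category.{v} A] [Abelian A]

lemma isZero_homology_of_acyclic {K : Z2Complex A} (hK : K.Acyclic) (i : ZMod 2) :
    IsZero (K.homology i) :=
  (HomologicalComplex.exactAt_iff_isZero_homology K i).1 (hK i)

lemma acyclic_of_isZero_homology {K : Z2Complex A} (h : ∀ i, IsZero (K.homology i)) :
    K.Acyclic := fun i => (HomologicalComplex.exactAt_iff_isZero_homology K i).2 (h i)

lemma exists_rel (i : ZMod 2) : ∃ j, (ComplexShape.up (ZMod 2)).Rel i j := by
  revert i; decide

lemma acyclic_middle {L M X : Z2Complex A} (p : ExtPair L M X) (hL : L.Acyclic)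
    (hM : M.Acyclic) : X.Acyclic := by
  refine acyclic_of_isZero_homology fun i => ?_
  exact (p.shortExact.homology_exact₂ i).isZero_of_both_zeros
    ((isZero_homology_of_acyclic hM i).eq_of_src _ _)
    ((isZero_homology_of_acyclic hL i).eq_of_tgt _ _)

lemma acyclic_quotient {L M X : Z2Complex A} (p : ExtPair L M X) (hM : M.Acyclic)
    (hX : X.Acyclic) : L.Acyclic := by
  refine acyclic_of_isZero_homology fun i => ?_
  obtain ⟨j, hij⟩ := exists_rel i
  exact (p.shortExact.homology_exact₃ i j hij).isZero_of_both_zeros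
    ((isZero_homology_of_acyclic hX i).eq_of_src _ _)
    ((isZero_homology_of_acyclic hM j).eq_of_tgt _ _)

/-- A surjection with acyclic kernel induces isomorphisms in homology. -/
lemma isIso_homologyMap_g {L M X : Z2Complex A} (p : ExtPair L M X) (hM : M.Acyclic)
    (i : ZMod 2) : IsIso (HomologicalComplex.homologyMap p.g i) := by
  obtain ⟨j, hij⟩ := exists_rel i
  have hm : Mono (HomologicalComplex.homologyMap p.g i) :=
    (p.shortExact.homology_exact₂ i).mono_g ((isZero_homology_of_acyclic hM i).eq_of_src _ _)
  have he : Epi (HomologicalComplex.homologyMap p.g i) :=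
    (p.shortExact.homology_exact₃ i j hij).epi_f ((isZero_homology_of_acyclic hM j).eq_of_tgt _ _)
  exact isIso_of_mono_of_epi _

/-- An injection with acyclic cokernel induces isomorphisms in homology. -/
lemma isIso_homologyMap_f {L M X : Z2Complex A} (p : ExtPair L M X) (hL : L.Acyclic)
    (i : ZMod 2) : IsIso (HomologicalComplex.homologyMap p.f i) := by
  obtain ⟨j, hij⟩ := exists_rel i
  have hm : Mono (HomologicalComplex.homologyMap p.f i) :=
    (p.shortExact.homology_exact₁ j i (rel_symm hij)).mono_g
      ((isZero_homology_of_acyclic hL j).eq_of_src _ _)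
  have he : Epi (HomologicalComplex.homologyMap p.f i) :=
    (p.shortExact.homology_exact₂ i).epi_f ((isZero_homology_of_acyclic hL i).eq_of_tgt _ _)
  exact isIso_of_mono_of_epi _

/-- A morphism inducing isomorphisms in homology with zero kernel has acyclic cokernel. -/
lemma acyclic_of_isIso_homologyMap_f {L M X : Z2Complex A} (p : ExtPair L M X)
    (h : ∀ i, IsIso (HomologicalComplex.homologyMap p.f i)) : L.Acyclic := by
  refine acyclic_of_isZero_homology fun i => ?_
  obtain ⟨j, hij⟩ := exists_rel i
  refine (p.shortExact.homology_exact₃ i j hij).isZero_of_both_zeros ?_ ?_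
  · have := h i
    refine (cancel_epi (HomologicalComplex.homologyMap p.f i)).1 ?_
    have h₀ : HomologicalComplex.homologyMap p.f i ≫ HomologicalComplex.homologyMap p.g i = 0 := by
      rw [← HomologicalComplex.homologyMap_comp, p.zero, HomologicalComplex.homologyMap_zero]
    exact h₀.trans comp_zero.symm
  · have := h j
    refine (cancel_mono (HomologicalComplex.homologyMap p.f j)).1 ?_
    exact (p.shortExact.δ_comp i j hij).trans zero_comp.symm

variable {i j : ZMod 2} (hij : (ComplexShape.up (ZMod 2)).Rel i j)

lemma acyclic_dbl (X : A) : (dbl hij X).Acyclic := acyclic_double_id X hij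

include hij in
lemma isIso_d_of_acyclic {M : Z2Complex A} (hM : M.Acyclic) (h : M.d i j = 0) :
    IsIso (M.d j i) := by
  have hji := rel_symm hij
  have h₁ := hM j
  rw [HomologicalComplex.exactAt_iff' _ i j i
      ((ComplexShape.up (ZMod 2)).prev_eq' hij) ((ComplexShape.up (ZMod 2)).next_eq' hji)] at h₁
  have h₂ := hM i
  rw [HomologicalComplex.exactAt_iff' _ j i j
      ((ComplexShape.up (ZMod 2)).prev_eq' hji) ((ComplexShape.up (ZMod 2)).next_eq' hij)] at h₂
  have hm : Mono (M.d j i) := (ShortComplex.exact_iff_mono _ h).1 h₁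
  have he : Epi (M.d j i) := (ShortComplex.exact_iff_epi _ h).1 h₂
  exact isIso_of_mono_of_epi _

lemma exists_iso_dbl_of_acyclic {M : Z2Complex A} (hM : M.Acyclic) (h : M.d i j = 0) :
    Nonempty (dbl (rel_symm hij) (M.X j) ≅ M) := by
  have := isIso_d_of_acyclic hij hM h
  have : IsIso (fromDbl (rel_symm hij) (𝟙 (M.X j))) := by
    refine z2_isIso (rel_symm hij) _ ?_ ?_
    · rw [fromDbl_f₀]; infer_instance
    · rw [fromDbl_f₁]; infer_instance
  exact ⟨asIso (fromDbl (rel_symm hij) (𝟙 (M.X j)))⟩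

/-- The two sides of a pullback of complexes are jointly monic in each degree. -/
lemma pullback_f_ext {K L M : Z2Complex A} (f : K ⟶ M) (g : L ⟶ M) (n : ZMod 2) {W : A}
    {s t : W ⟶ (pullback f g).X n}
    (h₁ : s ≫ (pullback.fst f g).f n = t ≫ (pullback.fst f g).f n)
    (h₂ : s ≫ (pullback.snd f g).f n = t ≫ (pullback.snd f g).f n) : s = t :=
  ((IsPullback.of_hasPullback f g).map
    (HomologicalComplex.eval A (ComplexShape.up (ZMod 2)) n)).hom_ext h₁ h₂

end Acyclic

/-! ### Roofs of cones, and vanishing of `Ext²` against acyclic complexes. -/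

section Roofs

variable {A : Type u} [Category.{v} A] [Abelian A] [hHer : Fact (IsHereditary A)]
  {i j : ZMod 2} (hij : (ComplexShape.up (ZMod 2)).Rel i j)

lemma subsingleton_ext_two_dbl_right (N : Z2Complex A) (X : A) :
    Subsingleton (Ext N (dbl hij X) 2) :=
  subsingleton_ext_two_right (evalAdjDbl hij) X (fun _ => hHer.out _ _ 2 le_rfl) N

lemma subsingleton_ext_two_dbl_left (X : A) (N : Z2Complex A) :
    Subsingleton (Ext (dbl hij X) N 2) :=
  subsingleton_ext_two_left (dblAdjEval hij) X (fun _ => hHer.out _ _ 2 le_rfl) N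

/-- In a hereditary category, a morphism `d : M → N` lifts to a monomorphism to an extension of
`N` by the kernel of `d`. -/
lemma exists_mono_lift {M N : A} (d : M ⟶ N) :
    ∃ (E : A) (p : ExtPair N (kernel d) E) (m : M ⟶ E),
      Mono m ∧ kernel.ι d ≫ m = p.f ∧ m ≫ p.g = d := by
  have hK := image_shortExact d
  -- Since `Ext²(N / im d, ker d) = 0`, the extension `ker d → M → im d` is the restriction of an
  -- extension of `N` by `ker d`.
  obtain ⟨y, hy⟩ := exists_ext_contravariant (cokernel_shortExact (Limits.image.ι d)) (kernel d)
    (hHer.out _ _ 2 le_rfl) hK.extClass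
  obtain ⟨E, a, b, zero, hE, rfl⟩ := exists_shortExact_of_ext y
  obtain ⟨φ, h₁, h₃⟩ := exists_hom_of_extClass hK hE (𝟙 (kernel d)) (Limits.image.ι d) (by
    rw [Ext.comp_mk₀_id]
    exact hy.symm)
  have hf : kernel.ι d ≫ φ.τ₂ = a := by
    have := φ.comm₁₂
    rw [h₁] at this
    exact this.symm.trans (Category.id_comp _)
  have hg : φ.τ₂ ≫ b = d := by
    have := φ.comm₂₃
    rw [h₃] at this
    exact this.trans (Limits.image.fac d)
  refine ⟨E, ⟨(a, b), zero, hE⟩, φ.τ₂, ?_, hf, hg⟩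
  refine Preadditive.mono_of_cancel_zero _ fun {T} t ht => ?_
  have ht' : t ≫ φ.τ₂ = 0 := ht
  have htd : t ≫ d = 0 := by rw [← hg, reassoc_of% ht', zero_comp]
  have hE' : Mono a := hE.mono_f
  have : kernel.lift d t htd = 0 := by
    rw [← cancel_mono a, ← hf, kernel.lift_ι_assoc, ht', zero_comp]
  rw [← kernel.lift_ι d t htd, this, zero_comp]

/-- Every complex is connected through surjections with kernels `dbl` to a complex whose
differential vanishes in degree `i`. -/
lemma exists_roof (M : Z2Complex A) :
    ∃ (T M' : Z2Complex A) (X Y : A), Nonempty (ExtPair M (dbl hij X) T) ∧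
      Nonempty (ExtPair M' (dbl hij Y) T) ∧ M'.d i j = 0 ∧ (M.d j i = 0 → M'.d j i = 0) := by
  obtain ⟨E, p, m, hm, hpf, hpg⟩ := exists_mono_lift (M.d i j)
  -- The pullback `T` of the cone sequence of `p` along `M → dbl (M.X j)` maps onto `M` with kernel
  -- the cone over `ker d`. The monomorphism `m` embeds another cone, over `M.X i`, in `T`; the
  -- complex `M'` is the quotient by it.
  let b := dblMap hij p.g
  let η := toDbl hij (𝟙 (M.X j))
  have hS : (ShortComplex.mk (dblMap hij p.f) b (by
      refine from_dbl_ext hij ?_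
      simp [b, reassoc_of% p.zero])).ShortExact := p.shortExact.map_of_exact (dblFunctor hij)
  have hcompat : dblMap hij m ≫ b = fromDbl hij (𝟙 (M.X i)) ≫ η := by
    refine from_dbl_ext hij ?_
    simp [b, η, reassoc_of% hpg]
  let T := pullback b η
  let k : dbl hij (M.X i) ⟶ T := pullback.lift (dblMap hij m) (fromDbl hij (𝟙 (M.X i))) hcompat
  have hk₁ : k ≫ pullback.fst b η = dblMap hij m := pullback.lift_fst _ _ _
  have hk₂ : k ≫ pullback.snd b η = fromDbl hij (𝟙 (M.X i)) := pullback.lift_snd _ _ _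
  have hmm : Mono (dblMap hij m) := z2_mono hij _
    (by rw [dblMap_f₀]; infer_instance) (by rw [dblMap_f₁]; infer_instance)
  have hkm : Mono k := mono_of_mono_fac hk₁
  refine ⟨T, cokernel k, _, _, ⟨⟨(_, _), _, pullback_shortExact hS η⟩⟩,
    ⟨⟨(_, _), _, cokernel_shortExact k⟩⟩, ?_, fun h => ?_⟩
  · let x : T.X i ⟶ E := (pullback.fst b η).f i ≫ (dblIso₀ hij E).hom
    let y : T.X i ⟶ M.X i := (pullback.snd b η).f i
    have hxy : x ≫ p.g = y ≫ M.d i j := by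
      have h := congrArg (fun φ => φ.f i) (pullback.condition (f := b) (g := η))
      simp only [HomologicalComplex.comp_f, b, η, dblMap_f₀, toDbl_f₀, Category.id_comp] at h
      rw [← cancel_mono (dblIso₀ hij (M.X j)).inv]
      simpa [x, y] using h
    -- In degree `i`, an element of `T` is a pair `(x, y)` with equal images in `M.X j`. So `x - m
    -- y` comes from `ker d`, and absorbing it into `y` gives `v` with `m v = x` and `d v = d y`:
    -- the differential of `T` lands in the cone divided out.
    obtain ⟨z, hz⟩ := ShortExact.comp_eq_zero_lift p (x - y ≫ m) (by
      rw [Preadditive.sub_comp, Category.assoc y m p.g, hpg, hxy, sub_self])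
    let v : T.X i ⟶ M.X i := y + z ≫ kernel.ι (M.d i j)
    have hv₁ : v ≫ m = x := by
      simp [v, Preadditive.add_comp, hpf, hz]
    have hv₂ : v ≫ M.d i j = y ≫ M.d i j := by
      simp [v, Preadditive.add_comp]
    have hd : T.d i j = v ≫ (dblIso₁ hij (M.X i)).inv ≫ k.f j := by
      refine pullback_f_ext b η j ?_ ?_
      · rw [Category.assoc, Category.assoc, ← HomologicalComplex.comp_f, hk₁, dblMap_f₁,
          Iso.inv_hom_id_assoc, reassoc_of% hv₁]
        rw [← (pullback.fst b η).comm i j, dbl_d]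
        simp [x]
      · rw [Category.assoc, Category.assoc, ← HomologicalComplex.comp_f, hk₂, fromDbl_f₁,
          Iso.inv_hom_id_assoc, Category.id_comp, hv₂]
        exact ((pullback.snd b η).comm i j).symm
    rw [← cancel_epi ((cokernel.π k).f i), (cokernel.π k).comm i j, hd, Category.assoc,
      Category.assoc, ← HomologicalComplex.comp_f, cokernel.condition]
    simp
  · have hd : T.d j i = 0 := by
      refine pullback_f_ext b η i ?_ ?_
      · rw [← (pullback.fst b η).comm j i, dbl_d_symm, comp_zero, zero_comp]
      · rw [← (pullback.snd b η).comm j i, h, comp_zero, zero_comp]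
    rw [← cancel_epi ((cokernel.π k).f j), (cokernel.π k).comm j i, hd, zero_comp, comp_zero]

/-- Every acyclic complex is the quotient of an extension of two cones by a cone. -/
lemma exists_acyclic_resolution {K : Z2Complex A} (hK : K.Acyclic) :
    ∃ (T : Z2Complex A) (X Y W : A), Nonempty (ExtPair K (dbl hij X) T) ∧
      Nonempty (ExtPair (dbl (rel_symm hij) W) (dbl hij Y) T) := by
  obtain ⟨T, M', X, Y, ⟨p⟩, ⟨q⟩, h, -⟩ := exists_roof hij K
  have hT := acyclic_middle p hK (acyclic_dbl hij X)
  have hM' := acyclic_quotient q (acyclic_dbl hij Y) hT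
  obtain ⟨e⟩ := exists_iso_dbl_of_acyclic hij hM' h
  exact ⟨T, X, Y, M'.X j, ⟨p⟩, ⟨q.map e.symm (Iso.refl _) (Iso.refl _)⟩⟩

/-- In `Ext²(N, T) → Ext²(N, K) → Ext³(N, dbl X)` the outer terms vanish, `T` being an extension of
cones. -/
lemma subsingleton_ext_two_acyclic_right (N : Z2Complex A) {K : Z2Complex A} (hK : K.Acyclic) :
    Subsingleton (Ext N K 2) := by
  obtain ⟨T, X, Y, W, ⟨p⟩, ⟨q⟩⟩ := exists_acyclic_resolution rel_zero_one hK
  have h₁ : Subsingleton (Ext N T 2) := subsingleton_ext_middle_right q.shortExact N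
    (subsingleton_ext_two_dbl_right rel_zero_one N Y)
    (subsingleton_ext_two_dbl_right (rel_symm rel_zero_one) N W)
  have h₂ : Subsingleton (Ext N (dbl rel_zero_one X) 3) :=
    subsingleton_ext_three_right (fun N => subsingleton_ext_two_dbl_right rel_zero_one N X) N
  refine subsingleton_of_forall_eq 0 fun ξ => ?_
  obtain ⟨x, rfl⟩ := Ext.covariant_sequence_exact₃ N p.shortExact ξ (n₁ := 3) rfl (h₂.elim _ _)
  rw [h₁.elim x 0, Ext.zero_comp]

/-- The resolution presents `K` as a quotient, so in the first variable the vanishing of `Ext²` on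
its kernel only controls `Ext³` of `K`. -/
lemma subsingleton_ext_three_acyclic_left {K : Z2Complex A} (hK : K.Acyclic)
    (N : Z2Complex A) : Subsingleton (Ext K N 3) := by
  obtain ⟨T, X, Y, W, ⟨p⟩, ⟨q⟩⟩ := exists_acyclic_resolution rel_zero_one hK
  have h₁ : Subsingleton (Ext T N 3) := subsingleton_ext_middle_left q.shortExact N
    (subsingleton_ext_three_left (subsingleton_ext_two_dbl_left rel_zero_one Y) N)
    (subsingleton_ext_three_left (subsingleton_ext_two_dbl_left (rel_symm rel_zero_one) W) N)
  have h₂ := subsingleton_ext_two_dbl_left rel_zero_one X N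
  refine subsingleton_of_forall_eq 0 fun ξ => ?_
  obtain ⟨x, rfl⟩ := Ext.contravariant_sequence_exact₃ p.shortExact N ξ (h₁.elim _ _)
    (n₀ := 2) rfl
  rw [h₂.elim x 0, Ext.comp_zero]

omit hHer in
lemma acyclic_biprod {K K' : Z2Complex A} (hK : K.Acyclic) (hK' : K'.Acyclic) :
    (K ⊞ K').Acyclic :=
  acyclic_middle (L := K') (M := K) ⟨(biprod.inl, biprod.snd), biprod.inl_snd,
    (ShortComplex.Splitting.ofHasBinaryBiproduct K K').shortExact⟩ hK' hK

/-- Embedding `K` in a sum of cones recovers degree two: the cokernel is acyclic, so its `Ext³`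
vanishes and `Ext²(K, N)` is a quotient of `Ext²` of the cones. -/
lemma subsingleton_ext_two_acyclic_left {K : Z2Complex A} (hK : K.Acyclic) (N : Z2Complex A) :
    Subsingleton (Ext K N 2) := by
  have hS := cokernel_shortExact (embDbl rel_zero_one K)
  have h₁ := subsingleton_ext_three_acyclic_left (acyclic_quotient
    ⟨(_, _), _, cokernel_shortExact (embDbl rel_zero_one K)⟩ hK
    (acyclic_biprod (acyclic_dbl _ _) (acyclic_dbl _ _))) N
  have h₂ : Subsingleton
      (Ext (dbl rel_zero_one (K.X 1) ⊞ dbl (rel_symm rel_zero_one) (K.X 0)) N 2) :=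
    subsingleton_ext_middle_left (ShortComplex.Splitting.ofHasBinaryBiproduct _ _).shortExact N
      (subsingleton_ext_two_dbl_left rel_zero_one _ N)
      (subsingleton_ext_two_dbl_left (rel_symm rel_zero_one) _ N)
  refine subsingleton_of_forall_eq 0 fun ξ => ?_
  obtain ⟨x, rfl⟩ := Ext.contravariant_sequence_exact₁ hS N ξ (n₁ := 3) rfl (h₁.elim _ _)
  rw [h₂.elim x 0, Ext.comp_zero]

end Roofs

/-! ### Universal property of the Grothendieck group. -/

section GrothendieckGroup

variable {C : Type u} [Category.{v} C] [Abelian C]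

/-- The universal property of the Grothendieck group. -/
def K0.lift {G : Type*} [AddCommGroup G] (f : C → G)
    (h : ∀ L M X : C, ExtPair L M X → f X = f M + f L) :
    K0 C →+ G :=
  QuotientAddGroup.lift (K0.relations C) (FreeAbelianGroup.lift f) (by
    refine (AddSubgroup.closure_le _).2 ?_
    rintro _ ⟨S, hS, rfl⟩
    have : f S.X₂ = f S.X₁ + f S.X₃ :=
      h _ _ _ ⟨(S.f, S.g), S.zero, hS⟩
    simp [this])

@[simp]
lemma K0.lift_of {G : Type*} [AddCommGroup G] (f : C → G)
    (h : ∀ L M X : C, ExtPair L M X → f X = f M + f L) (X : C) :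
    K0.lift f h (K0.of X) = f X :=
  FreeAbelianGroup.lift_apply_of f X

lemma K0.hom_ext {G : Type*} [AddCommGroup G] {φ ψ : K0 C →+ G}
    (h : ∀ X, φ (K0.of X) = ψ (K0.of X)) : φ = ψ := by
  ext α
  obtain ⟨⟨X, Y⟩, rfl⟩ := K0.exists_eq_sub α
  rw [map_sub, map_sub, h, h]

lemma K0.of_extPair {L M X : C} (p : ExtPair L M X) : K0.of X = K0.of M + K0.of L := by
  have h' : FreeAbelianGroup.of X - (FreeAbelianGroup.of M + FreeAbelianGroup.of L) ∈
      K0.relations C := AddSubgroup.subset_closure ⟨_, p.shortExact, rfl⟩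
  have h2 := (QuotientAddGroup.eq_zero_iff _).2 h'
  exact sub_eq_zero.1 h2

lemma K0.of_isZero {X : C} (h : IsZero X) : K0.of X = 0 := by
  have p : ExtPair X X X := ⟨(0, 0), comp_zero,
    { exact := ShortComplex.exact_of_isZero_X₂ _ h
      mono_f := h.mono _
      epi_g := h.epi _ }⟩
  simpa using K0.of_extPair p

/-- An isomorphism as a short exact sequence with zero kernel. -/
def ExtPair.ofIso {X Y Z : C} (e : X ≅ Y) (hZ : IsZero Z) : ExtPair Y Z X :=
  ⟨(0, e.hom), zero_comp,
    { exact := (ShortComplex.exact_iff_mono _ rfl).2 (inferInstanceAs (Mono e.hom))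
      mono_f := hZ.mono _
      epi_g := inferInstanceAs (Epi e.hom) }⟩

/-- A split extension. -/
def ExtPair.split (M L : C) : ExtPair L M (M ⊞ L) :=
  ⟨(biprod.inl, biprod.snd), biprod.inl_snd,
    (ShortComplex.Splitting.ofHasBinaryBiproduct M L).shortExact⟩

lemma K0.of_iso {X Y : C} (e : X ≅ Y) : K0.of X = K0.of Y := by
  rw [K0.of_extPair (ExtPair.ofIso e (isZero_zero C)), K0.of_isZero (isZero_zero C), zero_add]

/-- The class of an isomorphism class in the Grothendieck group. -/
def K0.ofClass : IsoClass C → K0 C :=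
  Quotient.lift K0.of fun _ _ ⟨e⟩ => K0.of_iso e

end GrothendieckGroup

/-! ### Boundary classes and reduction to homology stalks. -/

section Invariants

variable {A : Type u} [Category.{v} A] [Abelian A]

/-- The class of the boundaries of degree `i` in the Grothendieck group. -/
def bdry (i : ZMod 2) (M : Z2Complex A) : K0 A := K0.of (M.cycles i) - K0.of (M.homology i)

variable {i j : ZMod 2} (hij : (ComplexShape.up (ZMod 2)).Rel i j)

include hij in
lemma bdry_eq_zero {M : Z2Complex A} (h : M.d i j = 0) : bdry j M = 0 := by
  have hp := (ComplexShape.up (ZMod 2)).prev_eq' hij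
  rw [bdry, K0.of_iso (M.isoHomologyπ i j hp h), sub_self]

-- Combines `X^i / Z^i ≅ B^j` with `Z^j / B^j ≅ H^j`, where `Z`, `B`, `H` are cycles, boundaries and
-- homology.
include hij in
lemma K0.of_X (M : Z2Complex A) :
    K0.of (M.X i) = K0.of (M.homology i) + bdry i M + bdry j M := by
  have hn := (ComplexShape.up (ZMod 2)).next_eq' hij
  have hp := (ComplexShape.up (ZMod 2)).prev_eq' hij
  let t := M.toCycles i j
  have h₁ : M.iCycles i ≫ Limits.factorThruImage t = 0 := by
    rw [← cancel_mono (Limits.image.ι t), ← cancel_mono (M.iCycles j)]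
    simp [t]
  have key : ∀ {T : A} (k : T ⟶ M.X i), k ≫ Limits.factorThruImage t = 0 → k ≫ M.d i j = 0 := by
    intro T k hk
    rw [← M.toCycles_i i j, show M.toCycles i j = Limits.factorThruImage t ≫ Limits.image.ι t from
      (Limits.image.fac t).symm, Category.assoc, reassoc_of% hk, zero_comp]
  have p₁ : ExtPair (Limits.image t) (M.cycles i) (M.X i) := by
    refine ⟨(M.iCycles i, Limits.factorThruImage t), h₁, ?_⟩
    refine
      { exact := ShortComplex.exact_of_f_is_kernel _
          (KernelFork.IsLimit.ofι' _ _ fun {T} k hk => ?_)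
        mono_f := inferInstanceAs (Mono (M.iCycles i))
        epi_g := inferInstanceAs (Epi (Limits.factorThruImage t)) }
    have hk' : k ≫ M.d i j = 0 := key k hk
    exact ⟨M.liftCycles k j hn hk', M.liftCycles_i k j hn hk'⟩
  have h₂ : Limits.image.ι t ≫ M.homologyπ j = 0 := by
    rw [← cancel_epi (Limits.factorThruImage t), Limits.image.fac_assoc, comp_zero]
    exact M.toCycles_comp_homologyπ i j
  have p₂ : ExtPair (M.homology j) (Limits.image t) (M.cycles j) := by
    refine ⟨(Limits.image.ι t, M.homologyπ j), h₂, ?_⟩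
    refine
      { exact := ShortComplex.exact_of_g_is_cokernel _
          (CokernelCofork.IsColimit.ofπ' _ _ fun {T} k hk => ?_)
        mono_f := inferInstanceAs (Mono (Limits.image.ι t))
        epi_g := inferInstanceAs (Epi (M.homologyπ j)) }
    have hk' : M.toCycles i j ≫ k = 0 := by
      have h : (Limits.factorThruImage t ≫ Limits.image.ι t) ≫ k = 0 := by
        rw [Category.assoc]
        exact (congrArg (Limits.factorThruImage t ≫ ·) hk).trans comp_zero
      rwa [Limits.image.fac] at h
    exact ⟨(M.homologyIsCokernel i j hp).desc (CokernelCofork.ofπ k hk'),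
      (M.homologyIsCokernel i j hp).fac (CokernelCofork.ofπ k hk') .one⟩
  have e₁ := K0.of_extPair p₁
  have e₂ := K0.of_extPair p₂
  rw [e₁, bdry, bdry, e₂]
  abel

-- A map that kills the image of the cycles of `X` kills the boundaries of `L`, since `X → L` is
-- onto in degree `i`. It then factors through homology, where surjectivity is assumed.
include hij in
lemma epi_cyclesMap_g {L M X : Z2Complex A} (p : ExtPair L M X)
    (h : Epi (HomologicalComplex.homologyMap p.g j)) :
    Epi (HomologicalComplex.cyclesMap p.g j) := by
  have hp := (ComplexShape.up (ZMod 2)).prev_eq' hij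
  refine Preadditive.epi_of_cancel_zero _ fun {T} t ht => ?_
  have hg : Epi (p.g.f i) := inferInstance
  have h₁ : L.toCycles i j ≫ t = 0 := by
    rw [← cancel_epi (p.g.f i), comp_zero]
    have : p.g.f i ≫ L.toCycles i j = X.toCycles i j ≫ HomologicalComplex.cyclesMap p.g j := by
      rw [← cancel_mono (L.iCycles j)]; simp
    rw [reassoc_of% this, ht, comp_zero]
  obtain ⟨t', ht'⟩ : ∃ t', L.homologyπ j ≫ t' = t :=
    ⟨(L.homologyIsCokernel i j hp).desc (CokernelCofork.ofπ t h₁),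
      (L.homologyIsCokernel i j hp).fac (CokernelCofork.ofπ t h₁) .one⟩
  have : t' = 0 := by
    rw [← cancel_epi (HomologicalComplex.homologyMap p.g j), ← cancel_epi (X.homologyπ j),
      HomologicalComplex.homologyπ_naturality_assoc, ht', ht, comp_zero, comp_zero]
  rw [← ht', this, comp_zero]

/-- Cycles are left exact; surjectivity on homology supplies the missing epimorphism. It holds when
either end is acyclic, whence the additivity of `bdry` in those cases. -/
lemma K0.of_cycles {L M X : Z2Complex A} (p : ExtPair L M X)
    (h : Epi (HomologicalComplex.homologyMap p.g i)) :
    K0.of (X.cycles i) = K0.of (M.cycles i) + K0.of (L.cycles i) := by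
  obtain ⟨j, hij⟩ := exists_rel i
  have he := epi_cyclesMap_g (rel_symm hij) p h
  have hf : Mono (p.f.f i) := inferInstance
  exact K0.of_extPair ⟨(HomologicalComplex.cyclesMap p.f i, HomologicalComplex.cyclesMap p.g i), _,
    { exact := HomologicalComplex.cycles_left_exact _ p.shortExact.exact i
      mono_f := inferInstanceAs (Mono (HomologicalComplex.cyclesMap p.f i))
      epi_g := he }⟩

lemma bdry_of_acyclic_left {L M X : Z2Complex A} (p : ExtPair L M X) (hM : M.Acyclic)
    (i : ZMod 2) : bdry i X = bdry i M + bdry i L := by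
  have h := isIso_homologyMap_g p hM i
  rw [bdry, bdry, bdry, K0.of_cycles p inferInstance, K0.of_isZero (isZero_homology_of_acyclic hM i),
    K0.of_iso (asIso (HomologicalComplex.homologyMap p.g i))]
  abel

lemma bdry_of_acyclic_right {L M X : Z2Complex A} (p : ExtPair L M X) (hL : L.Acyclic)
    (i : ZMod 2) : bdry i X = bdry i M + bdry i L := by
  have h := isIso_homologyMap_f p hL i
  rw [bdry, bdry, bdry, K0.of_cycles p ((isZero_homology_of_acyclic hL i).epi _),
    K0.of_isZero (isZero_homology_of_acyclic hL i),
    K0.of_iso (asIso (HomologicalComplex.homologyMap p.f i)).symm]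
  abel

/-- The isomorphism from a complex with zero differentials. -/
lemma homologyIso_of_d_eq_zero {M : Z2Complex A} (h : ∀ i j, M.d i j = 0) (i : ZMod 2) :
    Nonempty (M.homology i ≅ M.X i) :=
  ⟨(ShortComplex.HomologyData.ofZeros (M.sc i) (h _ _) (h _ _)).left.homologyIso⟩

lemma exists_iso_stalk {M : Z2Complex A} (h : ∀ i j, M.d i j = 0) :
    Nonempty (M ≅ stalk (M.X 1) ⊞ stalkStar (M.X 0)) := by
  let a : M ⟶ stalk (M.X 1) := HomologicalComplex.mkHomToSingle (𝟙 _) (by simp [h])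
  let b : M ⟶ stalkStar (M.X 0) := HomologicalComplex.mkHomToSingle (𝟙 _) (by simp [h])
  let c : stalk (M.X 1) ⟶ M := HomologicalComplex.mkHomFromSingle (𝟙 _) (by simp [h])
  let d : stalkStar (M.X 0) ⟶ M := HomologicalComplex.mkHomFromSingle (𝟙 _) (by simp [h])
  have z₁ : ∀ X : A, IsZero ((stalk X).X 0) := fun X =>
    HomologicalComplex.isZero_single_obj_X _ _ _ _ (by decide)
  have z₀ : ∀ X : A, IsZero ((stalkStar X).X 1) := fun X =>
    HomologicalComplex.isZero_single_obj_X _ _ _ _ (by decide)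
  have ha : a.f 1 = (HomologicalComplex.singleObjXSelf _ 1 (M.X 1)).inv := by
    exact (HomologicalComplex.mkHomToSingle_f _ _).trans (Category.id_comp _)
  have hb : b.f 0 = (HomologicalComplex.singleObjXSelf _ 0 (M.X 0)).inv := by
    exact (HomologicalComplex.mkHomToSingle_f _ _).trans (Category.id_comp _)
  have hc : c.f 1 = (HomologicalComplex.singleObjXSelf _ 1 (M.X 1)).hom := by
    exact (HomologicalComplex.mkHomFromSingle_f _ _).trans (Category.comp_id _)
  have hd : d.f 0 = (HomologicalComplex.singleObjXSelf _ 0 (M.X 0)).hom := by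
    exact (HomologicalComplex.mkHomFromSingle_f _ _).trans (Category.comp_id _)
  refine ⟨⟨biprod.lift a b, biprod.desc c d, ?_, ?_⟩⟩
  · rw [biprod.lift_desc]
    refine z2_hom_ext rel_zero_one ?_ ?_
    · rw [HomologicalComplex.add_f_apply, HomologicalComplex.comp_f, HomologicalComplex.comp_f,
        (z₁ _).eq_of_tgt (a.f 0) 0, zero_comp, zero_add, hb, hd]
      exact Iso.inv_hom_id _
    · rw [HomologicalComplex.add_f_apply, HomologicalComplex.comp_f, HomologicalComplex.comp_f,
        (z₀ _).eq_of_tgt (b.f 1) 0, zero_comp, add_zero, ha, hc]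
      exact Iso.inv_hom_id _
  · have hca : c ≫ a = 𝟙 _ := z2_hom_ext rel_zero_one ((z₁ _).eq_of_src _ _) (by
      rw [HomologicalComplex.comp_f, ha, hc]; exact Iso.hom_inv_id _)
    have hdb : d ≫ b = 𝟙 _ := z2_hom_ext rel_zero_one (by
      rw [HomologicalComplex.comp_f, hb, hd]; exact Iso.hom_inv_id _) ((z₀ _).eq_of_src _ _)
    have hcb : c ≫ b = 0 := z2_hom_ext rel_zero_one ((z₁ _).eq_of_src _ _) ((z₀ _).eq_of_tgt _ _)
    have hda : d ≫ a = 0 := z2_hom_ext rel_zero_one ((z₁ _).eq_of_tgt _ _) ((z₀ _).eq_of_src _ _)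
    refine biprod.hom_ext' _ _ (biprod.hom_ext _ _ ?_ ?_) (biprod.hom_ext _ _ ?_ ?_) <;>
      simp [hca, hdb, hcb, hda]

lemma acyclic_of_isZero {K : Z2Complex A} (h : IsZero K) : K.Acyclic :=
  acyclic_of_isZero_homology fun i => (HomologicalComplex.homologyFunctor A _ i).map_isZero h

/-- The stalks with isomorphic terms are isomorphic. -/
def stalkSumIso {X X' Y Y' : A} (x : X ≅ X') (y : Y ≅ Y') :
    stalk X ⊞ stalkStar Y ≅ stalk X' ⊞ stalkStar Y' :=
  biprod.mapIso ((HomologicalComplex.single A _ 1).mapIso x)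
    ((HomologicalComplex.single A _ 0).mapIso y)

/-- Up to surjections with acyclic kernel, a complex is the sum of its homology stalks. -/
lemma rel_stalk_homology [hHer : Fact (IsHereditary A)] {r : Z2Complex A → Z2Complex A → Prop}
    (hr : Equivalence r) (h : ∀ {L M X : Z2Complex A}, ExtPair L M X → M.Acyclic → r X L)
    (M : Z2Complex A) : r M (stalk (M.homology 1) ⊞ stalkStar (M.homology 0)) := by
  have step : ∀ {i j : ZMod 2} (_ : (ComplexShape.up (ZMod 2)).Rel i j) (M : Z2Complex A),
      ∃ M' : Z2Complex A, r M M' ∧ (∀ n, Nonempty (M.homology n ≅ M'.homology n)) ∧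
        M'.d i j = 0 ∧ (M.d j i = 0 → M'.d j i = 0) := by
    intro i j hij M
    obtain ⟨T, M', X, Y, ⟨p⟩, ⟨q⟩, h₁, h₂⟩ := exists_roof hij M
    refine ⟨M', hr.trans (hr.symm (h p (acyclic_dbl hij X))) (h q (acyclic_dbl hij Y)),
      fun n => ?_, h₁, h₂⟩
    have := isIso_homologyMap_g p (acyclic_dbl hij X) n
    have := isIso_homologyMap_g q (acyclic_dbl hij Y) n
    exact ⟨(asIso (HomologicalComplex.homologyMap p.g n)).symm ≪≫
      asIso (HomologicalComplex.homologyMap q.g n)⟩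
  -- One roof kills `d⁰`; a second kills `d¹` and keeps `d⁰` zero. The homology is unchanged
  -- throughout.
  obtain ⟨M₁, hM₁, e₁, d₁, -⟩ := step rel_zero_one M
  obtain ⟨M₂, hM₂, e₂, d₂, d₃⟩ := step rel_one_zero M₁
  have hd : ∀ i j, M₂.d i j = 0 := by
    intro i j
    by_cases hij : (ComplexShape.up (ZMod 2)).Rel i j
    · rcases (by revert i j; decide : (i = 0 ∧ j = 1) ∨ (i = 1 ∧ j = 0)) with ⟨rfl, rfl⟩ | ⟨rfl, rfl⟩
      · exact d₃ d₁
      · exact d₂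
    · exact M₂.shape _ _ hij
  have e : ∀ n, Nonempty (M₂.X n ≅ M.homology n) := fun n =>
    ⟨((e₁ n).some ≪≫ (e₂ n).some ≪≫ (homologyIso_of_d_eq_zero hd n).some).symm⟩
  obtain ⟨f⟩ := exists_iso_stalk hd
  exact hr.trans hM₁ (hr.trans hM₂ (h (ExtPair.ofIso
    (f ≪≫ stalkSumIso (e 1).some (e 0).some) (isZero_zero _)) (acyclic_of_isZero (isZero_zero _))))

end Invariants

/-! ### The index of a complex. -/

section Index

variable {A : Type u} [Category.{v} A] [Abelian A]

variable (A) in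
/-- The index set of the basis of the modified Hall algebra. -/
abbrev HallIndex : Type u := IsoClass A × IsoClass A × K0 A × K0 A

/-- The pair of boundary classes of a complex. -/
def bd (M : Z2Complex A) : K0 A × K0 A := (bdry 1 M, bdry 0 M)

/-- The homology and the boundary classes of a complex. -/
def index (M : Z2Complex A) : HallIndex A :=
  (IsoClass.mk (M.homology 1), IsoClass.mk (M.homology 0), bd M)

namespace HallIndex

/-- Translation of the boundary classes. -/
def shift (κ : K0 A × K0 A) (b : HallIndex A) : HallIndex A := (b.1, b.2.1, b.2.2 + κ)

/-- The class of the degree `1` component. -/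
def deg₁ (b : HallIndex A) : K0 A := K0.ofClass b.1 + b.2.2.1 + b.2.2.2

/-- The class of the degree `0` component. -/
def deg₀ (b : HallIndex A) : K0 A := K0.ofClass b.2.1 + b.2.2.1 + b.2.2.2

lemma shift_zero (b : HallIndex A) : shift 0 b = b := by simp [shift]

lemma shift_shift (κ κ' : K0 A × K0 A) (b : HallIndex A) :
    shift κ (shift κ' b) = shift (κ + κ') b := by
  simp only [shift, add_assoc, add_comm κ' κ]

lemma deg₁_shift (κ : K0 A × K0 A) (b : HallIndex A) :
    (shift κ b).deg₁ = b.deg₁ + (κ.1 + κ.2) := by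
  simp only [shift, deg₁, Prod.fst_add, Prod.snd_add]; abel

lemma deg₀_shift (κ : K0 A × K0 A) (b : HallIndex A) :
    (shift κ b).deg₀ = b.deg₀ + (κ.1 + κ.2) := by
  simp only [shift, deg₀, Prod.fst_add, Prod.snd_add]; abel

end HallIndex

open HallIndex

lemma deg₁_index (M : Z2Complex A) : (index M).deg₁ = K0.of (M.X 1) :=
  (K0.of_X rel_one_zero M).symm

lemma deg₀_index (M : Z2Complex A) : (index M).deg₀ = K0.of (M.X 0) := by
  rw [K0.of_X rel_zero_one M, add_right_comm]; rfl

lemma bd_of_acyclic_left {L M X : Z2Complex A} (p : ExtPair L M X) (hM : M.Acyclic) :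
    bd X = bd M + bd L :=
  Prod.ext (bdry_of_acyclic_left p hM 1) (bdry_of_acyclic_left p hM 0)

lemma bd_of_acyclic_right {L M X : Z2Complex A} (p : ExtPair L M X) (hL : L.Acyclic) :
    bd X = bd M + bd L :=
  Prod.ext (bdry_of_acyclic_right p hL 1) (bdry_of_acyclic_right p hL 0)

lemma index_of_acyclic_left {L M X : Z2Complex A} (p : ExtPair L M X) (hM : M.Acyclic) :
    index X = shift (bd M) (index L) := by
  have h₁ := isIso_homologyMap_g p hM 1
  have h₀ := isIso_homologyMap_g p hM 0
  refine Prod.ext (IsoClass.mk_eq_iff.2 ⟨asIso (HomologicalComplex.homologyMap p.g 1)⟩)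
    (Prod.ext (IsoClass.mk_eq_iff.2 ⟨asIso (HomologicalComplex.homologyMap p.g 0)⟩) ?_)
  exact (bd_of_acyclic_left p hM).trans (add_comm _ _)

lemma index_of_acyclic_right {L M X : Z2Complex A} (p : ExtPair L M X) (hL : L.Acyclic) :
    index X = shift (bd L) (index M) := by
  have h₁ := isIso_homologyMap_f p hL 1
  have h₀ := isIso_homologyMap_f p hL 0
  refine Prod.ext (IsoClass.mk_eq_iff.2 ⟨(asIso (HomologicalComplex.homologyMap p.f 1)).symm⟩)
    (Prod.ext (IsoClass.mk_eq_iff.2 ⟨(asIso (HomologicalComplex.homologyMap p.f 0)).symm⟩) ?_)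
  exact bd_of_acyclic_right p hL

lemma bd_of_isZero {M : Z2Complex A} (h : IsZero M) : bd M = 0 := by
  have := bd_of_acyclic_left (ExtPair.ofIso (Iso.refl M) h) (acyclic_of_isZero h)
  simpa using this

lemma index_iso {M M' : Z2Complex A} (e : M ≅ M') : index M = index M' := by
  rw [index_of_acyclic_left (ExtPair.ofIso e (isZero_zero _)) (acyclic_of_isZero (isZero_zero _)),
    bd_of_isZero (isZero_zero _), shift_zero]

lemma index_acyclic {K : Z2Complex A} (hK : K.Acyclic) :
    index K = (IsoClass.mk 0, IsoClass.mk 0, bd K) :=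
  Prod.ext (IsoClass.mk_eq_iff.2 ⟨(isZero_homology_of_acyclic hK 1).isoZero⟩)
    (Prod.ext (IsoClass.mk_eq_iff.2 ⟨(isZero_homology_of_acyclic hK 0).isoZero⟩) rfl)

lemma index_stalk (X Y : A) :
    index (stalk X ⊞ stalkStar Y) = (IsoClass.mk X, IsoClass.mk Y, 0) := by
  have hd : ∀ i j, (stalk X ⊞ stalkStar Y).d i j = 0 := by
    intro i j
    have h₁ : (stalk X).d i j = 0 := by unfold stalk; simp
    have h₂ : (stalkStar Y).d i j = 0 := by unfold stalkStar; simp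
    have h := biprod.total (X := stalk X) (Y := stalkStar Y)
    have h' := congrArg (fun φ => φ.f i ≫ (stalk X ⊞ stalkStar Y).d i j) h
    simp only [HomologicalComplex.add_f_apply, HomologicalComplex.comp_f,
      HomologicalComplex.id_f, Preadditive.add_comp, Category.assoc, Category.id_comp,
      HomologicalComplex.Hom.comm, h₁, h₂] at h'
    rw [← h']
    simp
  obtain ⟨e₁⟩ := homologyIso_of_d_eq_zero hd 1
  obtain ⟨e₀⟩ := homologyIso_of_d_eq_zero hd 0
  have s₁ : (HomologicalComplex.eval A (ComplexShape.up (ZMod 2)) 1).obj (stalk X) ≅ X :=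
    HomologicalComplex.singleObjXSelf (ComplexShape.up (ZMod 2)) 1 X
  have s₀ : (HomologicalComplex.eval A (ComplexShape.up (ZMod 2)) 0).obj (stalkStar Y) ≅ Y :=
    HomologicalComplex.singleObjXSelf (ComplexShape.up (ZMod 2)) 0 Y
  have z₁ : IsZero ((HomologicalComplex.eval A (ComplexShape.up (ZMod 2)) 1).obj (stalkStar Y)) :=
    HomologicalComplex.isZero_single_obj_X (ComplexShape.up (ZMod 2)) 0 Y 1 (by decide)
  have z₀ : IsZero ((HomologicalComplex.eval A (ComplexShape.up (ZMod 2)) 0).obj (stalk X)) :=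
    HomologicalComplex.isZero_single_obj_X (ComplexShape.up (ZMod 2)) 1 X 0 (by decide)
  have f₁ : (stalk X ⊞ stalkStar Y).X 1 ≅ X :=
    (HomologicalComplex.eval A _ 1).mapBiprod (stalk X) (stalkStar Y) ≪≫
      biprod.mapIso s₁ z₁.isoZero ≪≫
      (isoBiprodZero (isZero_zero A)).symm
  have f₀ : (stalk X ⊞ stalkStar Y).X 0 ≅ Y :=
    (HomologicalComplex.eval A _ 0).mapBiprod (stalk X) (stalkStar Y) ≪≫
      biprod.mapIso z₀.isoZero s₀ ≪≫
      (isoZeroBiprod (isZero_zero A)).symm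
  exact Prod.ext (IsoClass.mk_eq_iff.2 ⟨e₁ ≪≫ f₁⟩) (Prod.ext (IsoClass.mk_eq_iff.2 ⟨e₀ ≪≫ f₀⟩)
    (Prod.ext (bdry_eq_zero rel_zero_one (hd 0 1)) (bdry_eq_zero rel_one_zero (hd 1 0))))

variable {i j : ZMod 2} (hij : (ComplexShape.up (ZMod 2)).Rel i j)

lemma bdry_dbl₀ (X : A) : bdry i (dbl hij X) = 0 :=
  bdry_eq_zero (rel_symm hij) (dbl_d_symm hij X)

lemma bdry_dbl₁ (X : A) : bdry j (dbl hij X) = K0.of X := by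
  have h := K0.of_X hij (dbl hij X)
  rw [K0.of_iso (dblIso₀ hij X), bdry_dbl₀,
    K0.of_isZero (isZero_homology_of_acyclic (acyclic_dbl hij X) i)] at h
  simpa using h.symm

/-- As `bd` lists degree `1` first, its two coordinates are the exponents of `K_α` and `K_β^*`. -/
lemma bd_cone (X : A) : bd (cone X) = (K0.of X, 0) :=
  Prod.ext (bdry_dbl₁ rel_zero_one X) (bdry_dbl₀ rel_zero_one X)

lemma bd_coneStar (X : A) : bd (coneStar X) = (0, K0.of X) :=
  Prod.ext (bdry_dbl₀ rel_one_zero X) (bdry_dbl₁ rel_one_zero X)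

variable [hHer : Fact (IsHereditary A)]

/-- Two additive functions on acyclic complexes which agree on the cones are equal. -/
lemma acyclic_additive_eq {G : Type*} [AddCommGroup G] (f g : Z2Complex A → G)
    (hf : ∀ {L M X : Z2Complex A}, ExtPair L M X → M.Acyclic → L.Acyclic → f X = f M + f L)
    (hg : ∀ {L M X : Z2Complex A}, ExtPair L M X → M.Acyclic → L.Acyclic → g X = g M + g L)
    (h₁ : ∀ X, f (cone X) = g (cone X)) (h₀ : ∀ X, f (coneStar X) = g (coneStar X))
    {K : Z2Complex A} (hK : K.Acyclic) : f K = g K := by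
  -- The resolution writes the value at `K` as the sum of the values at two cones minus that at a
  -- third.
  obtain ⟨T, X, Y, W, ⟨p⟩, ⟨q⟩⟩ := exists_acyclic_resolution rel_zero_one hK
  have e₁ := hf p (acyclic_dbl _ _) hK
  have e₂ := hf q (acyclic_dbl _ _) (acyclic_dbl _ _)
  have e₃ := hg p (acyclic_dbl _ _) hK
  have e₄ := hg q (acyclic_dbl _ _) (acyclic_dbl _ _)
  have a := h₁ X
  have b := h₁ Y
  have c := h₀ W
  change f (dbl rel_zero_one X) = g (dbl rel_zero_one X) at a
  change f (dbl rel_zero_one Y) = g (dbl rel_zero_one Y) at b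
  change f (dbl (rel_symm rel_zero_one) W) = g (dbl (rel_symm rel_zero_one) W) at c
  rw [e₂, a, b, c, ← e₄, e₃] at e₁
  exact (add_left_cancel e₁).symm

end Index

/-! ### The Euler form on the Grothendieck group. -/

section Euler

variable {C : Type u} [Category.{v} C] [Abelian C] [∀ X Y : C, Finite (X ⟶ Y)]
  [∀ X Y : C, Finite (Ext X Y 1)]

/-- The Euler form with values in the group of units. -/
def eulerUnit (X Y : C) : Additive ℚˣ :=
  Additive.ofMul (Units.mk0 (eulerForm X Y) (eulerForm_pos X Y).ne')

lemma eulerUnit_of_mul {X Y X' Y' X'' Y'' : C}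
    (h : eulerForm X Y = eulerForm X' Y' * eulerForm X'' Y'') :
    eulerUnit X Y = eulerUnit X' Y' + eulerUnit X'' Y'' :=
  congrArg Additive.ofMul (Units.ext h)

lemma eulerUnit_congr {D : Type u'} [Category.{v'} D] [Abelian D] [∀ X Y : D, Finite (X ⟶ Y)]
    [∀ X Y : D, Finite (Ext X Y 1)] {X Y : C} {X' Y' : D}
    (h : eulerForm X Y = eulerForm X' Y') : eulerUnit X Y = eulerUnit X' Y' :=
  congrArg Additive.ofMul (Units.ext h)

variable [hHer : Fact (IsHereditary C)]

/-- The Euler form on the Grothendieck group, with values in the group of units. -/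
def eulerHom : K0 C →+ K0 C →+ Additive ℚˣ :=
  K0.lift (fun X => K0.lift (fun Y => eulerUnit X Y) fun _ _ _ p => eulerUnit_of_mul
    (eulerForm_covariant p.shortExact X
      (exists_ext_covariant p.shortExact X (hHer.out _ _ 2 le_rfl)))) fun _ _ _ p => by
    refine K0.hom_ext fun Y => ?_
    rw [AddMonoidHom.add_apply, K0.lift_of, K0.lift_of, K0.lift_of]
    exact eulerUnit_of_mul (eulerForm_contravariant p.shortExact Y
      (exists_ext_contravariant p.shortExact Y (hHer.out _ _ 2 le_rfl)))

lemma eulerHom_of (X Y : C) : eulerHom (K0.of X) (K0.of Y) = eulerUnit X Y :=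
  (DFunLike.congr_fun (K0.lift_of _ _ X) _).trans (K0.lift_of _ _ Y)

/-- The Euler form on the Grothendieck group. -/
def eulerK0 (α β : K0 C) : ℚ := ((eulerHom α β).toMul : ℚˣ)

lemma eulerK0_of (X Y : C) : eulerK0 (K0.of X) (K0.of Y) = eulerForm X Y := by
  rw [eulerK0, eulerHom_of]; rfl

lemma eulerK0_ne_zero (α β : K0 C) : eulerK0 α β ≠ 0 := Units.ne_zero _

lemma eulerK0_add_left (α α' β : K0 C) :
    eulerK0 (α + α') β = eulerK0 α β * eulerK0 α' β := by
  simp [eulerK0]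

lemma eulerK0_add_right (α β β' : K0 C) :
    eulerK0 α (β + β') = eulerK0 α β * eulerK0 α β' := by
  simp [eulerK0]

end Euler

/-! ### The Euler form against acyclic complexes. -/

section EulerComplex

variable {A : Type u} [Category.{v} A] [Abelian A] [∀ X Y : A, Finite (X ⟶ Y)]
  [∀ X Y : A, Finite (Ext X Y 1)] [hHer : Fact (IsHereditary A)]

/-- The Euler form of a complex and an acyclic complex, in terms of the invariants. -/
def chiRight (b : HallIndex A) (κ : K0 A × K0 A) : ℚ :=
  eulerK0 b.deg₁ κ.1 * eulerK0 b.deg₀ κ.2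

/-- The Euler form of an acyclic complex and a complex, in terms of the invariants. -/
def chiLeft (κ : K0 A × K0 A) (b : HallIndex A) : ℚ :=
  eulerK0 κ.1 b.deg₀ * eulerK0 κ.2 b.deg₁

lemma chiRight_ne_zero (b : HallIndex A) (κ : K0 A × K0 A) : chiRight b κ ≠ 0 :=
  mul_ne_zero (eulerK0_ne_zero _ _) (eulerK0_ne_zero _ _)

lemma chiLeft_ne_zero (κ : K0 A × K0 A) (b : HallIndex A) : chiLeft κ b ≠ 0 :=
  mul_ne_zero (eulerK0_ne_zero _ _) (eulerK0_ne_zero _ _)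

/-- Both sides are multiplicative in `K`: the left because `Ext²(M, -)` vanishes on acyclic
complexes, the right because `bd` is additive on them. On a cone, adjunction reduces the form to
`A`, evaluating `M` at the target of the cone's differential. -/
lemma eulerForm_acyclic_right (M : Z2Complex A) {K : Z2Complex A} (hK : K.Acyclic) :
    eulerForm M K = chiRight (index M) (bd K) := by
  have key : eulerUnit M K = eulerHom (K0.of (M.X 1)) (bd K).1 +
      eulerHom (K0.of (M.X 0)) (bd K).2 := by
    refine acyclic_additive_eq (fun K => eulerUnit M K) (fun K =>
      eulerHom (K0.of (M.X 1)) (bd K).1 + eulerHom (K0.of (M.X 0)) (bd K).2) ?_ ?_ ?_ ?_ hK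
    · intro L N X p hN _
      exact eulerUnit_of_mul (eulerForm_covariant p.shortExact M
        (exists_ext_covariant p.shortExact M (subsingleton_ext_two_acyclic_right M hN)))
    · intro L N X p hN _
      simp only [bd_of_acyclic_left p hN, Prod.fst_add, Prod.snd_add, map_add]
      abel
    · intro X
      simp only [bd_cone, map_zero, add_zero, eulerHom_of]
      exact eulerUnit_congr (eulerForm_adj (evalAdjDbl rel_zero_one) M X).symm
    · intro X
      simp only [bd_coneStar, map_zero, zero_add, eulerHom_of]
      exact eulerUnit_congr (eulerForm_adj (evalAdjDbl rel_one_zero) M X).symm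
  have := congrArg (fun x : Additive ℚˣ => ((x.toMul : ℚˣ) : ℚ)) key
  rw [chiRight, deg₁_index, deg₀_index]
  simpa [eulerK0, eulerUnit] using this

/-- Cones now act as left adjoints, so `M` is evaluated at the source of the differential; this
exchanges the degrees relative to `chiRight`. -/
lemma eulerForm_acyclic_left (M : Z2Complex A) {K : Z2Complex A} (hK : K.Acyclic) :
    eulerForm K M = chiLeft (bd K) (index M) := by
  have key : eulerUnit K M = eulerHom (bd K).1 (K0.of (M.X 0)) +
      eulerHom (bd K).2 (K0.of (M.X 1)) := by
    refine acyclic_additive_eq (fun K => eulerUnit K M) (fun K =>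
      eulerHom (bd K).1 (K0.of (M.X 0)) + eulerHom (bd K).2 (K0.of (M.X 1))) ?_ ?_ ?_ ?_ hK
    · intro L N X p _ hL
      exact eulerUnit_of_mul (eulerForm_contravariant p.shortExact M
        (exists_ext_contravariant p.shortExact M (subsingleton_ext_two_acyclic_left hL M)))
    · intro L N X p hN _
      simp only [bd_of_acyclic_left p hN, Prod.fst_add, Prod.snd_add, map_add,
        AddMonoidHom.add_apply]
      abel
    · intro X
      simp only [bd_cone, map_zero, AddMonoidHom.zero_apply, add_zero, eulerHom_of]
      exact eulerUnit_congr (eulerForm_adj (dblAdjEval rel_zero_one) X M)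
    · intro X
      simp only [bd_coneStar, map_zero, AddMonoidHom.zero_apply, zero_add, eulerHom_of]
      exact eulerUnit_congr (eulerForm_adj (dblAdjEval rel_one_zero) X M)
  have := congrArg (fun x : Additive ℚˣ => ((x.toMul : ℚˣ) : ℚ)) key
  rw [chiLeft, deg₁_index, deg₀_index]
  simpa [eulerK0, eulerUnit] using this

end EulerComplex

/-! ### Middle terms under pushout and pullback. -/

section Middle

variable {C : Type u} [Category.{v} C] [Abelian C]

open ShortExact

/-- The middle terms of an extension and of its pushout along a surjection. -/
lemma exists_extPair_of_postcomp {K L M N X X' : C} (p : ExtPair M K L) (q : ExtPair N L X)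
    (q' : ExtPair N M X') (h : q.cls.comp (Ext.mk₀ p.g) (add_zero 1) = q'.cls) :
    Nonempty (ExtPair X' K X) := by
  obtain ⟨φ, h₁, h₃⟩ := exists_hom_of_extClass q.shortExact q'.shortExact p.g (𝟙 N)
    (by rw [Ext.mk₀_id_comp]; exact h)
  let y : X ⟶ X' := φ.τ₂
  have c₁ : p.g ≫ q'.f = q.f ≫ y := by
    have := φ.comm₁₂
    rwa [h₁] at this
  have c₃ : y ≫ q'.g = q.g := by
    have := φ.comm₂₃
    rw [h₃] at this
    exact this.trans (Category.comp_id _)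
  have hy : Epi y := by
    refine Preadditive.epi_of_cancel_zero _ fun {T} t ht => ?_
    obtain ⟨t', rfl⟩ := comp_eq_zero_desc q' t (by
      rw [← cancel_epi p.g, reassoc_of% c₁, ht, comp_zero, comp_zero])
    rw [reassoc_of% c₃] at ht
    rw [(cancel_epi q.g).1 (ht.trans comp_zero.symm), comp_zero]
  have hz : (p.f ≫ q.f) ≫ y = 0 := by
    rw [Category.assoc, ← c₁, reassoc_of% p.zero, zero_comp]
  refine ⟨⟨(p.f ≫ q.f, y), hz, ?_⟩⟩
  refine
    { exact := ShortComplex.exact_of_f_is_kernel _ (KernelFork.IsLimit.ofι' _ _ fun {T} t ht => ?_)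
      mono_f := inferInstanceAs (Mono (p.f ≫ q.f))
      epi_g := hy }
  -- The kernel of `X → X'` dies in `N`, hence lies in `L`; there it dies in `M`, hence lies in `K`.
  have key : ∀ t : T ⟶ X, t ≫ y = 0 → ∃ r, r ≫ p.f ≫ q.f = t := by
    intro t ht
    obtain ⟨s, rfl⟩ := comp_eq_zero_lift q t (by rw [← c₃, reassoc_of% ht, zero_comp])
    obtain ⟨r, rfl⟩ := comp_eq_zero_lift p s (by
      rw [← cancel_mono q'.f, Category.assoc, c₁, zero_comp, ← Category.assoc, ht])
    exact ⟨r, (Category.assoc _ _ _).symm⟩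
  exact ⟨(key t ht).choose, (key t ht).choose_spec⟩

/-- The middle terms of an extension and of its pullback along an injection. -/
lemma exists_extPair_of_precomp {K L M N X X' : C} (p : ExtPair K M L) (q : ExtPair L N X)
    (q' : ExtPair M N X') (h : (Ext.mk₀ p.f).comp q.cls (zero_add 1) = q'.cls) :
    Nonempty (ExtPair K X' X) := by
  obtain ⟨φ, h₁, h₃⟩ := exists_hom_of_extClass q'.shortExact q.shortExact (𝟙 N) p.f
    (by rw [Ext.comp_mk₀_id]; exact h.symm)
  let y : X' ⟶ X := φ.τ₂
  have c₁ : q'.f ≫ y = q.f := by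
    have := φ.comm₁₂
    rw [h₁] at this
    exact this.symm.trans (Category.id_comp _)
  have c₃ : y ≫ q.g = q'.g ≫ p.f := by
    have := φ.comm₂₃
    rwa [h₃] at this
  have hy : Mono y := by
    refine Preadditive.mono_of_cancel_zero _ fun {T} t ht => ?_
    obtain ⟨t', rfl⟩ := comp_eq_zero_lift q' t (by
      rw [← cancel_mono p.f, Category.assoc, ← c₃, reassoc_of% ht, zero_comp, zero_comp])
    rw [Category.assoc, c₁] at ht
    rw [(cancel_mono q.f).1 (ht.trans zero_comp.symm), zero_comp]
  have hz : y ≫ q.g ≫ p.g = 0 := by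
    rw [reassoc_of% c₃, p.zero, comp_zero]
  refine ⟨⟨(y, q.g ≫ p.g), hz, ?_⟩⟩
  refine
    { exact := ShortComplex.exact_of_g_is_cokernel _
        (CokernelCofork.IsColimit.ofπ' _ _ fun {T} t ht => ?_)
      mono_f := hy
      epi_g := inferInstanceAs (Epi (q.g ≫ p.g)) }
  have key : ∀ t : X ⟶ T, y ≫ t = 0 → ∃ r, (q.g ≫ p.g) ≫ r = t := by
    intro t ht
    obtain ⟨s, rfl⟩ := comp_eq_zero_desc q t (by rw [← c₁, Category.assoc, ht, comp_zero])
    obtain ⟨r, rfl⟩ := comp_eq_zero_desc p s (by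
      rw [← cancel_epi q'.g, ← reassoc_of% c₃, ht, comp_zero])
    exact ⟨r, Category.assoc _ _ _⟩
  exact ⟨(key t ht).choose, (key t ht).choose_spec⟩

end Middle

section Fibers

lemma finsum_comp_of_surjective {G H : Type*} [AddCommGroup G] [AddCommGroup H] [Finite G]
    {W : Type*} [AddCommGroup W] [Module ℚ W] (f : G →+ H) (hf : Function.Surjective f)
    (F : H → W) : ∑ᶠ g, F (f g) = ((Nat.card G : ℚ) / Nat.card H) • ∑ᶠ h, F h := by
  classical
  have : Finite H := Finite.of_surjective f hf
  have := Fintype.ofFinite G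
  have := Fintype.ofFinite H
  let c := (Finset.univ.filter fun g => f g = 0).card
  have hc : ∀ h : H, (Finset.univ.filter fun g => f g = h).card = c := fun h =>
    AddMonoidHom.card_fiber_eq_of_mem_range f (hf h) ⟨0, map_zero f⟩
  have hG : (Nat.card G : ℚ) = Nat.card H * c := by
    rw [Nat.card_eq_fintype_card, Nat.card_eq_fintype_card, ← Finset.card_univ,
      Finset.card_eq_sum_card_fiberwise (f := f) (t := Finset.univ) fun _ _ => Finset.mem_univ _]
    simp [hc]
  have hH : (Nat.card H : ℚ) ≠ 0 := by exact_mod_cast Nat.card_pos.ne'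
  rw [finsum_eq_sum_of_fintype, finsum_eq_sum_of_fintype, ← Finset.sum_fiberwise Finset.univ f, hG,
    mul_div_cancel_left₀ _ hH, Finset.smul_sum]
  refine Finset.sum_congr rfl fun h _ => ?_
  rw [Finset.sum_congr rfl fun g hg => by rw [(Finset.mem_filter.1 hg).2], Finset.sum_const, hc,
    Nat.cast_smul_eq_nsmul]

end Fibers

/-! ### The linear map to indices. -/

section IndexMap

variable {A : Type u} [Category.{v} A] [Abelian A]

open HallIndex

/-- The invariants of an isomorphism class of complexes. -/
def indexClass : IsoClass (Z2Complex A) → HallIndex A :=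
  Quotient.lift index fun _ _ ⟨e⟩ => index_iso e

variable (A) in
/-- The linear map sending a complex to its invariants. -/
def indexMap : HallSpace (Z2Complex A) →ₗ[ℚ] (HallIndex A →₀ ℚ) :=
  Finsupp.lmapDomain ℚ ℚ indexClass

@[simp]
lemma indexMap_cls (M : Z2Complex A) :
    indexMap A (HallSpace.cls M) = Finsupp.single (index M) 1 := by
  simp only [indexMap, HallSpace.cls, Finsupp.lmapDomain_apply, Finsupp.mapDomain_single]
  rfl

/-- Translation of the boundary classes, linearly. -/
def shiftMap (κ : K0 A × K0 A) : (HallIndex A →₀ ℚ) →ₗ[ℚ] (HallIndex A →₀ ℚ) :=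
  Finsupp.lmapDomain ℚ ℚ (shift κ)

@[simp]
lemma shiftMap_single (κ : K0 A × K0 A) (b : HallIndex A) (q : ℚ) :
    shiftMap κ (Finsupp.single b q) = Finsupp.single (shift κ b) q := by
  simp [shiftMap]

lemma shiftMap_shiftMap (κ κ' : K0 A × K0 A) (x : HallIndex A →₀ ℚ) :
    shiftMap κ (shiftMap κ' x) = shiftMap (κ + κ') x := by
  have : shiftMap κ ∘ₗ shiftMap κ' = shiftMap (κ + κ') := by
    refine Finsupp.lhom_ext fun b q => ?_
    simp [shift_shift]
  exact LinearMap.congr_fun this x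

lemma shiftMap_zero (x : HallIndex A →₀ ℚ) : shiftMap 0 x = x := by
  have : shiftMap (0 : K0 A × K0 A) = LinearMap.id := by
    refine Finsupp.lhom_ext fun b q => ?_
    simp [shift_zero]
  exact LinearMap.congr_fun this x

end IndexMap

/-! ### The Hall product on indices. -/

section IndexMul

variable {A : Type u} [Category.{v} A] [Abelian A] [∀ X Y : A, Finite (X ⟶ Y)]
  [∀ X Y : A, Finite (Ext X Y 1)] [hHer : Fact (IsHereditary A)]

open HallIndex

lemma chiRight_add (b : HallIndex A) (κ κ' : K0 A × K0 A) :
    chiRight b (κ + κ') = chiRight b κ * chiRight b κ' := by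
  simp only [chiRight, Prod.fst_add, Prod.snd_add, eulerK0_add_right]; ring

lemma chiLeft_add (b : HallIndex A) (κ κ' : K0 A × K0 A) :
    chiLeft (κ + κ') b = chiLeft κ b * chiLeft κ' b := by
  simp only [chiLeft, Prod.fst_add, Prod.snd_add, eulerK0_add_left]; ring

lemma chiRight_zero (b : HallIndex A) : chiRight b 0 = 1 := by
  have h := chiRight_add b 0 0
  rw [add_zero] at h
  exact (mul_eq_left₀ (chiRight_ne_zero b 0)).1 h.symm

/-- Here `a, b` and `c, d` are orders of `Hom` and `Ext¹`. The normalization `1 / a` and the fibre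
size `b / d` combine to the inverse Euler form times the normalization `1 / c`. -/
lemma inv_mul_div_of_div_eq {a b c d χ : ℚ} (ha : 0 < a) (hb : 0 < b) (hc : 0 < c) (hd : 0 < d)
    (h : a / b = χ * (c / d)) : a⁻¹ * (b / d) = χ⁻¹ * c⁻¹ := by
  have hχ : χ ≠ 0 := by
    rintro rfl
    rw [zero_mul] at h
    exact (div_pos ha hb).ne' h
  field_simp at h ⊢
  linarith

/-- `Ext¹(N, L) → Ext¹(N, M)` is onto because `Ext²(N, K) = 0`, and the middle term of a class is an
extension by `K` of the middle term of its image. So indices are translated by `bd K`, and counting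
fibres gives the inverse Euler form. -/
lemma indexMap_mul_of_acyclic_left {K L M : Z2Complex A} (N : Z2Complex A) (p : ExtPair M K L)
    (hK : K.Acyclic) :
    indexMap A (hallMul _ (HallSpace.cls N) (HallSpace.cls L)) = (chiRight (index N) (bd K))⁻¹ •
      shiftMap (bd K) (indexMap A (hallMul _ (HallSpace.cls N) (HallSpace.cls M))) := by
  let f : Ext N L 1 →+ Ext N M 1 := (Ext.mk₀ p.g).postcomp N (add_zero 1)
  have hsurj := exists_ext_covariant p.shortExact N (subsingleton_ext_two_acyclic_right N hK)
  have hf : Function.Surjective f := hsurj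
  have hmid : ∀ ξ : Ext N L 1, indexMap A (HallSpace.cls (extMiddle ξ)) =
      shiftMap (bd K) (indexMap A (HallSpace.cls (extMiddle (f ξ)))) := by
    intro ξ
    obtain ⟨q, hq⟩ := exists_extPair ξ
    obtain ⟨q', hq'⟩ := exists_extPair (f ξ)
    obtain ⟨r⟩ := exists_extPair_of_postcomp p q q' (by rw [hq, hq']; rfl)
    rw [indexMap_cls, indexMap_cls, shiftMap_single, index_of_acyclic_left r hK]
  have hEul := eulerForm_covariant p.shortExact N hsurj
  have hchi := eulerForm_acyclic_right N hK
  rw [map_hallMul_cls, map_hallMul_cls, finsum_congr hmid, finsum_comp_of_surjective f hf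
      fun η => shiftMap (bd K) (indexMap A (HallSpace.cls (extMiddle η))), map_smul,
    map_finsum (shiftMap (bd K)) (Set.toFinite _), smul_smul, smul_smul]
  congr 1
  rw [← hchi]
  exact inv_mul_div_of_div_eq (card_hom_pos N L) (card_ext_pos N L) (card_hom_pos N M)
    (card_ext_pos N M) hEul

lemma indexMap_mul_of_acyclic_right {K L M : Z2Complex A} (N : Z2Complex A) (p : ExtPair K M L)
    (hK : K.Acyclic) :
    indexMap A (hallMul _ (HallSpace.cls L) (HallSpace.cls N)) = (chiLeft (bd K) (index N))⁻¹ •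
      shiftMap (bd K) (indexMap A (hallMul _ (HallSpace.cls M) (HallSpace.cls N))) := by
  let f : Ext L N 1 →+ Ext M N 1 := (Ext.mk₀ p.f).precomp N (zero_add 1)
  have hsurj := exists_ext_contravariant p.shortExact N (subsingleton_ext_two_acyclic_left hK N)
  have hf : Function.Surjective f := hsurj
  have hmid : ∀ ξ : Ext L N 1, indexMap A (HallSpace.cls (extMiddle ξ)) =
      shiftMap (bd K) (indexMap A (HallSpace.cls (extMiddle (f ξ)))) := by
    intro ξ
    obtain ⟨q, hq⟩ := exists_extPair ξ
    obtain ⟨q', hq'⟩ := exists_extPair (f ξ)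
    obtain ⟨r⟩ := exists_extPair_of_precomp p q q' (by rw [hq, hq']; rfl)
    rw [indexMap_cls, indexMap_cls, shiftMap_single, index_of_acyclic_right r hK]
  have hEul := eulerForm_contravariant p.shortExact N hsurj
  have hchi := eulerForm_acyclic_left N hK
  rw [map_hallMul_cls, map_hallMul_cls, finsum_congr hmid, finsum_comp_of_surjective f hf
      fun η => shiftMap (bd K) (indexMap A (HallSpace.cls (extMiddle η))), map_smul,
    map_finsum (shiftMap (bd K)) (Set.toFinite _), smul_smul, smul_smul]
  congr 1
  rw [← hchi]
  exact inv_mul_div_of_div_eq (card_hom_pos L N) (card_ext_pos L N) (card_hom_pos M N)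
    (card_ext_pos M N) (hEul.trans (mul_comm _ _))

omit hHer in
/-- A linear map whose value at a complex only depends on the invariants of the complex factors
through the map to the invariants. -/
lemma exists_factor_indexMap {W : Type*} [AddCommGroup W] [Module ℚ W]
    (f : HallSpace (Z2Complex A) →ₗ[ℚ] W)
    (h : ∀ M M' : Z2Complex A, index M = index M' → f (HallSpace.cls M) = f (HallSpace.cls M')) :
    ∃ g : (HallIndex A →₀ ℚ) →ₗ[ℚ] W, f = g ∘ₗ indexMap A := by
  classical
  let g₀ : HallIndex A → W := fun b =>
    if hb : ∃ M, index M = b then f (HallSpace.cls hb.choose) else 0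
  refine ⟨Finsupp.linearCombination ℚ g₀, hallSpace_linearMap_ext fun M => ?_⟩
  have hb : ∃ M', index M' = index M := ⟨M, rfl⟩
  simp only [LinearMap.comp_apply, indexMap_cls, Finsupp.linearCombination_single, one_smul, g₀,
    dif_pos hb]
  exact h _ _ hb.choose_spec.symm

omit [∀ X Y : A, Finite (X ⟶ Y)] [∀ X Y : A, Finite (Ext X Y 1)] in
/-- A function of complexes which does not change along surjections with acyclic kernel only
depends on the isomorphism classes of the homology objects. -/
lemma eq_of_index_eq {G : Z2Complex A → (HallIndex A →₀ ℚ)}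
    (hG : ∀ {L M X : Z2Complex A}, ExtPair L M X → M.Acyclic → G X = G L)
    {M M' : Z2Complex A} (h : index M = index M') : G M = G M' := by
  have key : ∀ M, G M = G (stalk (M.homology 1) ⊞ stalkStar (M.homology 0)) :=
    rel_stalk_homology (r := fun M M' => G M = G M')
      ⟨fun _ => rfl, fun h => h.symm, fun h h' => h.trans h'⟩ hG
  obtain ⟨e₁⟩ := IsoClass.mk_eq_iff.1 (congrArg Prod.fst h)
  obtain ⟨e₀⟩ := IsoClass.mk_eq_iff.1 (congrArg (fun b : HallIndex A => b.2.1) h)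
  rw [key M, key M']
  exact hG (ExtPair.ofIso (stalkSumIso e₁ e₀) (isZero_zero _)) (acyclic_of_isZero (isZero_zero _))

/-- Multiplying by the Euler factor and translating back by `bd M` makes the product invariant along
surjections with acyclic kernel, so `eq_of_index_eq` applies. The normalization is undone using `bd
M = bd M'`. -/
lemma indexMap_mul_congr_right (N : Z2Complex A) {M M' : Z2Complex A} (h : index M = index M') :
    indexMap A (hallMul _ (HallSpace.cls N) (HallSpace.cls M)) =
      indexMap A (hallMul _ (HallSpace.cls N) (HallSpace.cls M')) := by
  let G : Z2Complex A → (HallIndex A →₀ ℚ) := fun M => chiRight (index N) (bd M) •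
    shiftMap (-bd M) (indexMap A (hallMul _ (HallSpace.cls N) (HallSpace.cls M)))
  have hG : G M = G M' := by
    refine eq_of_index_eq (fun {M K L} p hK => ?_) h
    have := chiRight_ne_zero (index N) (bd K)
    simp only [G]
    rw [indexMap_mul_of_acyclic_left N p hK, map_smul, shiftMap_shiftMap, smul_smul,
      bd_of_acyclic_left p hK, chiRight_add, neg_add_rev, neg_add_cancel_right,
      mul_assoc, mul_comm (chiRight _ (bd M)), mul_inv_cancel_left₀ this]
  have hb : bd M = bd M' := congrArg (fun b : HallIndex A => b.2.2) h
  simp only [G, hb] at hG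
  have := smul_right_injective _ (chiRight_ne_zero (index N) (bd M')) hG
  have := congrArg (shiftMap (bd M')) this
  simpa only [shiftMap_shiftMap, add_neg_cancel, shiftMap_zero] using this

omit [∀ X Y : A, Finite (X ⟶ Y)] [∀ X Y : A, Finite (Ext X Y 1)] hHer in
/-- A surjection with acyclic kernel is the composition of an injection with acyclic cokernel and
a split surjection with acyclic kernel. -/
lemma exists_mono_of_acyclic_left {K L M : Z2Complex A} (p : ExtPair M K L) (hK : K.Acyclic) :
    ∃ Q D : Z2Complex A, Q.Acyclic ∧ D.Acyclic ∧ Nonempty (ExtPair D L (Q ⊞ M)) := by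
  let Q := dbl rel_zero_one (L.X 1) ⊞ dbl (rel_symm rel_zero_one) (L.X 0)
  have hQ : Q.Acyclic := acyclic_biprod (acyclic_dbl _ _) (acyclic_dbl _ _)
  let ι : L ⟶ Q := embDbl rel_zero_one L
  let t : L ⟶ Q ⊞ M := biprod.lift ι p.g
  have ht : t ≫ biprod.fst = ι := biprod.lift_fst _ _
  have ht' : t ≫ biprod.snd = p.g := biprod.lift_snd _ _
  have hm : Mono ι := inferInstance
  have htm : Mono t := mono_of_mono_fac ht
  let q : ExtPair (cokernel t) L (Q ⊞ M) := ⟨(t, cokernel.π t), _, cokernel_shortExact t⟩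
  refine ⟨Q, cokernel t, hQ, acyclic_of_isIso_homologyMap_f q fun i => ?_, ⟨q⟩⟩
  have h₁ := isIso_homologyMap_g p hK i
  have h₂ := isIso_homologyMap_g (ExtPair.split Q M) hQ i
  have h₃ : HomologicalComplex.homologyMap t i ≫
      HomologicalComplex.homologyMap (ExtPair.split Q M).g i =
        HomologicalComplex.homologyMap p.g i := by
    rw [← HomologicalComplex.homologyMap_comp]
    exact congrArg (HomologicalComplex.homologyMap · i) ht'
  exact IsIso.of_isIso_fac_right h₃

/-- In the first variable the translation rule concerns injections with acyclic cokernel. Invariance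
along a surjection `L → M` follows by comparing the injections of `L` and `M` into `Q ⊞ M`. -/
lemma indexMap_mul_congr_left (N : Z2Complex A) {M M' : Z2Complex A} (h : index M = index M') :
    indexMap A (hallMul _ (HallSpace.cls M) (HallSpace.cls N)) =
      indexMap A (hallMul _ (HallSpace.cls M') (HallSpace.cls N)) := by
  let G : Z2Complex A → (HallIndex A →₀ ℚ) := fun M => chiLeft (bd M) (index N) •
    shiftMap (-bd M) (indexMap A (hallMul _ (HallSpace.cls M) (HallSpace.cls N)))
  have hG' : ∀ {K M L : Z2Complex A}, ExtPair K M L → K.Acyclic → G L = G M := by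
    intro K M L p hK
    have := chiLeft_ne_zero (bd K) (index N)
    simp only [G]
    rw [indexMap_mul_of_acyclic_right N p hK, map_smul, shiftMap_shiftMap, smul_smul,
      bd_of_acyclic_right p hK, chiLeft_add, neg_add, neg_add_cancel_right,
      mul_assoc, mul_inv_cancel₀ this, mul_one]
  have hG : G M = G M' := by
    refine eq_of_index_eq (fun {M K L} p hK => ?_) h
    obtain ⟨Q, D, hQ, hD, ⟨q⟩⟩ := exists_mono_of_acyclic_left p hK
    rw [← hG' q hD]
    exact hG' ((ExtPair.split M Q).map (Iso.refl _) (Iso.refl _) (biprod.braiding M Q)) hQ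
  have hb : bd M = bd M' := congrArg (fun b : HallIndex A => b.2.2) h
  simp only [G, hb] at hG
  have := smul_right_injective _ (chiLeft_ne_zero (bd M') (index N)) hG
  have := congrArg (shiftMap (bd M')) this
  simpa only [shiftMap_shiftMap, add_neg_cancel, shiftMap_zero] using this

lemma indexMap_mul_eq_zero_right (u : HallSpace (Z2Complex A)) {x : HallSpace (Z2Complex A)}
    (hx : indexMap A x = 0) : indexMap A (hallMul _ u x) = 0 := by
  induction u using hallSpace_induction with
  | h₀ => simp
  | hadd u v hu hv => simp [hu, hv]
  | hcls q N =>
    obtain ⟨g, hg⟩ := exists_factor_indexMap (indexMap A ∘ₗ hallMul _ (HallSpace.cls N))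
      fun M M' h => indexMap_mul_congr_right N h
    have h : indexMap A (hallMul _ (HallSpace.cls N) x) = g (indexMap A x) :=
      LinearMap.congr_fun hg x
    rw [map_smul, LinearMap.smul_apply, map_smul, h, hx, map_zero, smul_zero]

lemma indexMap_mul_eq_zero_left (u : HallSpace (Z2Complex A)) {x : HallSpace (Z2Complex A)}
    (hx : indexMap A x = 0) : indexMap A (hallMul _ x u) = 0 := by
  induction u using hallSpace_induction with
  | h₀ => simp
  | hadd u v hu hv => simp [hu, hv]
  | hcls q N =>
    obtain ⟨g, hg⟩ := exists_factor_indexMap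
      ({ toFun := fun y => indexMap A (hallMul _ y (HallSpace.cls N))
         map_add' := fun y z => by rw [map_add, LinearMap.add_apply, map_add]
         map_smul' := fun q y => by
          rw [map_smul, LinearMap.smul_apply, map_smul, RingHom.id_apply] } :
        HallSpace (Z2Complex A) →ₗ[ℚ] (HallIndex A →₀ ℚ))
      fun M M' h => indexMap_mul_congr_left N h
    have h : indexMap A (hallMul _ x (HallSpace.cls N)) = g (indexMap A x) :=
      LinearMap.congr_fun hg x
    rw [map_smul, map_smul, h, hx, map_zero, smul_zero]

end IndexMul

/-! ### The quotient algebra. -/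

section Quotient

variable {A : Type u} [Category.{v} A] [Abelian A] (h : IsHallAlgebra (Z2Complex A))

/-- The projection of the Hall space to the quotient algebra. -/
def quotMap : HallSpace (Z2Complex A) →ₗ[ℚ] QuotientHallAlgebra h where
  toFun x := (acyclicIdeal h).ringCon.mk' x
  map_add' x y := map_add ((acyclicIdeal h).ringCon.mk') x y
  map_smul' _ _ := rfl

lemma quotMap_cls (M : Z2Complex A) : quotMap h (HallSpace.cls M) = quotientCls h M := rfl

lemma quotMap_mul (x y : HallSpace (Z2Complex A)) :
    quotMap h (hallMul _ x y) = quotMap h x * quotMap h y := rfl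

lemma quotMap_surjective : Function.Surjective (quotMap h) :=
  (acyclicIdeal h).ringCon.mk'_surjective

variable {h} in
lemma quotientCls_iso {M M' : Z2Complex A} (e : M ≅ M') : quotientCls h M = quotientCls h M' := by
  rw [← quotMap_cls, ← quotMap_cls, HallSpace.cls, HallSpace.cls, IsoClass.mk_eq_iff.2 ⟨e⟩]

variable {h} in
lemma quotientCls_extPair {L M X : Z2Complex A} (p : ExtPair L M X) (hM : M.Acyclic) :
    quotientCls h X = quotientCls h (M ⊞ L) := by
  refine ((acyclicIdeal h).ringCon.eq).2 ?_
  rw [TwoSidedIdeal.rel_iff]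
  exact TwoSidedIdeal.subset_span ⟨_, p.shortExact, hM, rfl⟩

end Quotient

/-! ### Acyclic classes in the quotient algebra. -/

section Relations

variable {A : Type u} [Category.{v} A] [Abelian A] [∀ X Y : A, Finite (X ⟶ Y)]
  [∀ X Y : A, Finite (Ext X Y 1)]  {h : IsHallAlgebra (Z2Complex A)}

open HallIndex

/-- In the quotient every extension of `M` by `K` has the class of the split one, so the product
collapses to `|Ext¹| / |Hom|` times one class. -/
lemma quotientCls_mul (M : Z2Complex A) {K : Z2Complex A} (hK : K.Acyclic) :
    quotientCls h M * quotientCls h K = (eulerForm M K)⁻¹ • quotientCls h (M ⊞ K) := by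
  have hmid : ∀ ξ : Ext M K 1,
      quotMap h (HallSpace.cls (extMiddle ξ)) = quotientCls h (M ⊞ K) := by
    intro ξ
    obtain ⟨q, -⟩ := exists_extPair ξ
    rw [quotMap_cls, quotientCls_extPair q hK, quotientCls_iso (biprod.braiding K M)]
  have := Fintype.ofFinite (Ext M K 1)
  rw [← quotMap_cls, ← quotMap_cls, ← quotMap_mul, map_hallMul_cls, finsum_congr hmid,
    finsum_eq_sum_of_fintype, Finset.sum_const, Finset.card_univ, ← Nat.card_eq_fintype_card,
    ← Nat.cast_smul_eq_nsmul ℚ, smul_smul, eulerForm, inv_div, div_eq_inv_mul]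

variable [hHer : Fact (IsHereditary A)]

variable (h) in
/-- The map from the Hall algebra to the invariants. -/
def algIndexMap : HallAlgebra h →ₗ[ℚ] (HallIndex A →₀ ℚ) := indexMap A

variable (h) in
/-- The ideal of all elements with vanishing invariants. -/
def indexIdeal : TwoSidedIdeal (HallAlgebra h) :=
  TwoSidedIdeal.mk' {x | algIndexMap h x = 0} (map_zero _)
    (fun {x y} hx hy => (map_add (algIndexMap h) x y).trans
      ((congrArg₂ (· + ·) hx hy).trans (add_zero 0)))
    (fun {x} hx => (map_neg (algIndexMap h) x).trans ((congrArg (- ·) hx).trans neg_zero))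
    (fun {x _} hy => indexMap_mul_eq_zero_right x hy)
    (fun {_ y} hx => indexMap_mul_eq_zero_left y hx)

lemma mem_indexIdeal {x : HallAlgebra h} : x ∈ indexIdeal h ↔ algIndexMap h x = 0 :=
  TwoSidedIdeal.mem_mk' _ _ _ _ _ _ x

lemma acyclicIdeal_le : acyclicIdeal h ≤ indexIdeal h := by
  refine TwoSidedIdeal.span_le.2 ?_
  rintro _ ⟨T, hT, hK, rfl⟩
  let p : ExtPair T.X₃ T.X₁ T.X₂ := ⟨(T.f, T.g), T.zero, hT⟩
  refine mem_indexIdeal.2 ?_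
  refine (map_sub (indexMap A) (HallSpace.cls T.X₂) (HallSpace.cls (T.X₁ ⊞ T.X₃))).trans ?_
  rw [indexMap_cls, indexMap_cls, index_of_acyclic_left p hK,
    index_of_acyclic_left (ExtPair.split T.X₁ T.X₃) hK, sub_self]

variable (h) in
/-- The map from the quotient algebra to the invariants. -/
def barMap : QuotientHallAlgebra h →ₗ[ℚ] (HallIndex A →₀ ℚ) where
  toFun := Quotient.lift (fun x : HallAlgebra h => algIndexMap h x) fun x y hxy => by
    have h₁ : x - y ∈ indexIdeal h := acyclicIdeal_le ((TwoSidedIdeal.rel_iff _ _ _).1 hxy)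
    exact sub_eq_zero.1 ((map_sub (algIndexMap h) x y).symm.trans (mem_indexIdeal.1 h₁))
  map_add' := by
    rintro ⟨x⟩ ⟨y⟩
    exact map_add (algIndexMap h) x y
  map_smul' := by
    rintro q ⟨x⟩
    exact map_smul (algIndexMap h) q x

lemma barMap_cls (M : Z2Complex A) :
    barMap h (quotientCls h M) = Finsupp.single (index M) 1 := indexMap_cls M

lemma eulerForm_ne_zero {C : Type u} [Category.{v} C] [Abelian C] [∀ X Y : C, Finite (X ⟶ Y)]
    [∀ X Y : C, Finite (Ext X Y 1)] (X Y : C) : eulerForm X Y ≠ 0 := (eulerForm_pos X Y).ne'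

omit hHer in
lemma quotientCls_biprod (M : Z2Complex A) {K : Z2Complex A} (hK : K.Acyclic) :
    quotientCls h (M ⊞ K) = eulerForm M K • (quotientCls h M * quotientCls h K) := by
  rw [quotientCls_mul M hK, smul_smul, mul_inv_cancel₀ (eulerForm_ne_zero M K), one_smul]

/-- A direct sum with an acyclic complex is the product of the classes rescaled by the Euler form,
which only sees `index` and `bd`. -/
lemma quotientCls_biprod_congr {M M' K K' : Z2Complex A} (hK : K.Acyclic) (hK' : K'.Acyclic)
    (hi : index M = index M') (hM : quotientCls h M = quotientCls h M') (hb : bd K = bd K')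
    (hq : quotientCls h K = quotientCls h K') :
    quotientCls h (M ⊞ K) = quotientCls h (M' ⊞ K') := by
  rw [quotientCls_biprod M hK, quotientCls_biprod M' hK', hM, hq, eulerForm_acyclic_right M hK,
    eulerForm_acyclic_right M' hK', hi, hb]

omit [∀ X Y : A, Finite (X ⟶ Y)] [∀ X Y : A, Finite (Ext X Y 1)] hHer in
lemma index_biprod (M : Z2Complex A) {K : Z2Complex A} (hK : K.Acyclic) :
    index (M ⊞ K) = shift (bd K) (index M) :=
  index_of_acyclic_right ((ExtPair.split M K)) hK

omit [∀ X Y : A, Finite (X ⟶ Y)] [∀ X Y : A, Finite (Ext X Y 1)] hHer in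
lemma bd_biprod (M : Z2Complex A) {K : Z2Complex A} (hK : K.Acyclic) :
    bd (M ⊞ K) = bd M + bd K :=
  congrArg (fun b : HallIndex A => b.2.2) (index_biprod M hK)

section AcyclicClasses

variable (A) in
/-- The acyclic complexes. -/
abbrev AcyclicComplex : Type (max u v) := {K : Z2Complex A // K.Acyclic}

variable (h) in
/-- Two acyclic complexes are stably equivalent if they have the same boundary classes and become
equal in the quotient algebra after adding an acyclic complex. -/
def acyclicSetoid : Setoid (AcyclicComplex A) where
  r K K' := bd K.1 = bd K'.1 ∧
    ∃ T : Z2Complex A, T.Acyclic ∧ quotientCls h (K.1 ⊞ T) = quotientCls h (K'.1 ⊞ T)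
  iseqv :=
    { refl := fun _ => ⟨rfl, 0, acyclic_of_isZero (isZero_zero _), rfl⟩
      symm := fun ⟨h₁, T, hT, h₂⟩ => ⟨h₁.symm, T, hT, h₂.symm⟩
      trans := by
        rintro ⟨K₁, hK₁⟩ ⟨K₂, hK₂⟩ ⟨K₃, hK₃⟩ ⟨h₁, T, hT, h₂⟩ ⟨h₁', T', hT', h₂'⟩
        -- Adding both stabilizers requires equal indices in `quotientCls_biprod_congr`; this is why
        -- equality of `bd` is part of the relation.
        refine ⟨h₁.trans h₁', T ⊞ T', acyclic_biprod hT hT', ?_⟩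
        have ix : ∀ {K K' : Z2Complex A}, K.Acyclic → K'.Acyclic → bd K = bd K' →
            ∀ {T : Z2Complex A}, T.Acyclic → index (K ⊞ T) = index (K' ⊞ T) := by
          intro K K' hK hK' hb T hT
          rw [index_biprod _ hT, index_biprod _ hT, index_acyclic hK, index_acyclic hK', hb]
        have e₁ := quotientCls_biprod_congr hT' hT' (ix hK₁ hK₂ h₁ hT) h₂ rfl rfl
        have e₂ := quotientCls_biprod_congr hT hT (ix hK₂ hK₃ h₁' hT') h₂' rfl rfl
        have a : ∀ K : Z2Complex A, quotientCls h ((K ⊞ T) ⊞ T') = quotientCls h (K ⊞ T ⊞ T') :=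
          fun K => quotientCls_iso (biprod.associator _ _ _)
        have b : ∀ K : Z2Complex A, quotientCls h ((K ⊞ T') ⊞ T) = quotientCls h (K ⊞ T ⊞ T') :=
          fun K => quotientCls_iso (biprod.associator _ _ _ ≪≫
            biprod.mapIso (Iso.refl _) (biprod.braiding _ _))
        exact (a K₁).symm.trans (e₁.trans ((a K₂).trans ((b K₂).symm.trans (e₂.trans (b K₃))))) }

end AcyclicClasses

end Relations

/-! ### Stable equality of complexes with the same index. -/

section Stable

variable {A : Type u} [Category.{v} A] [Abelian A] [∀ X Y : A, Finite (X ⟶ Y)]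
  [∀ X Y : A, Finite (Ext X Y 1)] {h : IsHallAlgebra (Z2Complex A)} [hHer : Fact (IsHereditary A)]

open HallIndex

lemma index_eq_of_bd_eq {A : Type u} [Category.{v} A] [Abelian A] {K K' : Z2Complex A}
    (hK : K.Acyclic) (hK' : K'.Acyclic) (hb : bd K = bd K') : index K = index K' := by
  rw [index_acyclic hK, index_acyclic hK', hb]

lemma bd_iso {A : Type u} [Category.{v} A] [Abelian A] {M M' : Z2Complex A} (e : M ≅ M') :
    bd M = bd M' :=
  congrArg (fun b : HallIndex A => b.2.2) (index_iso e)

/-- Exchange of the two middle summands. -/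
def biprodInterchange {C : Type u} [Category.{v} C] [Abelian C] (X Y Z W : C) :
    (X ⊞ Y) ⊞ (Z ⊞ W) ≅ (X ⊞ Z) ⊞ (Y ⊞ W) :=
  biprod.associator _ _ _ ≪≫ biprod.mapIso (Iso.refl X) ((biprod.associator _ _ _).symm ≪≫
    biprod.mapIso (biprod.braiding Y Z) (Iso.refl W) ≪≫ biprod.associator _ _ _) ≪≫
    (biprod.associator _ _ _).symm

variable (h) in
/-- The monoid of stable equivalence classes of acyclic complexes. -/
def AcyclicMonoid : Type (max u v) := _root_.Quotient (acyclicSetoid h)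

variable (h) in
/-- The class of an acyclic complex. -/
def AcyclicMonoid.mk (K : AcyclicComplex A) : AcyclicMonoid h := Quotient.mk (acyclicSetoid h) K

lemma AcyclicMonoid.mk_eq_of_iso {K K' : AcyclicComplex A} (e : K.1 ≅ K'.1) :
    AcyclicMonoid.mk h K = AcyclicMonoid.mk h K' :=
  Quotient.sound ⟨bd_iso e, 0, acyclic_of_isZero (isZero_zero _),
    quotientCls_iso (biprod.mapIso e (Iso.refl _))⟩

instance : Zero (AcyclicMonoid h) :=
  ⟨AcyclicMonoid.mk h ⟨0, acyclic_of_isZero (isZero_zero _)⟩⟩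

instance : Add (AcyclicMonoid h) where
  add := Quotient.map₂ (fun K K' => ⟨K.1 ⊞ K'.1, acyclic_biprod K.2 K'.2⟩) (by
    rintro ⟨K₁, hK₁⟩ ⟨K₂, hK₂⟩ ⟨h₁, T, hT, h₂⟩ ⟨K₁', hK₁'⟩ ⟨K₂', hK₂'⟩ ⟨h₁', T', hT', h₂'⟩
    have e : quotientCls h ((K₁ ⊞ T) ⊞ (K₁' ⊞ T')) = quotientCls h ((K₂ ⊞ T) ⊞ (K₂' ⊞ T')) := by
      refine quotientCls_biprod_congr (acyclic_biprod hK₁' hT') (acyclic_biprod hK₂' hT')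
        (index_eq_of_bd_eq (acyclic_biprod hK₁ hT) (acyclic_biprod hK₂ hT) ?_) h₂ ?_ h₂'
      · exact (bd_biprod _ hT).trans ((congrArg (· + bd T) h₁).trans (bd_biprod _ hT).symm)
      · exact (bd_biprod _ hT').trans ((congrArg (· + bd T') h₁').trans (bd_biprod _ hT').symm)
    refine ⟨(bd_biprod _ hK₁').trans ((congrArg₂ (· + ·) h₁ h₁').trans (bd_biprod _ hK₂').symm),
      T ⊞ T', acyclic_biprod hT hT', ?_⟩
    exact (quotientCls_iso (biprodInterchange _ _ _ _)).trans
      (e.trans (quotientCls_iso (biprodInterchange _ _ _ _))))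

instance : AddCommMonoid (AcyclicMonoid h) where
  add_assoc := by
    rintro ⟨K₁⟩ ⟨K₂⟩ ⟨K₃⟩
    exact AcyclicMonoid.mk_eq_of_iso (biprod.associator _ _ _)
  zero_add := by
    rintro ⟨K⟩
    exact AcyclicMonoid.mk_eq_of_iso (isoZeroBiprod (isZero_zero _)).symm
  add_zero := by
    rintro ⟨K⟩
    exact AcyclicMonoid.mk_eq_of_iso (isoBiprodZero (isZero_zero _)).symm
  add_comm := by
    rintro ⟨K⟩ ⟨K'⟩
    exact AcyclicMonoid.mk_eq_of_iso (biprod.braiding _ _)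
  nsmul := nsmulRec

lemma AcyclicMonoid.mk_add (K K' : AcyclicComplex A) : AcyclicMonoid.mk h K +
    AcyclicMonoid.mk h K' = AcyclicMonoid.mk h ⟨K.1 ⊞ K'.1, acyclic_biprod K.2 K'.2⟩ := rfl

open Classical in
variable (h) in
/-- The class of an acyclic complex in the group of stable equivalence classes. -/
def acyclicHat (K : Z2Complex A) : Algebra.GrothendieckAddGroup (AcyclicMonoid h) :=
  -- The default `0` only makes the function total, as `acyclic_additive_eq` expects.
  if hK : K.Acyclic then Algebra.GrothendieckAddGroup.of (AcyclicMonoid.mk h ⟨K, hK⟩) else 0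

lemma acyclicHat_of_acyclic {K : Z2Complex A} (hK : K.Acyclic) : acyclicHat h K =
    Algebra.GrothendieckAddGroup.of (AcyclicMonoid.mk h ⟨K, hK⟩) := dif_pos hK

lemma acyclicHat_extPair {L M X : Z2Complex A} (p : ExtPair L M X) (hM : M.Acyclic)
    (hL : L.Acyclic) : acyclicHat h X = acyclicHat h M + acyclicHat h L := by
  have hX := acyclic_middle p hL hM
  rw [acyclicHat_of_acyclic hX, acyclicHat_of_acyclic hM, acyclicHat_of_acyclic hL, ← map_add,
    AcyclicMonoid.mk_add]
  have hb : bd X = bd (M ⊞ L) := by rw [bd_of_acyclic_left p hM, bd_biprod M hL]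
  exact congrArg _ (Quotient.sound ⟨hb, 0, acyclic_of_isZero (isZero_zero _),
    quotientCls_biprod_congr (acyclic_of_isZero (isZero_zero _))
      (acyclic_of_isZero (isZero_zero _)) (index_eq_of_bd_eq hX (acyclic_biprod hM hL) hb)
      (quotientCls_extPair p hM) rfl rfl⟩)

/-- The short exact sequence of cones of a short exact sequence. -/
def ExtPair.dbl {A : Type u} [Category.{v} A] [Abelian A] {i j : ZMod 2}
    (hij : (ComplexShape.up (ZMod 2)).Rel i j) {L M X : A} (p : ExtPair L M X) :
    ExtPair (dbl hij L) (dbl hij M) (dbl hij X) :=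
  ⟨(dblMap hij p.f, dblMap hij p.g), from_dbl_ext hij (by simp [reassoc_of% p.zero]),
    p.shortExact.map_of_exact (dblFunctor hij)⟩

variable (h) in
/-- The class of the cone, as a homomorphism on the Grothendieck group. -/
def dblHat {i j : ZMod 2} (hij : (ComplexShape.up (ZMod 2)).Rel i j) :
    K0 A →+ Algebra.GrothendieckAddGroup (AcyclicMonoid h) :=
  K0.lift (fun X => acyclicHat h (dbl hij X)) fun _ _ _ p =>
    acyclicHat_extPair (p.dbl hij) (acyclic_dbl hij _) (acyclic_dbl hij _)

lemma dblHat_of {i j : ZMod 2} (hij : (ComplexShape.up (ZMod 2)).Rel i j) (X : A) :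
    dblHat h hij (K0.of X) = acyclicHat h (dbl hij X) := by
  unfold dblHat
  rw [K0.lift_of]

/-- Both sides are additive on acyclic complexes and agree on cones. Hence the class in the group
completion is determined by `bd K`. -/
lemma acyclicHat_eq {K : Z2Complex A} (hK : K.Acyclic) :
    acyclicHat h K = dblHat h rel_zero_one (bd K).1 + dblHat h rel_one_zero (bd K).2 := by
  refine acyclic_additive_eq (fun K => acyclicHat h K)
    (fun K => dblHat h rel_zero_one (bd K).1 + dblHat h rel_one_zero (bd K).2)
    acyclicHat_extPair ?_ ?_ ?_ hK
  · intro L M X p hM _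
    simp only [bd_of_acyclic_left p hM, Prod.fst_add, Prod.snd_add, map_add]
    abel
  · intro X
    simp only [bd_cone, map_zero, add_zero, dblHat_of]
    rfl
  · intro X
    simp only [bd_coneStar, map_zero, zero_add, dblHat_of]
    rfl

/-- Acyclic complexes with the same boundary classes are stably equal in the quotient algebra. -/
lemma exists_stable_eq_of_acyclic {K K' : Z2Complex A} (hK : K.Acyclic) (hK' : K'.Acyclic)
    (hb : bd K = bd K') :
    ∃ T : Z2Complex A, T.Acyclic ∧ quotientCls h (K ⊞ T) = quotientCls h (K' ⊞ T) := by
  have e : acyclicHat h K = acyclicHat h K' := by rw [acyclicHat_eq hK, acyclicHat_eq hK', hb]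
  rw [acyclicHat_of_acyclic hK, acyclicHat_of_acyclic hK'] at e
  -- Equality in the group completion means equality after adding some `C`; unfolding the stable
  -- relation adds a further `T`.
  obtain ⟨c, hc⟩ :=
    (AddLocalization.addMonoidOf (⊤ : AddSubmonoid (AcyclicMonoid h))).eq_iff_exists.1 e
  obtain ⟨⟨C, hC⟩, hCc⟩ := Quotient.exists_rep c.1
  rw [← hCc] at hc
  obtain ⟨-, T, hT, h₂⟩ := Quotient.exact hc
  refine ⟨C ⊞ T, acyclic_biprod hC hT, ?_⟩
  have i : ∀ K : Z2Complex A, quotientCls h ((C ⊞ K) ⊞ T) = quotientCls h (K ⊞ C ⊞ T) := fun K =>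
    quotientCls_iso (biprod.mapIso (biprod.braiding _ _) (Iso.refl _) ≪≫ biprod.associator _ _ _)
  exact (i K).symm.trans (h₂.trans (i K'))

variable (h) in
/-- Two complexes with the same invariants and the same class in the quotient algebra. -/
def SameClass (M M' : Z2Complex A) : Prop :=
  index M = index M' ∧ quotientCls h M = quotientCls h M'

omit [∀ X Y : A, Finite (X ⟶ Y)] [∀ X Y : A, Finite (Ext X Y 1)] hHer in
lemma SameClass.trans {M M' M'' : Z2Complex A} (h₁ : SameClass h M M') (h₂ : SameClass h M' M'') :
    SameClass h M M'' := ⟨h₁.1.trans h₂.1, h₁.2.trans h₂.2⟩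

omit [∀ X Y : A, Finite (X ⟶ Y)] [∀ X Y : A, Finite (Ext X Y 1)] hHer in
lemma SameClass.symm {M M' : Z2Complex A} (h₁ : SameClass h M M') : SameClass h M' M :=
  ⟨h₁.1.symm, h₁.2.symm⟩

omit [∀ X Y : A, Finite (X ⟶ Y)] [∀ X Y : A, Finite (Ext X Y 1)] hHer in
lemma SameClass.of_iso {M M' : Z2Complex A} (e : M ≅ M') : SameClass h M M' :=
  ⟨index_iso e, quotientCls_iso e⟩

lemma SameClass.biprod {M M' : Z2Complex A} (h₁ : SameClass h M M') {K : Z2Complex A}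
    (hK : K.Acyclic) : SameClass h (M ⊞ K) (M' ⊞ K) :=
  ⟨by rw [index_biprod _ hK, index_biprod _ hK, h₁.1],
    quotientCls_biprod_congr hK hK h₁.1 h₁.2 rfl rfl⟩

/-- Complexes with the same invariants are stably equal in the quotient algebra. -/
lemma exists_stable_eq {M M' : Z2Complex A} (hi : index M = index M') :
    ∃ T : Z2Complex A, T.Acyclic ∧ quotientCls h (M ⊞ T) = quotientCls h (M' ⊞ T) := by
  have hz : (0 : Z2Complex A).Acyclic := acyclic_of_isZero (isZero_zero _)
  have swap : ∀ (M K L : Z2Complex A), SameClass h ((M ⊞ K) ⊞ L) ((M ⊞ L) ⊞ K) := fun M K L =>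
    .of_iso (biprod.associator _ _ _ ≪≫ biprod.mapIso (Iso.refl M) (biprod.braiding _ _) ≪≫
      (biprod.associator _ _ _).symm)
  have assoc : ∀ (M K L : Z2Complex A), SameClass h (M ⊞ (K ⊞ L)) ((M ⊞ K) ⊞ L) := fun M K L =>
    .of_iso (biprod.associator _ _ _).symm
  -- Allowing acyclic summands on both sides gives an equivalence relation, so the reduction to
  -- homology stalks applies.
  have key : ∀ M : Z2Complex A, ∃ K K' : Z2Complex A, K.Acyclic ∧ K'.Acyclic ∧
      SameClass h (M ⊞ K) ((stalk (M.homology 1) ⊞ stalkStar (M.homology 0)) ⊞ K') := by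
    refine rel_stalk_homology (r := fun M M' => ∃ K K' : Z2Complex A, K.Acyclic ∧ K'.Acyclic ∧
      SameClass h (M ⊞ K) (M' ⊞ K')) ⟨?_, ?_, ?_⟩ ?_
    · exact fun M => ⟨0, 0, hz, hz, rfl, rfl⟩
    · exact fun ⟨K, K', hK, hK', e⟩ => ⟨K', K, hK', hK, e.symm⟩
    · rintro M M' M'' ⟨K, K', hK, hK', e⟩ ⟨L, L', hL, hL', e'⟩
      exact ⟨K ⊞ L, L' ⊞ K', acyclic_biprod hK hL, acyclic_biprod hL' hK',
        (assoc _ _ _).trans ((e.biprod hL).trans ((swap _ _ _).trans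
          ((e'.biprod hK').trans (assoc _ _ _).symm)))⟩
    · intro M K L p hK
      refine ⟨0, K, hz, hK, (SameClass.of_iso (isoBiprodZero (isZero_zero _)).symm).trans
        (SameClass.trans ⟨?_, quotientCls_extPair p hK⟩ (.of_iso (biprod.braiding _ _)))⟩
      rw [index_of_acyclic_left p hK, index_of_acyclic_left (ExtPair.split K M) hK]
  obtain ⟨K, K', hK, hK', e⟩ := key M
  obtain ⟨L, L', hL, hL', e'⟩ := key M'
  obtain ⟨e₁⟩ := IsoClass.mk_eq_iff.1 (congrArg Prod.fst hi)
  obtain ⟨e₀⟩ := IsoClass.mk_eq_iff.1 (congrArg (fun b : HallIndex A => b.2.1) hi)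
  let s := stalk (M.homology 1) ⊞ stalkStar (M.homology 0)
  have hs : SameClass h ((stalk (M'.homology 1) ⊞ stalkStar (M'.homology 0)) ⊞ L') (s ⊞ L') :=
    .of_iso (biprod.mapIso (stalkSumIso e₁ e₀).symm (Iso.refl _))
  have hKL : (K ⊞ L).Acyclic := acyclic_biprod hK hL
  have f : SameClass h (M ⊞ (K ⊞ L)) (s ⊞ (K' ⊞ L)) :=
    (assoc _ _ _).trans ((e.biprod hL).trans (assoc _ _ _).symm)
  have f' : SameClass h (M' ⊞ (K ⊞ L)) (s ⊞ (L' ⊞ K)) :=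
    (assoc _ _ _).trans ((swap _ _ _).trans (((e'.trans hs).biprod hK).trans (assoc _ _ _).symm))
  -- Both complexes are added to the same stalk sum `s` with equal resulting indices, so cancelling
  -- `bd s` reduces to the acyclic case.
  have hb : bd (K' ⊞ L) = bd (L' ⊞ K) := by
    have a := f.1.symm.trans (((index_biprod M hKL).trans
      ((congrArg _ hi).trans (index_biprod M' hKL).symm)).trans f'.1)
    have b := congrArg (fun b : HallIndex A => b.2.2) a
    have c : bd (s ⊞ (K' ⊞ L)) = bd (s ⊞ (L' ⊞ K)) := b
    rw [bd_biprod s (acyclic_biprod hK' hL), bd_biprod s (acyclic_biprod hL' hK)] at c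
    exact add_left_cancel c
  obtain ⟨T, hT, t⟩ := exists_stable_eq_of_acyclic (h := h) (acyclic_biprod hK' hL)
    (acyclic_biprod hL' hK) hb
  refine ⟨(K ⊞ L) ⊞ T, acyclic_biprod hKL hT, ?_⟩
  have g : quotientCls h (s ⊞ ((K' ⊞ L) ⊞ T)) = quotientCls h (s ⊞ ((L' ⊞ K) ⊞ T)) :=
    quotientCls_biprod_congr (acyclic_biprod (acyclic_biprod hK' hL) hT)
      (acyclic_biprod (acyclic_biprod hL' hK) hT) rfl rfl
      (by rw [bd_biprod _ hT, bd_biprod _ hT, hb]) t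
  exact ((assoc _ _ _).trans ((f.biprod hT).trans (assoc _ _ _).symm)).2.trans
    (g.trans ((assoc _ _ _).trans ((f'.biprod hT).trans (assoc _ _ _).symm)).2.symm)

end Stable

/-! ### Weighted translations of indices. -/

section ScaledShift

variable {A : Type u} [Category.{v} A] [Abelian A]

open HallIndex

/-- Translation of the boundary classes with nonzero coefficients. -/
def scaledShift (κ : K0 A × K0 A) (c : HallIndex A → ℚ) (hc : ∀ b, c b ≠ 0) :
    (HallIndex A →₀ ℚ) ≃ₗ[ℚ] (HallIndex A →₀ ℚ) :=
  LinearEquiv.ofLinearMap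
    (Finsupp.linearCombination ℚ fun b => Finsupp.single (shift κ b) (c b))
    (Finsupp.linearCombination ℚ fun b => Finsupp.single (shift (-κ) b) (c (shift (-κ) b))⁻¹)
    (Finsupp.lhom_ext fun b q => by
      have := hc (shift (-κ) b)
      simp only [LinearMap.comp_apply, Finsupp.linearCombination_single, Finsupp.smul_single,
        smul_eq_mul, shift_shift, add_neg_cancel, shift_zero, LinearMap.id_apply,
        inv_mul_cancel_right₀ this])
    (Finsupp.lhom_ext fun b q => by
      have := hc b
      simp only [LinearMap.comp_apply, Finsupp.linearCombination_single, Finsupp.smul_single,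
        smul_eq_mul, shift_shift, neg_add_cancel, shift_zero, LinearMap.id_apply,
        mul_inv_cancel_right₀ this])

lemma scaledShift_single (κ : K0 A × K0 A) (c : HallIndex A → ℚ) (hc : ∀ b, c b ≠ 0)
    (b : HallIndex A) (q : ℚ) :
    scaledShift κ c hc (Finsupp.single b q) = Finsupp.single (shift κ b) (q * c b) := by
  refine (Finsupp.linearCombination_single ℚ q b).trans ?_
  rw [Finsupp.smul_single, smul_eq_mul]

end ScaledShift

/-! ### The right denominator property. -/

section Denominators

variable {A : Type u} [Category.{v} A] [Abelian A] [∀ X Y : A, Finite (X ⟶ Y)]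
  [∀ X Y : A, Finite (Ext X Y 1)] {h : IsHallAlgebra (Z2Complex A)} [hHer : Fact (IsHereditary A)]

open HallIndex

/-- The action on invariants of the right multiplication by an acyclic complex. -/
def rightShift (κ : K0 A × K0 A) : (HallIndex A →₀ ℚ) ≃ₗ[ℚ] (HallIndex A →₀ ℚ) :=
  scaledShift κ (fun b => (chiRight b κ)⁻¹) fun b => inv_ne_zero (chiRight_ne_zero b κ)

/-- The action on invariants of the left multiplication by an acyclic complex. -/
def leftShift (κ : K0 A × K0 A) : (HallIndex A →₀ ℚ) ≃ₗ[ℚ] (HallIndex A →₀ ℚ) :=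
  scaledShift κ (fun b => (chiLeft κ b)⁻¹) fun b => inv_ne_zero (chiLeft_ne_zero κ b)

omit hHer in
lemma quotient_induction {p : QuotientHallAlgebra h → Prop} (h₀ : p 0)
    (hadd : ∀ x y, p x → p y → p (x + y)) (hcls : ∀ (q : ℚ) (M : Z2Complex A),
      p (q • quotientCls h M)) (x : QuotientHallAlgebra h) : p x := by
  obtain ⟨y, rfl⟩ := quotMap_surjective h x
  induction y using hallSpace_induction with
  | h₀ => rwa [map_zero]
  | hadd y z hy hz => rw [map_add]; exact hadd _ _ hy hz
  | hcls q M => rw [map_smul]; exact hcls q M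

lemma barMap_mul_cls (x : QuotientHallAlgebra h) {K : Z2Complex A} (hK : K.Acyclic) :
    barMap h (x * quotientCls h K) = rightShift (bd K) (barMap h x) := by
  induction x using quotient_induction with
  | h₀ => rw [zero_mul, map_zero, map_zero]
  | hadd x y hx hy => rw [add_mul, map_add, map_add, map_add, hx, hy]
  | hcls q M =>
    rw [smul_mul_assoc, map_smul, map_smul, map_smul, quotientCls_mul M hK, map_smul, barMap_cls,
      barMap_cls, rightShift, scaledShift_single, index_biprod M hK, Finsupp.smul_single,
      eulerForm_acyclic_right M hK, smul_eq_mul, mul_one, one_mul]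

/-- `quotientCls_mul` needs the acyclic factor on the right. On the left, `K` is viewed as an
extension of `K` by `0`, which reduces the product on indices to `[0] ⋄ [M]`. -/
lemma barMap_cls_mul (x : QuotientHallAlgebra h) {K : Z2Complex A} (hK : K.Acyclic) :
    barMap h (quotientCls h K * x) = leftShift (bd K) (barMap h x) := by
  induction x using quotient_induction with
  | h₀ => rw [mul_zero, map_zero, map_zero]
  | hadd x y hx hy => rw [mul_add, map_add, map_add, map_add, hx, hy]
  | hcls q M =>
    have e := indexMap_mul_of_acyclic_right M
      (ExtPair.ofIso (Iso.refl K) (isZero_zero (Z2Complex A))) hK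
    rw [hallMul_zero_cls, indexMap_cls, shiftMap_single, Finsupp.smul_single, smul_eq_mul,
      mul_one] at e
    rw [mul_smul_comm, map_smul, map_smul, map_smul, barMap_cls, leftShift, scaledShift_single,
      one_mul, ← e]
    rfl

omit [∀ X Y : A, Finite (X ⟶ Y)] [∀ X Y : A, Finite (Ext X Y 1)] hHer in
lemma mem_acyclicClasses_smul {s : QuotientHallAlgebra h} (hs : s ∈ acyclicClasses h) {q : ℚ}
    (hq : q ≠ 0) : q • s ∈ acyclicClasses h := by
  obtain ⟨q', K, hq', hK, rfl⟩ := hs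
  exact ⟨q * q', K, mul_ne_zero hq hq', hK, smul_smul _ _ _⟩

omit hHer in
lemma acyclicClasses_mul_mem {s t : QuotientHallAlgebra h} (hs : s ∈ acyclicClasses h)
    (ht : t ∈ acyclicClasses h) : s * t ∈ acyclicClasses h := by
  obtain ⟨q, K, hq, hK, rfl⟩ := hs
  obtain ⟨q', K', hq', hK', rfl⟩ := ht
  rw [smul_mul_assoc, mul_smul_comm, quotientCls_mul K hK']
  exact mem_acyclicClasses_smul (mem_acyclicClasses_smul (mem_acyclicClasses_smul
    (quotientCls_mem (acyclic_biprod hK hK')) (inv_ne_zero (eulerForm_ne_zero _ _))) hq') hq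

omit hHer in
/-- The classes of acyclic complexes commute up to scalars. -/
lemma exists_commute {s t : QuotientHallAlgebra h} (hs : s ∈ acyclicClasses h)
    (ht : t ∈ acyclicClasses h) : ∃ c : ℚ, c ≠ 0 ∧ s * t = c • (t * s) := by
  obtain ⟨q, K, hq, hK, rfl⟩ := hs
  obtain ⟨q', K', hq', hK', rfl⟩ := ht
  refine ⟨(eulerForm K K')⁻¹ * eulerForm K' K,
    mul_ne_zero (inv_ne_zero (eulerForm_ne_zero _ _)) (eulerForm_ne_zero _ _), ?_⟩
  have h₁ := eulerForm_ne_zero K' K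
  rw [smul_mul_assoc, mul_smul_comm, smul_mul_assoc, mul_smul_comm, quotientCls_mul K hK',
    quotientCls_mul K' hK, quotientCls_iso (biprod.braiding K' K)]
  simp only [smul_smul]
  congr 1
  field_simp

/-- An element with vanishing invariants is annihilated by the class of an acyclic complex. -/
lemma exists_mul_eq_zero {x : QuotientHallAlgebra h} (hx : barMap h x = 0) :
    ∃ t ∈ acyclicClasses h, x * t = 0 := by
  classical
  -- One complex is chosen for each index attained. A class minus that of the chosen complex is
  -- killed by a denominator; sums are handled by commuting denominators up to scalars.
  let g₀ : HallIndex A → QuotientHallAlgebra h := fun b =>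
    if hb : ∃ M, index M = b then quotientCls h hb.choose else 0
  let g : (HallIndex A →₀ ℚ) →ₗ[ℚ] QuotientHallAlgebra h := Finsupp.linearCombination ℚ g₀
  have key : ∀ x : QuotientHallAlgebra h, ∃ t ∈ acyclicClasses h,
      (x - g (barMap h x)) * t = 0 := by
    intro x
    induction x using quotient_induction with
    | h₀ => exact ⟨_, quotientCls_mem (acyclic_cone 0), by simp⟩
    | hadd x y hx hy =>
      obtain ⟨s, hs, hx⟩ := hx
      obtain ⟨t, ht, hy⟩ := hy
      obtain ⟨c, -, hc⟩ := exists_commute hs ht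
      refine ⟨s * t, acyclicClasses_mul_mem hs ht, ?_⟩
      rw [map_add, map_add, add_sub_add_comm, add_mul, ← mul_assoc, hx, zero_mul, zero_add, hc,
        mul_smul_comm, ← mul_assoc, hy, zero_mul, smul_zero]
    | hcls q M =>
      have hb : ∃ M', index M' = index M := ⟨M, rfl⟩
      obtain ⟨T, hT, e⟩ := exists_stable_eq (h := h) hb.choose_spec
      refine ⟨_, quotientCls_mem hT, ?_⟩
      have : g (barMap h (quotientCls h M)) = quotientCls h hb.choose := by
        rw [barMap_cls]
        simp only [g, Finsupp.linearCombination_single, one_smul, g₀, dif_pos hb]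
      rw [map_smul, map_smul, this, ← smul_sub, smul_mul_assoc, sub_mul, quotientCls_mul M hT,
        quotientCls_mul _ hT, e, eulerForm_acyclic_right _ hT, eulerForm_acyclic_right _ hT,
        hb.choose_spec, sub_self, smul_zero]
  obtain ⟨t, ht, e⟩ := key x
  exact ⟨t, ht, by rwa [hx, map_zero, sub_zero] at e⟩

-- On indices, acyclic classes act invertibly from both sides by translations that differ only in
-- their weights. So the Ore equation can be solved on indices, and the error, of zero index, is
-- removed by a further denominator from `exists_mul_eq_zero`. Reversibility follows from the
-- injectivity of `leftShift`.
variable (h) in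
lemma isRightDenominatorSet : IsRightDenominatorSet (acyclicClasses h) where
  one_mem := quotientCls_mem (acyclic_of_isZero (isZero_zero _))
  mul_mem _ _ := acyclicClasses_mul_mem
  ore := by
    rintro a _ ⟨q, K, hq, hK, rfl⟩
    have key : ∃ y, barMap h (quotientCls h K * y) = barMap h (a * quotientCls h K) := by
      induction a using quotient_induction with
      | h₀ => exact ⟨0, by simp⟩
      | hadd x y hx hy =>
        obtain ⟨x', hx'⟩ := hx
        obtain ⟨y', hy'⟩ := hy
        exact ⟨x' + y', by rw [mul_add, map_add, hx', hy', add_mul, map_add]⟩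
      | hcls c M =>
        refine ⟨(c * (chiLeft (bd K) (index M) * (chiRight (index M) (bd K))⁻¹)) •
          quotientCls h M, ?_⟩
        have := chiLeft_ne_zero (bd K) (index M)
        rw [barMap_cls_mul _ hK, barMap_mul_cls _ hK, map_smul, map_smul, barMap_cls, map_smul,
          map_smul, barMap_cls, leftShift, rightShift, scaledShift_single, scaledShift_single,
          Finsupp.smul_single, Finsupp.smul_single]
        congr 1
        simp only [smul_eq_mul]
        field_simp
    obtain ⟨y, hy⟩ := key
    obtain ⟨t, ht, e⟩ := exists_mul_eq_zero (h := h)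
      (x := quotientCls h K * y - a * quotientCls h K) (by rw [map_sub, hy, sub_self])
    refine ⟨q⁻¹ • (y * t), quotientCls h K * t, acyclicClasses_mul_mem (quotientCls_mem hK) ht, ?_⟩
    rw [smul_mul_assoc, mul_smul_comm, smul_smul, mul_inv_cancel₀ hq, one_smul, ← mul_assoc,
      ← mul_assoc, ← sub_eq_zero, ← sub_mul, e]
  reversible := by
    rintro a _ ⟨q, K, hq, hK, rfl⟩ e
    refine exists_mul_eq_zero ?_
    rw [smul_mul_assoc] at e
    have e' := congrArg (barMap h) ((smul_eq_zero.1 e).resolve_left hq)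
    rw [barMap_cls_mul _ hK, map_zero] at e'
    exact (leftShift (bd K)).map_eq_zero_iff.1 e'

end Denominators

/-! ### Calculus of right fractions. -/

section Fractions

variable {R : Type u} [Ring R] {S : Set R} (hS : IsRightDenominatorSet S)

namespace RightLocalization

open OreLocalization

lemma exists_frac (x : RightLocalization hS) : ∃ a s, ∃ hs : s ∈ S, x = frac hS a s hs := by
  obtain ⟨y, rfl⟩ := MulOpposite.op_surjective x
  induction y using OreLocalization.ind with
  | _ r s => exact ⟨r.unop, s.1.unop, s.2, rfl⟩

lemma frac_expand (a s t : R) (hs : s ∈ S) (hst : s * t ∈ S) :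
    frac hS a s hs = frac hS (a * t) (s * t) hst :=
  congrArg MulOpposite.op (OreLocalization.expand (MulOpposite.op a)
    (⟨MulOpposite.op s, hs⟩ : hS.submonoid.op) (MulOpposite.op t) hst)

lemma frac_add (a b s : R) (hs : s ∈ S) :
    frac hS a s hs + frac hS b s hs = frac hS (a + b) s hs :=
  congrArg MulOpposite.op (OreLocalization.add_oreDiv (r := MulOpposite.op a)
    (r' := MulOpposite.op b) (s := (⟨MulOpposite.op s, hs⟩ : hS.submonoid.op)))

lemma frac_zero (s : R) (hs : s ∈ S) : frac hS 0 s hs = 0 :=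
  congrArg MulOpposite.op (OreLocalization.zero_oreDiv (⟨MulOpposite.op s, hs⟩ : hS.submonoid.op))

lemma smul_frac {k : Type w} [CommSemiring k] [Algebra k R] (q : k) (a s : R) (hs : s ∈ S) :
    q • frac hS a s hs = frac hS (q • a) s hs := by
  refine congrArg MulOpposite.op ((OreLocalization.smul_one_oreDiv_one_smul (S := hS.submonoid.op)
    q (MulOpposite.op a /ₒ (⟨MulOpposite.op s, hs⟩ : hS.submonoid.op))).symm.trans ?_)
  refine (OreLocalization.oreDiv_smul_char (q • (1 : Rᵐᵒᵖ)) (MulOpposite.op a) 1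
    (⟨MulOpposite.op s, hs⟩ : hS.submonoid.op) (q • 1) ⟨MulOpposite.op s, hs⟩
    (by simp)).trans ?_
  rw [mul_one, smul_eq_mul, smul_mul_assoc, one_mul]
  rfl

lemma frac_mul_ofRing (a b s b' s' : R) (hs : s ∈ S) (hs' : s' ∈ S) (e : b * s' = s * b') :
    frac hS a s hs * ofRing hS b = frac hS (a * b') s' hs' := by
  refine congrArg MulOpposite.op ((OreLocalization.oreDiv_mul_char (MulOpposite.op b)
    (MulOpposite.op a) (1 : hS.submonoid.op) (⟨MulOpposite.op s, hs⟩ : hS.submonoid.op)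
    (MulOpposite.op b') (⟨MulOpposite.op s', hs'⟩ : hS.submonoid.op)
    (congrArg MulOpposite.op e)).trans ?_)
  rw [mul_one]
  rfl

lemma frac_mul_ofRing_self (a s : R) (hs : s ∈ S) :
    frac hS a s hs * ofRing hS s = ofRing hS a := by
  rw [frac_mul_ofRing hS a s s 1 1 hs hS.one_mem rfl, mul_one]
  rfl

end RightLocalization

end Fractions

/-! ### Commutation of the weighted translations. -/

section Shifts

variable {A : Type u} [Category.{v} A] [Abelian A] [∀ X Y : A, Finite (X ⟶ Y)]
  [∀ X Y : A, Finite (Ext X Y 1)] [hHer : Fact (IsHereditary A)]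

open HallIndex

lemma rightShift_single (κ : K0 A × K0 A) (b : HallIndex A) (q : ℚ) :
    rightShift κ (Finsupp.single b q) =
      Finsupp.single (shift κ b) (q * (chiRight b κ)⁻¹) :=
  scaledShift_single _ _ _ _ _

lemma rightShift_symm_single (κ : K0 A × K0 A) (b : HallIndex A) (q : ℚ) :
    (rightShift κ).symm (Finsupp.single b q) =
      Finsupp.single (shift (-κ) b) (q * chiRight (shift (-κ) b) κ) := by
  rw [LinearEquiv.symm_apply_eq, rightShift_single, shift_shift, add_neg_cancel, shift_zero,
    mul_inv_cancel_right₀ (chiRight_ne_zero _ _)]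

lemma chiRight_shift (κ κ' : K0 A × K0 A) (b : HallIndex A) :
    chiRight (shift κ b) κ' = chiRight b κ' * eulerK0 (κ.1 + κ.2) (κ'.1 + κ'.2) := by
  simp only [chiRight, deg₁_shift, deg₀_shift, eulerK0_add_left, eulerK0_add_right]
  ring

/-- The right shifts commute up to scalars. -/
lemma rightShift_comm (κ κ' : K0 A × K0 A) : ∃ c : ℚ, ∀ v : HallIndex A →₀ ℚ,
    rightShift κ (rightShift κ' v) = c • rightShift κ' (rightShift κ v) := by
  -- By `chiRight_shift`, weighting after a translation costs an Euler factor independent of the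
  -- index.
  refine ⟨(eulerK0 (κ'.1 + κ'.2) (κ.1 + κ.2))⁻¹ * eulerK0 (κ.1 + κ.2) (κ'.1 + κ'.2), fun v => ?_⟩
  induction v using Finsupp.induction_linear with
  | zero => simp
  | add v w hv hw => rw [map_add, map_add, hv, hw, map_add, map_add, smul_add]
  | single b q =>
    simp only [rightShift_single, shift_shift, Finsupp.smul_single, chiRight_shift, smul_eq_mul,
      add_comm κ' κ]
    congr 1
    have := eulerK0_ne_zero (κ.1 + κ.2) (κ'.1 + κ'.2)
    have := eulerK0_ne_zero (κ'.1 + κ'.2) (κ.1 + κ.2)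
    have := chiRight_ne_zero b κ
    have := chiRight_ne_zero b κ'
    field_simp

lemma rightShift_zero (v : HallIndex A →₀ ℚ) : rightShift 0 v = v := by
  induction v using Finsupp.induction_linear with
  | zero => simp
  | add v w hv hw => rw [map_add, hv, hw]
  | single b q => rw [rightShift_single, shift_zero, chiRight_zero, inv_one, mul_one]

end Shifts

/-! ### Denominators acting on indices. -/

section Localization

variable {A : Type u} [Category.{v} A] [Abelian A] [∀ X Y : A, Finite (X ⟶ Y)]
  [∀ X Y : A, Finite (Ext X Y 1)] {h : IsHallAlgebra (Z2Complex A)} [hHer : Fact (IsHereditary A)]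

open HallIndex RightLocalization

/-- A denominator may be written as `q[K]` in several ways, but its image under `barMap` determines
`q` and `bd K`, so the operator is well defined. -/
lemma exists_denomShift {s : QuotientHallAlgebra h} (hs : s ∈ acyclicClasses h) :
    ∃ ρ : (HallIndex A →₀ ℚ) ≃ₗ[ℚ] (HallIndex A →₀ ℚ), ∀ (q : ℚ) (K : Z2Complex A), K.Acyclic →
      s = q • quotientCls h K → ∀ v, ρ v = q • rightShift (bd K) v := by
  obtain ⟨q, K, hq, hK, rfl⟩ := hs
  refine ⟨(rightShift (bd K)).trans (LinearEquiv.smulOfNeZero ℚ _ q hq), ?_⟩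
  intro q' K' hK' e v
  have e' := congrArg (barMap h) e
  rw [map_smul, map_smul, barMap_cls, barMap_cls, Finsupp.smul_single, Finsupp.smul_single,
    smul_eq_mul, mul_one, smul_eq_mul, mul_one, Finsupp.single_eq_single_iff] at e'
  obtain ⟨h₁, h₂⟩ | ⟨h₁, -⟩ := e'
  · have hb : bd K = bd K' := congrArg (fun b : HallIndex A => b.2.2) h₁
    rw [← hb, ← h₂]
    rfl
  · exact absurd h₁ hq

/-- The action on invariants of the right multiplication by a scalar multiple of the class of an
acyclic complex. -/
def denomShift (s : QuotientHallAlgebra h) (hs : s ∈ acyclicClasses h) :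
    (HallIndex A →₀ ℚ) ≃ₗ[ℚ] (HallIndex A →₀ ℚ) := (exists_denomShift hs).choose

lemma denomShift_apply {s : QuotientHallAlgebra h} (hs : s ∈ acyclicClasses h) {q : ℚ}
    {K : Z2Complex A} (hK : K.Acyclic) (e : s = q • quotientCls h K) (v : HallIndex A →₀ ℚ) :
    denomShift s hs v = q • rightShift (bd K) v :=
  (exists_denomShift hs).choose_spec q K hK e v

lemma denomShift_cls {K : Z2Complex A} (hK : K.Acyclic) (hs : quotientCls h K ∈ acyclicClasses h)
    (v : HallIndex A →₀ ℚ) : denomShift (quotientCls h K) hs v = rightShift (bd K) v := by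
  rw [denomShift_apply hs hK (one_smul ℚ _).symm, one_smul]

lemma denomShift_one (hs : (1 : QuotientHallAlgebra h) ∈ acyclicClasses h)
    (v : HallIndex A →₀ ℚ) : denomShift 1 hs v = v := by
  refine (denomShift_cls (acyclic_of_isZero (isZero_zero _)) hs v).trans ?_
  rw [bd_of_isZero (isZero_zero _), rightShift_zero]

lemma barMap_mul (x : QuotientHallAlgebra h) {s : QuotientHallAlgebra h}
    (hs : s ∈ acyclicClasses h) : barMap h (x * s) = denomShift s hs (barMap h x) := by
  obtain ⟨q, K, hq, hK, e⟩ := id hs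
  rw [denomShift_apply hs hK e, e, mul_smul_comm, map_smul, barMap_mul_cls x hK]

/-- The shifts of acyclic classes commute in the same way as the classes. -/
lemma denomShift_comm {s t : QuotientHallAlgebra h} (hs : s ∈ acyclicClasses h)
    (ht : t ∈ acyclicClasses h) {c : ℚ} (e : s * t = c • (t * s)) (v : HallIndex A →₀ ℚ) :
    denomShift t ht (denomShift s hs v) = c • denomShift s hs (denomShift t ht v) := by
  obtain ⟨c', hc'⟩ : ∃ c' : ℚ, ∀ v, denomShift t ht (denomShift s hs v) =
      c' • denomShift s hs (denomShift t ht v) := by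
    obtain ⟨q, K, -, hK, es⟩ := id hs
    obtain ⟨q', K', -, hK', et⟩ := id ht
    obtain ⟨c', hc'⟩ := rightShift_comm (bd K') (bd K)
    refine ⟨c', fun v => ?_⟩
    rw [denomShift_apply ht hK' et, denomShift_apply hs hK es, denomShift_apply ht hK' et,
      denomShift_apply hs hK es, map_smul, map_smul, hc', smul_comm q' q, smul_comm c' q,
      smul_comm c' q']
  have b_s : barMap h s = denomShift s hs (barMap h 1) :=
    (congrArg (barMap h) (one_mul s)).symm.trans (barMap_mul 1 hs)
  have b_t : barMap h t = denomShift t ht (barMap h 1) :=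
    (congrArg (barMap h) (one_mul t)).symm.trans (barMap_mul 1 ht)
  have e₁ := congrArg (barMap h) e
  rw [barMap_mul s ht, map_smul, barMap_mul t hs, b_s, b_t, hc'] at e₁
  -- The scalars `c` and `c'` are compared on one nonzero vector, obtained from the unit.
  have hw : denomShift s hs (denomShift t ht (barMap h 1)) ≠ 0 := by
    intro h₀
    rw [LinearEquiv.map_eq_zero_iff, LinearEquiv.map_eq_zero_iff] at h₀
    have e₀ : barMap h 1 = Finsupp.single (index (0 : Z2Complex A)) 1 := barMap_cls 0
    rw [e₀, Finsupp.single_eq_zero] at h₀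
    exact one_ne_zero h₀
  rw [hc', smul_left_injective ℚ hw e₁]

end Localization

section Fractions

variable {R : Type u} [Ring R] {S : Set R} (hS : IsRightDenominatorSet S)

namespace RightLocalization

lemma exists_of_frac_eq {a s b t : R} {hs : s ∈ S} {ht : t ∈ S}
    (e : frac hS a s hs = frac hS b t ht) :
    ∃ u r, s * u ∈ S ∧ s * u = t * r ∧ a * u = b * r := by
  obtain ⟨u, r, h₁, h₂⟩ := OreLocalization.oreDiv_eq_iff.1 (MulOpposite.op_injective e)
  have h₂' : t * u.1.unop = s * r.unop := congrArg MulOpposite.unop h₂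
  refine ⟨r.unop, u.1.unop, ?_, h₂'.symm, (congrArg MulOpposite.unop h₁).symm⟩
  rw [← h₂']
  exact hS.mul_mem _ _ ht u.2

lemma exists_common_denominator (x y : RightLocalization hS) :
    ∃ a b s, ∃ hs : s ∈ S, x = frac hS a s hs ∧ y = frac hS b s hs := by
  obtain ⟨a, s, hs, rfl⟩ := exists_frac hS x
  obtain ⟨b, t, ht, rfl⟩ := exists_frac hS y
  obtain ⟨a₁, s₁, hs₁, e⟩ := hS.ore t s hs
  have hw : s * a₁ ∈ S := e ▸ hS.mul_mem _ _ ht hs₁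
  refine ⟨a * a₁, b * s₁, s * a₁, hw, frac_expand hS a s a₁ hs hw, ?_⟩
  rw [frac_expand hS b t s₁ ht (hS.mul_mem _ _ ht hs₁)]
  congr 1
  exact e.symm

end RightLocalization

end Fractions

/-! ### The index map on the localization. -/

section Localization

variable {A : Type u} [Category.{v} A] [Abelian A] [∀ X Y : A, Finite (X ⟶ Y)]
  [∀ X Y : A, Finite (Ext X Y 1)] {h : IsHallAlgebra (Z2Complex A)} [hHer : Fact (IsHereditary A)]
  (hS : IsRightDenominatorSet (acyclicClasses h))

open HallIndex RightLocalization

/-- Only `s * u` is a denominator, not `u`. Commuting `s` with `s * u` gives `s * (u * s - c⁻¹ • (s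
* u)) = 0`; by reversibility the second factor is killed by a denominator on the right, hence is
invisible on indices, and `denomShift_comm` removes the scalar. -/
lemma barMap_mul_of_mul_mem (a u : QuotientHallAlgebra h) {s : QuotientHallAlgebra h}
    (hs : s ∈ acyclicClasses h) (hw : s * u ∈ acyclicClasses h) :
    barMap h (a * u) = denomShift (s * u) hw ((denomShift s hs).symm (barMap h a)) := by
  obtain ⟨c, hc, e⟩ := exists_commute hs hw
  have e₀ : s * (u * s - c⁻¹ • (s * u)) = 0 := by
    rw [mul_sub, mul_smul_comm, e, smul_smul, inv_mul_cancel₀ hc, one_smul, mul_assoc, sub_self]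
  obtain ⟨r, hr, er⟩ := (isRightDenominatorSet (h := h)).reversible _ s hs e₀
  have e₁ : barMap h (a * (u * s - c⁻¹ • (s * u))) = 0 := by
    rw [← (denomShift r hr).map_eq_zero_iff, ← barMap_mul _ hr, mul_assoc, er, mul_zero, map_zero]
  rw [mul_sub, map_sub, sub_eq_zero, mul_smul_comm, map_smul, ← mul_assoc, barMap_mul _ hs,
    barMap_mul _ hw] at e₁
  apply (denomShift s hs).injective
  rw [e₁]
  have e₂ := denomShift_comm hs hw e ((denomShift s hs).symm (barMap h a))
  rw [LinearEquiv.apply_symm_apply] at e₂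
  rw [e₂, smul_smul, inv_mul_cancel₀ hc, one_smul]

/-- Equal fractions agree after expansion to a common denominator, and expansion preserves the value
by `barMap_mul_of_mul_mem`. -/
lemma exists_locMap (x : ModifiedHallAlgebra hS) : ∃ v : HallIndex A →₀ ℚ, ∀ a s hs,
    x = frac hS a s hs → v = (denomShift s hs).symm (barMap h a) := by
  obtain ⟨a, s, hs, rfl⟩ := exists_frac hS x
  refine ⟨(denomShift s hs).symm (barMap h a), fun b t ht e => ?_⟩
  obtain ⟨u, r, hw, e₁, e₂⟩ := exists_of_frac_eq hS e
  have hw' : t * r ∈ acyclicClasses h := e₁ ▸ hw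
  have e₃ := barMap_mul_of_mul_mem a u hs hw
  have e₄ := barMap_mul_of_mul_mem b r ht hw'
  have e₅ : ∀ v, denomShift (s * u) hw v = denomShift (t * r) hw' v := by
    intro v
    congr 2
  rw [e₂, e₄, e₅] at e₃
  exact ((denomShift _ hw').injective e₃).symm

/-- The underlying function of `locMap`. -/
def locFun (x : ModifiedHallAlgebra hS) : HallIndex A →₀ ℚ := (exists_locMap hS x).choose

lemma locFun_frac (a s : QuotientHallAlgebra h) (hs : s ∈ acyclicClasses h) :
    locFun hS (frac hS a s hs) = (denomShift s hs).symm (barMap h a) :=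
  (exists_locMap hS _).choose_spec a s hs rfl

/-- The map from the modified Hall algebra to the vector space on the invariants, sending the class
of a complex to its invariant. -/
def locMap : ModifiedHallAlgebra hS →ₗ[ℚ] (HallIndex A →₀ ℚ) where
  toFun := locFun hS
  map_add' x y := by
    obtain ⟨a, b, s, hs, rfl, rfl⟩ := exists_common_denominator hS x y
    rw [frac_add, locFun_frac, locFun_frac, locFun_frac, map_add, map_add]
  map_smul' q x := by
    obtain ⟨a, s, hs, rfl⟩ := exists_frac hS x
    rw [smul_frac, locFun_frac, locFun_frac, map_smul, map_smul, RingHom.id_apply]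

lemma locMap_frac (a s : QuotientHallAlgebra h) (hs : s ∈ acyclicClasses h) :
    locMap hS (frac hS a s hs) = (denomShift s hs).symm (barMap h a) :=
  locFun_frac hS a s hs

/-- A numerator of zero index is killed by a denominator, and expanding the fraction by it gives
zero. -/
lemma locMap_injective : Function.Injective (locMap hS) := by
  rw [← LinearMap.ker_eq_bot, LinearMap.ker_eq_bot']
  intro x hx
  obtain ⟨a, s, hs, rfl⟩ := exists_frac hS x
  rw [locMap_frac, LinearEquiv.map_eq_zero_iff] at hx
  obtain ⟨t, ht, e⟩ := exists_mul_eq_zero hx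
  rw [frac_expand hS a s t hs (hS.mul_mem _ _ hs ht), e, frac_zero]

lemma locMap_mhCls (M : Z2Complex A) : locMap hS (mhCls hS M) = Finsupp.single (index M) 1 := by
  refine (locMap_frac hS _ _ _).trans ?_
  rw [LinearEquiv.symm_apply_eq, denomShift_one, barMap_cls]

/-- Moving `s` past the denominator `t` costs a scalar, which the same commutation of their shifts
absorbs. -/
lemma locMap_mul_ofRing (x : ModifiedHallAlgebra hS) {s : QuotientHallAlgebra h}
    (hs : s ∈ acyclicClasses h) : locMap hS (x * ofRing hS s) = denomShift s hs (locMap hS x) := by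
  obtain ⟨a, t, ht, rfl⟩ := exists_frac hS x
  obtain ⟨c, hc, e⟩ := exists_commute hs ht
  rw [frac_mul_ofRing hS a s t (c • s) t ht ht (by rw [e, mul_smul_comm]), locMap_frac,
    locMap_frac, mul_smul_comm, map_smul, barMap_mul _ hs, LinearEquiv.symm_apply_eq,
    denomShift_comm hs ht e, LinearEquiv.apply_symm_apply]

lemma locMap_mul_frac (x : ModifiedHallAlgebra hS) {s t : QuotientHallAlgebra h}
    (hs : s ∈ acyclicClasses h) (ht : t ∈ acyclicClasses h) :
    locMap hS (x * frac hS s t ht) = (denomShift t ht).symm (denomShift s hs (locMap hS x)) := by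
  rw [LinearEquiv.eq_symm_apply, ← locMap_mul_ofRing hS _ ht, mul_assoc, frac_mul_ofRing_self,
    locMap_mul_ofRing hS _ hs]

end Localization

lemma IsoClass.exists_mk {C : Type u} [Category.{v} C] (c : IsoClass C) :
    ∃ X, IsoClass.mk X = c := Quotient.exists_rep c

/-! ### Torus elements, monomials and the basis. -/

section Torus

variable {A : Type u} [Category.{v} A] [Abelian A] [∀ X Y : A, Finite (X ⟶ Y)]
  [∀ X Y : A, Finite (Ext X Y 1)] {h : IsHallAlgebra (Z2Complex A)} [hHer : Fact (IsHereditary A)]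
  (hS : IsRightDenominatorSet (acyclicClasses h))

open HallIndex RightLocalization

/-- The invariant of a quotient of two classes of acyclic complexes. -/
lemma locMap_frac_cls {K L : Z2Complex A} (hK : K.Acyclic) (hL : L.Acyclic) :
    locMap hS (frac hS (quotientCls h K) (quotientCls h L) (quotientCls_mem hL)) =
      Finsupp.single ((IsoClass.mk 0, IsoClass.mk 0, bd K - bd L) : HallIndex A)
        (eulerK0 ((bd K - bd L).1 + (bd K - bd L).2) ((bd L).1 + (bd L).2)) := by
  rw [locMap_frac, LinearEquiv.symm_apply_eq, denomShift_cls hL, barMap_cls, rightShift_single,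
    index_acyclic hK]
  have e : shift (bd L) ((IsoClass.mk 0, IsoClass.mk 0, bd K - bd L) : HallIndex A) =
      (IsoClass.mk 0, IsoClass.mk 0, bd K) := by
    simp [shift]
  have e' : chiRight ((IsoClass.mk 0, IsoClass.mk 0, bd K - bd L) : HallIndex A) (bd L) =
      eulerK0 ((bd K - bd L).1 + (bd K - bd L).2) ((bd L).1 + (bd L).2) := by
    have z : K0.ofClass (IsoClass.mk (0 : A)) = 0 := K0.of_isZero (isZero_zero A)
    simp only [chiRight, deg₁, deg₀, z, zero_add, eulerK0_add_right]
  rw [e, e', mul_inv_cancel₀ (eulerK0_ne_zero _ _)]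

lemma eulerK0_sub_of (X Y : A) :
    eulerK0 (K0.of X - K0.of Y) (K0.of Y) = eulerForm X Y / eulerForm Y Y := by
  rw [eq_div_iff (eulerForm_ne_zero _ _), ← eulerK0_of, ← eulerK0_of, ← eulerK0_add_left,
    sub_add_cancel]

lemma locMap_torusFrac (X Y : A) : locMap hS (torusFrac hS X Y) =
    Finsupp.single ((IsoClass.mk 0, IsoClass.mk 0, K0.of X - K0.of Y, 0) : HallIndex A) 1 := by
  rw [torusFrac, map_smul, locMap_frac_cls hS (acyclic_cone X) (acyclic_cone Y), bd_cone, bd_cone,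
    Finsupp.smul_single, Prod.mk_sub_mk, sub_zero, add_zero, add_zero, eulerK0_sub_of, smul_eq_mul,
    inv_mul_cancel₀ (div_ne_zero (eulerForm_ne_zero _ _) (eulerForm_ne_zero _ _))]

lemma locMap_torusFracStar (X Y : A) : locMap hS (torusFracStar hS X Y) =
    Finsupp.single ((IsoClass.mk 0, IsoClass.mk 0, 0, K0.of X - K0.of Y) : HallIndex A) 1 := by
  rw [torusFracStar, map_smul, locMap_frac_cls hS (acyclic_coneStar X) (acyclic_coneStar Y),
    bd_coneStar, bd_coneStar, Finsupp.smul_single, Prod.mk_sub_mk, sub_zero, zero_add, zero_add,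
    eulerK0_sub_of, smul_eq_mul,
    inv_mul_cancel₀ (div_ne_zero (eulerForm_ne_zero _ _) (eulerForm_ne_zero _ _))]

/-- The injective map `locMap` sees only the difference of the two classes in `K₀`: the Euler factor
in `torusFrac` normalizes the coefficient to one. -/
lemma torusElt_sub (X Y : A) : torusElt hS (K0.of X - K0.of Y) = torusFrac hS X Y := by
  apply locMap_injective hS
  rw [torusElt, locMap_torusFrac, locMap_torusFrac,
    ← (K0.exists_eq_sub (K0.of X - K0.of Y)).choose_spec]

lemma torusEltStar_sub (X Y : A) :
    torusEltStar hS (K0.of X - K0.of Y) = torusFracStar hS X Y := by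
  apply locMap_injective hS
  rw [torusEltStar, locMap_torusFracStar, locMap_torusFracStar,
    ← (K0.exists_eq_sub (K0.of X - K0.of Y)).choose_spec]

lemma exists_locMap_mul_frac_cls {x : ModifiedHallAlgebra hS} {b : HallIndex A} {q : ℚ}
    (hq : q ≠ 0) (hx : locMap hS x = Finsupp.single b q) {K L : Z2Complex A} (hK : K.Acyclic)
    (hL : L.Acyclic) : ∃ q' : ℚ, q' ≠ 0 ∧
      locMap hS (x * frac hS (quotientCls h K) (quotientCls h L) (quotientCls_mem hL)) =
        Finsupp.single (shift (bd K - bd L) b) q' := by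
  rw [locMap_mul_frac hS x (quotientCls_mem hK), hx, denomShift_cls hK]
  have e : ∀ v, (denomShift (quotientCls h L) (quotientCls_mem hL)).symm v =
      (rightShift (bd L)).symm v := by
    intro v
    rw [LinearEquiv.symm_apply_eq, denomShift_cls hL, LinearEquiv.apply_symm_apply]
  rw [e, rightShift_single, rightShift_symm_single, shift_shift, neg_add_eq_sub]
  exact ⟨_, mul_ne_zero (mul_ne_zero hq (inv_ne_zero (chiRight_ne_zero _ _)))
    (chiRight_ne_zero _ _), rfl⟩

lemma exists_locMap_mul_torusElt {x : ModifiedHallAlgebra hS} {b : HallIndex A} {q : ℚ}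
    (hq : q ≠ 0) (hx : locMap hS x = Finsupp.single b q) (α : K0 A) : ∃ q' : ℚ, q' ≠ 0 ∧
      locMap hS (x * torusElt hS α) = Finsupp.single (shift (α, 0) b) q' := by
  obtain ⟨q', hq', e⟩ := exists_locMap_mul_frac_cls hS hq hx
    (acyclic_cone (K0.exists_eq_sub α).choose.1) (acyclic_cone (K0.exists_eq_sub α).choose.2)
  rw [bd_cone, bd_cone, Prod.mk_sub_mk, sub_zero, ← (K0.exists_eq_sub α).choose_spec] at e
  rw [torusElt, torusFrac, mul_smul_comm, map_smul, e, Finsupp.smul_single]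
  exact ⟨_, smul_ne_zero (inv_ne_zero (div_ne_zero (eulerForm_ne_zero _ _)
    (eulerForm_ne_zero _ _))) hq', rfl⟩

lemma exists_locMap_mul_torusEltStar {x : ModifiedHallAlgebra hS} {b : HallIndex A} {q : ℚ}
    (hq : q ≠ 0) (hx : locMap hS x = Finsupp.single b q) (α : K0 A) : ∃ q' : ℚ, q' ≠ 0 ∧
      locMap hS (x * torusEltStar hS α) = Finsupp.single (shift (0, α) b) q' := by
  obtain ⟨q', hq', e⟩ := exists_locMap_mul_frac_cls hS hq hx
    (acyclic_coneStar (K0.exists_eq_sub α).choose.1)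
    (acyclic_coneStar (K0.exists_eq_sub α).choose.2)
  rw [bd_coneStar, bd_coneStar, Prod.mk_sub_mk, sub_zero, ← (K0.exists_eq_sub α).choose_spec] at e
  rw [torusEltStar, torusFracStar, mul_smul_comm, map_smul, e, Finsupp.smul_single]
  exact ⟨_, smul_ne_zero (inv_ne_zero (div_ne_zero (eulerForm_ne_zero _ _)
    (eulerForm_ne_zero _ _))) hq', rfl⟩

lemma exists_locMap_monomial (X Y : A) (α β : K0 A) : ∃ q : ℚ, q ≠ 0 ∧
    locMap hS (mhCls hS (stalk X ⊞ stalkStar Y) * torusElt hS α * torusEltStar hS β) =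
      Finsupp.single ((IsoClass.mk X, IsoClass.mk Y, α, β) : HallIndex A) q := by
  obtain ⟨q, hq, e⟩ := exists_locMap_mul_torusElt hS one_ne_zero
    (locMap_mhCls hS (stalk X ⊞ stalkStar Y)) α
  obtain ⟨q', hq', e'⟩ := exists_locMap_mul_torusEltStar hS hq e β
  refine ⟨q', hq', e'.trans ?_⟩
  have e'' : index (stalk X ⊞ stalkStar Y) =
    ((IsoClass.mk X, IsoClass.mk Y, 0) : HallIndex A) := index_stalk X Y
  rw [shift_shift, e'']
  simp [shift]

/-- Every index vector is reached, up to a nonzero scalar, by its monomial. -/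
lemma locMap_bijective : Function.Bijective (locMap hS) := by
  refine ⟨locMap_injective hS, LinearMap.range_eq_top.1 (eq_top_iff.2 fun v _ => ?_)⟩
  induction v using Finsupp.induction_linear with
  | zero => exact zero_mem _
  | add v w hv hw => exact add_mem (hv trivial) (hw trivial)
  | single b r =>
    obtain ⟨c, d, α, β⟩ := b
    obtain ⟨X, rfl⟩ := IsoClass.exists_mk c
    obtain ⟨Y, rfl⟩ := IsoClass.exists_mk d
    obtain ⟨q, hq, e⟩ := exists_locMap_monomial hS X Y α β
    refine ⟨(r * q⁻¹) • (mhCls hS (stalk X ⊞ stalkStar Y) * torusElt hS α * torusEltStar hS β), ?_⟩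
    rw [map_smul, e, Finsupp.smul_single, smul_eq_mul, inv_mul_cancel_right₀ hq]

/-- The monomials form a basis of the modified Hall algebra. -/
lemma exists_basis : ∃ b : Module.Basis (HallIndex A) ℚ (ModifiedHallAlgebra hS),
    ∀ (X Y : A) (α β : K0 A), b (IsoClass.mk X, IsoClass.mk Y, α, β) =
      mhCls hS (stalk X ⊞ stalkStar Y) * torusElt hS α * torusEltStar hS β := by
  let Θ := LinearEquiv.ofBijective (locMap hS) (locMap_bijective hS)
  have key : ∀ i : HallIndex A, ∃ q : ℚˣ, ∀ (X Y : A) (α β : K0 A),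
      i = (IsoClass.mk X, IsoClass.mk Y, α, β) →
        locMap hS (mhCls hS (stalk X ⊞ stalkStar Y) * torusElt hS α * torusEltStar hS β) =
          Finsupp.single i (q : ℚ) := by
    rintro ⟨c, d, α, β⟩
    obtain ⟨X, rfl⟩ := IsoClass.exists_mk c
    obtain ⟨Y, rfl⟩ := IsoClass.exists_mk d
    obtain ⟨q, hq, e⟩ := exists_locMap_monomial hS X Y α β
    refine ⟨Units.mk0 q hq, ?_⟩
    rintro X' Y' α' β' hi
    simp only [Prod.mk.injEq] at hi
    obtain ⟨hX, hY, rfl, rfl⟩ := hi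
    have hM : mhCls hS (stalk X' ⊞ stalkStar Y') = mhCls hS (stalk X ⊞ stalkStar Y) := by
      apply locMap_injective hS
      rw [locMap_mhCls, locMap_mhCls]
      congr 1
      refine (index_stalk X' Y').trans (Eq.trans ?_ (index_stalk X Y).symm)
      rw [hX, hY]
    rw [hM]
    exact e
  choose q hq using key
  -- The standard basis pulled back along `locMap` is proportional to the monomials; rescaling by
  -- the units `q` makes them equal.
  refine ⟨(Module.Basis.ofRepr Θ).unitsSMul q, fun X Y α β => ?_⟩
  apply locMap_injective hS
  rw [Module.Basis.unitsSMul_apply, hq _ X Y α β rfl, Units.smul_def, map_smul,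
    Module.Basis.coe_ofRepr]
  refine (congrArg _ (Θ.apply_symm_apply _)).trans ?_
  rw [Finsupp.smul_single, smul_eq_mul, mul_one]

end Torus

end

end ModifiedHall

open ModifiedHall in
theorem corollary3p13 {k : Type*} [Field k] [Finite k] {A : Type*} [Category A] [Abelian A]
    [Linear k A]
    (hHom : ∀ X Y : A, Module.Finite k (X ⟶ Y))
    (hExt : ∀ (X Y : A) (n : ℕ), Module.Finite k (Ext X Y n))
    (hHer : IsHereditary A) :
    ∃ (h : IsHallAlgebra (Z2Complex A)) (hS : IsRightDenominatorSet (acyclicClasses h)),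
      (∀ X Y : A, torusElt hS (K0.of X - K0.of Y) = torusFrac hS X Y) ∧
      (∀ X Y : A, torusEltStar hS (K0.of X - K0.of Y) = torusFracStar hS X Y) ∧
      ∃ b : Module.Basis (IsoClass A × IsoClass A × K0 A × K0 A) ℚ (ModifiedHallAlgebra hS),
        ∀ (X Y : A) (α β : K0 A),
          b (IsoClass.mk X, IsoClass.mk Y, α, β) =
            mhCls hS (stalk X ⊞ stalkStar Y) * torusElt hS α * torusEltStar hS β := by
  have : ∀ X Y : A, Finite (X ⟶ Y) := fun X Y => by
    have := hHom X Y
    exact Module.finite_of_finite k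
  have : ∀ X Y : A, Finite (Ext X Y 1) := fun X Y => by
    have := hExt X Y 1
    exact Module.finite_of_finite k
  have : Fact (IsHereditary A) := ⟨hHer⟩
  exact ⟨isHallAlgebra _, isRightDenominatorSet _, torusElt_sub _, torusEltStar_sub _, exists_basis _⟩
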